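/- Let $n\ge 2$ and let $\Omega\subset\mathbb{R}^n$ be a bounded connected open set with Lipschitz boundary. Let $\mathcal{A}$ be a non-empty compact metric space, let $b:\overline\Omega\times\mathcal{A}\to\mathbb{R}^n$ and $f:\overline\Omega\times\mathcal{A}\to\mathbb{R}$ be uniformly continuous, put $\|b\|_C:=\sup_{\overline\Omega\times\mathcal{A}}|b|$, and let $$H(x,p):=\sup_{\alpha\in\mathcal{A}}\big(b(x,\alpha)\cdot p-f(x,\alpha)\big),\qquad \partial_pH(x,p):=\{c\in\mathbb{R}^n: H(x,q)\ge H(x,p)+c\cdot(q-p)\ \ \forall q\in\mathbb{R}^n\}.$$ For $v\in H^1_0(\Omega)$ let $D_pH[v]$ be the set of all $\tilde b\in L^\infty(\Omega;\mathbb{R}^n)$ with $\tilde b(x)\in\partial_pH(x,\nabla v(x))$ for a.e. $x\in\Omega$. Let $\nu>0$, $\kappa\ge 0$, $G\in H^{-1}(\Omega)=H^1_0(\Omega)^*$, and let $F:L^2(\Omega)\to H^{-1}(\Omega)$ satisfy, with constants $c_1,c_2\ge0$, $\|F[z]\|_{H^{-1}}\le c_1(\|z\|_{L^2}+1)$ and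 $\|F[z_1]-F[z_2]\|_{H^{-1}}\le c_2\|z_1-z_2\|_{L^2}$ for all $z,z_1,z_2\in L^2(\Omega)$. A conforming mesh of $\Omega$ is a finite collection $\mathcal{T}$ of closed nondegenerate $n$-simplices with pairwise disjoint interiors and union $\overline\Omega$ (so that $\Omega$ is a polyhedron) such that for distinct $K,K'\in\mathcal{T}$ the set $\partial K\cap\partial K'$ is the convex hull of a (possibly empty) set of vertices of $K$. For $K\in\mathcal{T}$ let $\psi^K_0,\dots,\psi^K_n$ be the nodal hat functions of its $n+1$ vertices, restricted to $K$. Let $\{\mathcal{T}_k\}_{k\in\mathbb{N}}$ be a sequence of conforming meshes of $\Omega$ that is strictly acute: there is $\theta\in(0,\pi/2)$ with $$\nabla\psi^K_i\cdot\nabla\psi^K_j\le-\sin(\theta)\,|\nabla\psi^K_i|\,|\nabla\psi^K_j|\qquad\forall k\in\mathbb{N},\ \forall K\in\mathcal{T}_k,\ \forall i\ne j .$$ Let $V_k:=\{v\in H^1_0(\Omega): v|_K \text{ is affine for all } K\in\mathcal{T}_k\}$ and $\sigma^k:=\min_{K\in\mathcal{T}_k}\operatorname{diam}(K)\min_{0\le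 i\le n}|\nabla\psi^K_i|$. Fix $\mu>1$ and define the artificial diffusion coefficient $\gamma_k$ elementwise by $$\gamma_k|_K:=\max\Big(\mu\,\frac{\|b\|_C\operatorname{diam}(K)+\kappa\operatorname{diam}(K)^2}{\sigma^k\sin(\theta)}-\nu,\;0\Big),\qquad K\in\mathcal{T}_k .$$ Suppose that $F$ is strictly monotone, i.e. for $m_1,m_2\in H^1_0(\Omega)$, $\langle F[m_1]-F[m_2],m_1-m_2\rangle_{H^{-1}\times H^1_0}\le0$ implies $m_1=m_2$, and that $G$ is non-negative in the sense of distributions, i.e. $\langle G,\phi\rangle_{H^{-1}\times H^1_0}\ge0$ for all $\phi\in H^1_0(\Omega)$ with $\phi\ge0$ a.e. in $\Omega$. Then for each $k\in\mathbb{N}$ there exists a unique pair $(u_k,m_k)\in V_k\times V_k$ for which there is some $\tilde b_k\in D_pH[u_k]$ such that $$\int_\Omega(\nu+\gamma_k)\nabla u_k\cdot\nabla\psi+H(x,\nabla u_k)\psi+\kappa u_k\psi\,\mathrm{d}x=\langle F[m_k],\psi\rangle_{H^{-1}\times H^1_0}\quad\forall\psi\in V_k,$$ $$\int_\Omega(\nu+\gamma_k)\nabla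 m_k\cdot\nabla\phi+m_k\tilde b_k\cdot\nabla\phi+\kappa m_k\phi\,\mathrm{d}x=\langle G,\phi\rangle_{H^{-1}\times H^1_0}\quad\forall\phi\in V_k.$$ -/

import Mathlib

noncomputable section

namespace MFG

open MeasureTheory Set
open scoped ContDiff ENNReal

/-- `ℝⁿ` with its Euclidean norm. -/
abbrev Euc (n : ℕ) : Type := EuclideanSpace ℝ (Fin n)

variable {n : ℕ}

/-- `Ω` has a Lipschitz boundary: near each boundary point, for a suitable unit vector `e`, the set
`Ω` consists of the points that lie strictly above (in direction `e`) the graph of a Lipschitz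
function over the hyperplane orthogonal to `e`. -/
def HasLipschitzBoundary (Ω : Set (Euc n)) : Prop :=
  ∀ x ∈ frontier Ω, ∃ r > (0 : ℝ), ∃ e : Euc n, ‖e‖ = 1 ∧
    ∃ (L : NNReal) (g : (ℝ ∙ e)ᗮ → ℝ), LipschitzWith L g ∧
      ∀ y ∈ Metric.ball x r, y ∈ Ω ↔ g ((ℝ ∙ e)ᗮ.orthogonalProjectionOnto y) < inner ℝ e y

/-! ### The spaces `L²(Ω)`, `H¹₀(Ω)`, `H⁻¹(Ω)` -/

/-- `L²(Ω)`. -/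
abbrev L2 (Ω : Set (Euc n)) : Type := Lp ℝ 2 (volume.restrict Ω)

/-- `L²(Ω; ℝⁿ)`. -/
abbrev L2Vec (Ω : Set (Euc n)) : Type := Lp (Euc n) 2 (volume.restrict Ω)

/-- `L^∞(Ω; ℝⁿ)`. -/
abbrev LInftyVec (Ω : Set (Euc n)) : Type := Lp (Euc n) ∞ (volume.restrict Ω)

/-- The pairs `(φ, ∇φ)` with `φ ∈ C_c^∞(Ω)`, as classes in `L²(Ω) × L²(Ω; ℝⁿ)`. -/
def testPairs (Ω : Set (Euc n)) : Set (WithLp 2 (L2 Ω × L2Vec Ω)) :=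
  {w | ∃ φ : Euc n → ℝ, ContDiff ℝ ∞ φ ∧ HasCompactSupport φ ∧ tsupport φ ⊆ Ω ∧
    w.fst =ᵐ[volume.restrict Ω] φ ∧ w.snd =ᵐ[volume.restrict Ω] gradient φ}

/-- `H¹₀(Ω)`, the closure of `C_c^∞(Ω)` in the norm `(‖v‖² + ‖∇v‖²)^{1/2}`. A function `v` is
represented by the pair `(v, ∇v)` of itself and its weak gradient. -/
def H01 (Ω : Set (Euc n)) : Submodule ℝ (WithLp 2 (L2 Ω × L2Vec Ω)) :=
  (Submodule.span ℝ (testPairs Ω)).topologicalClosure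

/-- The embedding of `H¹₀(Ω)` into `L²(Ω)`. -/
def fn {Ω : Set (Euc n)} (v : H01 Ω) : L2 Ω := (v : WithLp 2 (L2 Ω × L2Vec Ω)).fst

/-- The weak gradient. -/
def grad {Ω : Set (Euc n)} (v : H01 Ω) : L2Vec Ω := (v : WithLp 2 (L2 Ω × L2Vec Ω)).snd

/-- `H⁻¹(Ω)`, the dual of `H¹₀(Ω)` with the dual norm; the duality pairing is application. -/
abbrev HMinus1 (Ω : Set (Euc n)) : Type := StrongDual ℝ (H01 Ω)

/-- Strict monotonicity of `F : L²(Ω) → H⁻¹(Ω)`, tested on `H¹₀(Ω)`. -/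
def StrictlyMonotone {Ω : Set (Euc n)} (F : L2 Ω → HMinus1 Ω) : Prop :=
  ∀ m₁ m₂ : H01 Ω, (F (fn m₁) - F (fn m₂)) (m₁ - m₂) ≤ 0 → m₁ = m₂

/-- Non-negativity of `G ∈ H⁻¹(Ω)` in the sense of distributions. -/
def NonnegDistribution {Ω : Set (Euc n)} (G : HMinus1 Ω) : Prop :=
  ∀ φ : H01 Ω, (∀ᵐ x ∂volume.restrict Ω, 0 ≤ fn φ x) → 0 ≤ G φ

/-! ### The Hamiltonian and its subdifferential -/

variable {A : Type*}

/-- `H(x,p) = sup_α (b(x,α)·p - f(x,α))`. -/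
def hamiltonian (b : Euc n → A → Euc n) (f : Euc n → A → ℝ) (x p : Euc n) : ℝ :=
  ⨆ α : A, (inner ℝ (b x α) p - f x α)

/-- The Moreau–Rockafellar partial subdifferential `∂_p H(x,p)`. -/
def subdiff (b : Euc n → A → Euc n) (f : Euc n → A → ℝ) (x p : Euc n) : Set (Euc n) :=
  {c | ∀ q : Euc n, hamiltonian b f x p + inner ℝ c (q - p) ≤ hamiltonian b f x q}

/-- The set `D_pH[v]` of (classes of) essentially bounded measurable selections of
`∂_p H(·, ∇v(·))`. -/
def DpH {Ω : Set (Euc n)} (b : Euc n → A → Euc n) (f : Euc n → A → ℝ) (v : H01 Ω) :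
    Set (LInftyVec Ω) :=
  {c | ∀ᵐ x ∂volume.restrict Ω, c x ∈ subdiff b f x (grad v x)}

/-- `‖b‖_{C(closure Ω × A)}`. -/
def supNorm (Ω : Set (Euc n)) (b : Euc n → A → Euc n) : ℝ :=
  ⨆ p : closure Ω × A, ‖b p.1 p.2‖

/-! ### Meshes

A nondegenerate `n`-simplex in `ℝⁿ` is given by its `n + 1` vertices, an affine basis `K` of `ℝⁿ`.
The barycentric coordinate `K.coord i` is the restriction to the simplex of the nodal hat function
attached to the vertex `K i`. -/

/-- Vertices of a nondegenerate `n`-simplex in `ℝⁿ`. -/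
abbrev Simp (n : ℕ) : Type := AffineBasis (Fin (n + 1)) ℝ (Euc n)

/-- The closed simplex. -/
def Simp.cell (K : Simp n) : Set (Euc n) := convexHull ℝ (range K)

/-- The (constant) gradient on `K` of the nodal hat function of the `i`-th vertex. -/
def Simp.hatGrad (K : Simp n) (i : Fin (n + 1)) : Euc n :=
  (InnerProductSpace.toDual ℝ (Euc n)).symm (LinearMap.toContinuousLinearMap (K.coord i).linear)

/-- `diam(K)`. -/
def Simp.diam (K : Simp n) : ℝ := Metric.diam K.cell

/-- `σ_K = diam(K) · min_i |∇ψ_i|`. -/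
def Simp.sigma (K : Simp n) : ℝ := K.diam * ⨅ i, ‖K.hatGrad i‖

/-- A conforming simplicial mesh of `Ω`. -/
structure Mesh (Ω : Set (Euc n)) where
  elements : Finset (Simp n)
  iUnion_eq : ⋃ K ∈ elements, K.cell = closure Ω
  disjoint_interior : ∀ K ∈ elements, ∀ K' ∈ elements, K ≠ K' →
    Disjoint (interior K.cell) (interior K'.cell)
  conforming : ∀ K ∈ elements, ∀ K' ∈ elements, K ≠ K' →
    ∃ S ⊆ range K, frontier K.cell ∩ frontier K'.cell = convexHull ℝ S

namespace Mesh

variable {Ω : Set (Euc n)}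

/-- `σ = min_K σ_K`. -/
def sigma (T : Mesh Ω) : ℝ := ⨅ K : {K // K ∈ T.elements}, K.1.sigma

/-- Strict acuteness with angle `θ`. -/
def StrictlyAcute (T : Mesh Ω) (θ : ℝ) : Prop :=
  ∀ K ∈ T.elements, ∀ i j : Fin (n + 1), i ≠ j →
    inner ℝ (K.hatGrad i) (K.hatGrad j) ≤ -Real.sin θ * ‖K.hatGrad i‖ * ‖K.hatGrad j‖

/-- The finite element space of functions in `H¹₀(Ω)` that agree with an affine function (a
polynomial of total degree at most one) on each element. -/
def V (T : Mesh Ω) : Set (H01 Ω) :=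
  {v | ∀ K ∈ T.elements, ∃ a : Euc n →ᵃ[ℝ] ℝ,
    ∀ᵐ x ∂volume.restrict Ω, x ∈ K.cell → fn v x = a x}

/-- The value on the element `K` of the artificial diffusion coefficient; `β` stands for
`‖b‖_{C(closure Ω × A)}`. -/
def gammaOn (T : Mesh Ω) (ν κ μ θ β : ℝ) (K : Simp n) : ℝ :=
  max (μ * ((β * K.diam + κ * K.diam ^ 2) / (T.sigma * Real.sin θ)) - ν) 0

/-- The elementwise constant artificial diffusion coefficient. It is set to zero on the element
boundaries, a null set. -/
def gamma (T : Mesh Ω) (ν κ μ θ β : ℝ) (x : Euc n) : ℝ :=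
  ∑ K ∈ T.elements, (interior K.cell).indicator (fun _ => T.gammaOn ν κ μ θ β K) x

/-- `(u, m)` solves the finite element discretisation of the mean field game partial differential
inclusion on the mesh `T`. -/
def IsDiscreteSolution (T : Mesh Ω) (b : Euc n → A → Euc n) (f : Euc n → A → ℝ) (ν κ μ θ : ℝ)
    (F : L2 Ω → HMinus1 Ω) (G : HMinus1 Ω) (u m : H01 Ω) : Prop :=
  u ∈ T.V ∧ m ∈ T.V ∧ ∃ c ∈ DpH b f u,
    (∀ ψ ∈ T.V,
      ∫ x in Ω, ((ν + T.gamma ν κ μ θ (supNorm Ω b) x) * inner ℝ (grad u x) (grad ψ x)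
        + hamiltonian b f x (grad u x) * fn ψ x + κ * fn u x * fn ψ x) = F (fn m) ψ) ∧
    (∀ φ ∈ T.V,
      ∫ x in Ω, ((ν + T.gamma ν κ μ θ (supNorm Ω b) x) * inner ℝ (grad m x) (grad φ x)
        + fn m x * inner ℝ (c x) (grad φ x) + κ * fn m x * fn φ x) = G φ)

end Mesh

end MFG

end

/-! Expand `u` and `m` in the hat functions of the interior vertices. The Hamilton–Jacobi–Bellman
equation becomes `L u = Φ m`, where every component of `L` is convex because hat functions are
non-negative. The Kolmogorov–Fokker–Planck equation says that the transpose of a linearisation of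
`L` at `u`, built from a selection of the subdifferential, maps `m` to `G ≥ 0`.

Discrete maximum principle. Strict acuteness and the artificial diffusion make `L`, and every linear
operator with drift bounded by `‖b‖_C`, quasi-monotone: off-diagonal contributions are non-positive
(`Mesh.diffusion_dominates`). A vector with nodal values `M - exp (t⟪η, ·⟫)` is a strict
supersolution for all these operators at once (`Mesh.exists_supersolution`). Hence a comparison
principle holds for `L`, and by transposition every solution `m` is non-negative
(`Scheme.nonneg_of_kfp`).

Uniqueness is the Lasry–Lions argument (`Scheme.eq_of_solutions`): cross-testing two solutions,
convexity of `L` and non-negativity of both densities give `⟨F m₁ - F m₂, m₁ - m₂⟩ ≤ 0`. So the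
densities agree, and comparison identifies the value functions.

Existence avoids fixed points of set-valued maps. The second equation is the optimality condition
for `u` to minimise the convex function `v ↦ ∑ mᵢ (L v)ᵢ - ∑ Gᵢ vᵢ`, so the system is a saddle-point
problem perturbed by the monotone map `Φ`. It is solved on a compact convex truncation by Sion's
minimax theorem and Minty's trick (`exists_equilibrium`). For `G > 0` the maximum principle shows
that no constraint of the truncation binds; general `G` follows by a limit (`exists_game_solution`).
The drift is recovered from minimality in `Scheme.exists_selection`: separation in finite dimensions
produces approximate drifts, and nested closed convex sets in `L²` produce an exact one.

It remains to identify the finite element space with the span of the hat functions. Mollification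
puts Lipschitz functions that vanish off `Ω` into `H¹₀(Ω)`; conversely, a discrete function has
bounded gradient, hence a Lipschitz representative that vanishes off `Ω` and is determined by its
nodal values. The Lipschitz boundary enters only through `interior (closure Ω) = Ω`. -/

noncomputable section

namespace MFG

open MeasureTheory Set
open scoped ContDiff ENNReal

open Filter Topology

/-! ### Convex analysis: nested convex sets and monotone equilibrium problems -/

/-- In a Hilbert space, a decreasing sequence of non-empty closed bounded convex sets has a common
point. -/
theorem exists_mem_iInter_of_antitone_convex {X : Type*} [NormedAddCommGroup X]
    [InnerProductSpace ℝ X] [CompleteSpace X] (C : ℕ → Set X) (hanti : Antitone C)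
    (hcl : ∀ k, IsClosed (C k)) (hconv : ∀ k, Convex ℝ (C k)) (hne : ∀ k, (C k).Nonempty)
    {M : ℝ} (hbdd : ∀ x ∈ C 0, ‖x‖ ≤ M) : ∃ x, ∀ k, x ∈ C k := by
  have hmin : ∀ k, ∃ x ∈ C k, ∀ y ∈ C k, inner ℝ (0 - x) (y - x) ≤ 0 := by
    intro k
    obtain ⟨v, hv, hv'⟩ := exists_norm_eq_iInf_of_complete_convex (hne k) (hcl k).isComplete
      (hconv k) 0
    exact ⟨v, hv, (norm_eq_iInf_iff_real_inner_le_zero (hconv k) hv).1 hv'⟩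
  choose x hx hxmin using hmin
  -- `x k` is the projection of the origin onto `C k`. The obtuse-angle condition at `x k`, tested
  -- with `x j`, lets increments of the squared norm control distances; these norms increase and are
  -- bounded, so `x` is Cauchy.
  have key : ∀ j k, k ≤ j → ‖x j - x k‖ ^ 2 ≤ ‖x j‖ ^ 2 - ‖x k‖ ^ 2 := by
    intro j k hkj
    have h1 := hxmin k (x j) (hanti hkj (hx j))
    have h2 : ‖x j‖ ^ 2 = ‖x j - x k‖ ^ 2 + 2 * inner ℝ (x j - x k) (x k) + ‖x k‖ ^ 2 := by
      rw [← norm_add_sq_real]; simp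
    have h3 : inner ℝ (0 - x k) (x j - x k) = - inner ℝ (x j - x k) (x k) := by
      rw [zero_sub, inner_neg_left, real_inner_comm]
    linarith
  have hmono : Monotone fun k => ‖x k‖ ^ 2 := by
    intro k j hkj
    have := key j k hkj
    have h0 := sq_nonneg ‖x j - x k‖
    simp only
    linarith
  have hbd : BddAbove (range fun k => ‖x k‖ ^ 2) := by
    refine ⟨M ^ 2, ?_⟩
    rintro _ ⟨k, rfl⟩
    have := hbdd (x k) (hanti (Nat.zero_le k) (hx k))
    exact pow_le_pow_left₀ (norm_nonneg _) this 2
  have hlim := tendsto_atTop_ciSup hmono hbd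
  have hcs : CauchySeq x := by
    rw [Metric.cauchySeq_iff']
    intro ε hε
    have hc := hlim.cauchySeq
    rw [Metric.cauchySeq_iff'] at hc
    obtain ⟨N, hN⟩ := hc (ε ^ 2) (by positivity)
    refine ⟨N, fun k hk => ?_⟩
    have h1 := key k N hk
    have h2 := hN k hk
    rw [Real.dist_eq] at h2
    have h3 := le_abs_self (‖x k‖ ^ 2 - ‖x N‖ ^ 2)
    rw [dist_eq_norm]
    exact lt_of_pow_lt_pow_left₀ 2 hε.le (by linarith)
  obtain ⟨y, hy⟩ := cauchySeq_tendsto_of_complete hcs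
  refine ⟨y, fun k => (hcl k).mem_of_tendsto hy ?_⟩
  filter_upwards [eventually_ge_atTop k] with j hj using hanti hj (hx j)

/-- A monotone equilibrium problem on a compact convex set has a solution. -/
theorem exists_equilibrium {E : Type*} [TopologicalSpace E] [AddCommGroup E] [Module ℝ E]
    [IsTopologicalAddGroup E] [ContinuousSMul ℝ E] [T2Space E] {C : Set E} (hne : C.Nonempty)
    (hconv : Convex ℝ C) (hcomp : IsCompact C) (φ : E → E → ℝ) (hzero : ∀ x ∈ C, φ x x = 0)
    (hmono : ∀ x ∈ C, ∀ y ∈ C, φ x y + φ y x ≤ 0) (hcvx : ∀ x ∈ C, ConvexOn ℝ C (φ x))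
    (hcont₂ : ∀ x ∈ C, ContinuousOn (φ x) C) (hcont₁ : ∀ y ∈ C, ContinuousOn (fun x => φ x y) C) :
    ∃ z ∈ C, ∀ y ∈ C, 0 ≤ φ z y := by
  have hminty : ∃ z ∈ C, ∀ y ∈ C, φ y z ≤ 0 := by
    -- By compactness finitely many test points suffice. A saddle point `(a, l)` of the mixture `∑
    -- lᵢ φ i z` is compared with the barycentre `x = ∑ lⱼ j`: convexity bounds the mixture at `x`
    -- by the double sum of `lᵢ lⱼ φ i j`, which is non-positive after symmetrising by monotonicity.
    have hfin : ∀ s : Finset C, (C ∩ ⋂ y ∈ s, {z ∈ C | φ y z ≤ 0}).Nonempty := by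
      intro s
      rcases s.eq_empty_or_nonempty with rfl | hs
      · simpa using hne
      classical
      have : Nonempty s := hs.to_subtype
      obtain ⟨a, ha, l, hl, hal⟩ := Sion.exists_isSaddlePointOn (X := C)
        (Y := stdSimplex ℝ s) (f := fun z l => ∑ i : s, l i * φ i z) hne hconv hcomp
        (fun l hl => by
          apply ContinuousOn.lowerSemicontinuousOn
          exact continuousOn_finsetSum _ fun i _ => continuousOn_const.mul (hcont₂ i i.1.2))
        (fun l hl => by
          apply ConvexOn.quasiconvexOn
          refine ⟨hconv, fun x hx y hy p q hp hq hpq => ?_⟩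
          simp only [smul_eq_mul, Finset.mul_sum, ← Finset.sum_add_distrib]
          refine Finset.sum_le_sum fun i _ => ?_
          have h := (hcvx i i.1.2).2 hx hy hp hq hpq
          simp only [smul_eq_mul] at h
          have := mul_le_mul_of_nonneg_left h (hl.1 i)
          linarith)
        (convex_stdSimplex ℝ s) ⟨_, single_mem_stdSimplex ℝ (Classical.arbitrary s)⟩
        (isCompact_stdSimplex ℝ s)
        (fun x hx => by
          apply ContinuousOn.upperSemicontinuousOn
          fun_prop)
        (fun x hx => by
          apply ConcaveOn.quasiconcaveOn
          refine ⟨convex_stdSimplex ℝ s, fun y _ z _ p q hp hq hpq => le_of_eq ?_⟩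
          simp only [smul_eq_mul, Finset.mul_sum, ← Finset.sum_add_distrib, Pi.add_apply,
            Pi.smul_apply]
          exact Finset.sum_congr rfl fun i _ => by ring)
      refine ⟨a, ha, ?_⟩
      simp only [mem_iInter]
      intro y hy
      refine ⟨ha, ?_⟩
      set x : E := ∑ j : s, l j • (j.1.1 : E) with hx
      have hxC : x ∈ C := hconv.sum_mem (fun i _ => hl.1 i) hl.2 (fun i _ => i.1.2)
      have h1 := hal x hxC _ (single_mem_stdSimplex ℝ (⟨y, hy⟩ : s))
      have h2 : ∑ i : s, (Pi.single (⟨y, hy⟩ : s) (1 : ℝ) : s → ℝ) i * φ i a = φ y a := by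
        rw [Finset.sum_eq_single ⟨y, hy⟩]
        · simp
        · intro j _ hj; simp [hj]
        · simp
      have h3 : ∀ i : s, φ i x ≤ ∑ j : s, l j * φ i j := fun i => by
        have := (hcvx i i.1.2).map_sum_le (t := Finset.univ) (w := l)
          (p := fun j : s => (j.1.1 : E)) (fun i _ => hl.1 i) hl.2 (fun i _ => i.1.2)
        simpa only [smul_eq_mul] using this
      have h4 : ∑ i : s, l i * φ i x ≤ ∑ i : s, ∑ j : s, l i * l j * φ i j := by
        refine Finset.sum_le_sum fun i _ => ?_
        have := mul_le_mul_of_nonneg_left (h3 i) (hl.1 i)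
        simpa [Finset.mul_sum, mul_assoc] using this
      have h5 : ∑ i : s, ∑ j : s, l i * l j * φ i j + ∑ i : s, ∑ j : s, l i * l j * φ i j ≤ 0 := by
        nth_rewrite 2 [Finset.sum_comm]
        rw [← Finset.sum_add_distrib]
        refine Finset.sum_nonpos fun i _ => ?_
        rw [← Finset.sum_add_distrib]
        refine Finset.sum_nonpos fun j _ => ?_
        have := mul_nonpos_of_nonneg_of_nonpos (mul_nonneg (hl.1 i) (hl.1 j))
          (hmono i i.1.2 j j.1.2)
        linarith
      have h6 : φ y a ≤ ∑ i : s, l i * φ i x := by rw [← h2]; exact h1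
      exact h6.trans (by linarith)
    obtain ⟨z, hz, hz'⟩ := hcomp.inter_iInter_nonempty (fun y : C => {z ∈ C | φ y z ≤ 0})
      (fun y => by
        have := (hcont₂ y y.2).preimage_isClosed_of_isClosed hcomp.isClosed isClosed_Iic (t := Iic 0)
        exact this) hfin
    simp only [mem_iInter] at hz'
    exact ⟨z, hz, fun y hy => (hz' ⟨y, hy⟩).2⟩
  obtain ⟨z, hz, hzy⟩ := hminty
  refine ⟨z, hz, fun y hy => ?_⟩
  -- Minty's trick: on the segment from `z` to `y`, `φ (p t) (p t) = 0` and `φ (p t) z ≤ 0`, so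
  -- convexity forces `φ (p t) y ≥ 0`; then `t → 0`.
  set p : ℝ → E := fun t => (1 - t) • z + t • y with hp
  have hpC : ∀ t ∈ Icc (0 : ℝ) 1, p t ∈ C := fun t ht =>
    hconv hz hy (by linarith [ht.2]) ht.1 (by ring)
  have hpos : ∀ t ∈ Ioc (0 : ℝ) 1, 0 ≤ φ (p t) y := by
    intro t ht
    have hpt := hpC t ⟨ht.1.le, ht.2⟩
    have h1 := (hcvx (p t) hpt).2 hz hy (by linarith [ht.2] : (0 : ℝ) ≤ 1 - t) ht.1.le (by ring)
    have h2 : φ (p t) ((1 - t) • z + t • y) = 0 := hzero _ hpt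
    rw [h2] at h1
    simp only [smul_eq_mul] at h1
    have h3 := mul_nonpos_of_nonneg_of_nonpos (by linarith [ht.2] : (0 : ℝ) ≤ 1 - t) (hzy _ hpt)
    exact nonneg_of_mul_nonneg_right (by linarith) ht.1
  have hcts : ContinuousOn (fun t => φ (p t) y) (Icc 0 1) :=
    (hcont₁ y hy).comp (by fun_prop) hpC
  have h0 : Tendsto (fun t => φ (p t) y) (𝓝[Ioc 0 1] 0) (𝓝 (φ (p 0) y)) :=
    (hcts 0 (by simp)).mono_left (nhdsWithin_mono _ Ioc_subset_Icc_self)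
  have hp0 : p 0 = z := by simp [hp]
  rw [hp0] at h0
  have : (𝓝[Ioc (0 : ℝ) 1] 0).NeBot := by
    rw [← mem_closure_iff_nhdsWithin_neBot, closure_Ioc (by norm_num)]; simp
  exact ge_of_tendsto h0 (eventually_nhdsWithin_of_forall hpos)

/-! ### The finite-dimensional game -/

section FiniteSystem

variable {ι : Type*} [Fintype ι]

/-- A discrete operator `L` that satisfies a maximum principle: it is quasi-monotone, and `e` is a
positive vector that acts as a uniform strict supersolution. -/
structure HasComparison (L : (ι → ℝ) → ι → ℝ) (e : ι → ℝ) : Prop where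
  pos : ∀ i, 0 < e i
  quasi : ∀ u w i, u ≤ w → u i = w i → L w i ≤ L u i
  strict : ∀ u s i, 0 ≤ s → L (u - s • e) i ≤ L u i - s

/-- Let `t` be the largest ratio of `u - w` to `e`. If `t > 0`, then `w + t • e` touches `u` from
above at the maximising index. There quasi-monotonicity gives `L (w + t • e) ≤ L u`, and strictness
puts `L w` lower by at least `t`, contradicting `L u ≤ L w`. -/
theorem HasComparison.le_of_le {L : (ι → ℝ) → ι → ℝ} {e : ι → ℝ} (h : HasComparison L e)
    {u w : ι → ℝ} (huw : L u ≤ L w) : u ≤ w := by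
  rcases isEmpty_or_nonempty ι with hι | hι
  · intro i; exact (hι.false i).elim
  obtain ⟨i, hi⟩ := Finite.exists_max fun i => (u i - w i) / e i
  by_contra hcon
  have hpos : 0 < (u i - w i) / e i := by
    rw [Pi.le_def] at hcon
    push Not at hcon
    obtain ⟨j, hj⟩ := hcon
    exact lt_of_lt_of_le (div_pos (by linarith) (h.pos j)) (hi j)
  set t := (u i - w i) / e i with ht
  have h1 : u ≤ w + t • e := by
    intro j
    have := (div_le_iff₀ (h.pos j)).1 (hi j)
    simp only [Pi.add_apply, Pi.smul_apply, smul_eq_mul]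
    linarith
  have h2 : u i = (w + t • e) i := by
    simp only [Pi.add_apply, Pi.smul_apply, smul_eq_mul, ht]
    have := h.pos i
    field_simp
    ring
  have h3 := h.quasi _ _ i h1 h2
  have h4 := h.strict (w + t • e) t i hpos.le
  rw [add_sub_cancel_right] at h4
  linarith [huw i]

theorem HasComparison.eq_of_eq {L : (ι → ℝ) → ι → ℝ} {e : ι → ℝ} (h : HasComparison L e)
    {u w : ι → ℝ} (huw : L u = L w) : u = w :=
  le_antisymm (h.le_of_le huw.le) (h.le_of_le huw.ge)

/-- The transpose of a linear operator with a comparison principle is inverse-positive. -/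
theorem HasComparison.nonneg_of_transpose [DecidableEq ι] {L : (ι → ℝ) →ₗ[ℝ] (ι → ℝ)} {e : ι → ℝ}
    (h : HasComparison L e) {m G : ι → ℝ} (hG : ∀ i, 0 ≤ G i)
    (hm : ∀ w, ∑ i, m i * L w i = ∑ i, G i * w i) (i : ι) : 0 ≤ m i := by
  have hinj : Function.Injective L := fun u w huw => h.eq_of_eq huw
  -- `y` is a column of the inverse of `L`, non-negative by comparison; testing the transposed
  -- equation with it isolates `m i`.
  obtain ⟨y, hy⟩ := (LinearMap.injective_iff_surjective.1 hinj) (Pi.single i 1)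
  have hy0 : 0 ≤ y := h.le_of_le (by
    rw [hy, map_zero]
    intro j
    by_cases hj : j = i
    · subst hj; simp
    · simp [hj])
  have := hm y
  rw [hy, Finset.sum_eq_single i (fun j _ hj => by simp [hj]) (by simp)] at this
  simp only [Pi.single_eq_same, mul_one] at this
  rw [this]
  exact Finset.sum_nonneg fun j _ => mul_nonneg (hG j) (hy0 j)

/-- The convex set on which the truncated game is played. -/
def truncation (e : ι → ℝ) (R R' : ℝ) : Set ((ι → ℝ) × (ι → ℝ)) :=
  {z | (∀ i, |z.1 i| ≤ R * e i) ∧ (∀ i, 0 ≤ z.2 i) ∧ ∑ i, z.2 i ≤ R'}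

theorem isCompact_truncation (e : ι → ℝ) (R R' : ℝ) : IsCompact (truncation e R R') := by
  refine (isCompact_Icc (a := ((fun i => -(R * e i), fun _ => 0) : (ι → ℝ) × (ι → ℝ)))
    (b := (fun i => R * e i, fun _ => R'))).of_isClosed_subset ?_ ?_
  · have h1 : IsClosed {z : (ι → ℝ) × (ι → ℝ) | ∀ i, |z.1 i| ≤ R * e i} := by
      simp only [ofPred_forall]
      exact isClosed_iInter fun i => isClosed_le (by fun_prop) (by fun_prop)
    have h2 : IsClosed {z : (ι → ℝ) × (ι → ℝ) | ∀ i, 0 ≤ z.2 i} := by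
      simp only [ofPred_forall]
      exact isClosed_iInter fun i => isClosed_le (by fun_prop) (by fun_prop)
    have h3 : IsClosed {z : (ι → ℝ) × (ι → ℝ) | ∑ i, z.2 i ≤ R'} :=
      isClosed_le (by fun_prop) (by fun_prop)
    exact h1.inter (h2.inter h3)
  · rintro ⟨u, m⟩ ⟨h1, h2, h3⟩
    simp only at h1 h2 h3
    refine ⟨⟨fun i => (abs_le.1 (h1 i)).1, h2⟩, ⟨fun i => (abs_le.1 (h1 i)).2, fun i => ?_⟩⟩
    exact (Finset.single_le_sum (fun j _ => h2 j) (Finset.mem_univ i)).trans h3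

theorem convex_truncation (e : ι → ℝ) (R R' : ℝ) : Convex ℝ (truncation e R R') := by
  rintro ⟨u, m⟩ ⟨h1, h2, h3⟩ ⟨v, w⟩ ⟨k1, k2, k3⟩ a b ha hb hab
  simp only at h1 h2 h3 k1 k2 k3
  refine ⟨fun i => ?_, fun i => ?_, ?_⟩
  · simp only [Prod.fst_add, Prod.smul_fst, Pi.add_apply, Pi.smul_apply, smul_eq_mul]
    calc |a * u i + b * v i| ≤ a * |u i| + b * |v i| := by
          refine (abs_add_le _ _).trans ?_
          rw [abs_mul, abs_mul, abs_of_nonneg ha, abs_of_nonneg hb]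
      _ ≤ a * (R * e i) + b * (R * e i) := by gcongr <;> aesop
      _ = R * e i := by rw [← add_mul, hab, one_mul]
  · simp only [Prod.snd_add, Prod.smul_snd, Pi.add_apply, Pi.smul_apply, smul_eq_mul]
    have := h2 i; have := k2 i; positivity
  · simp only [Prod.snd_add, Prod.smul_snd, Pi.add_apply, Pi.smul_apply, smul_eq_mul,
      Finset.sum_add_distrib, ← Finset.mul_sum]
    calc a * ∑ i, m i + b * ∑ i, w i ≤ a * R' + b * R' := by gcongr
      _ = R' := by rw [← add_mul, hab, one_mul]

variable {L Φ : (ι → ℝ) → ι → ℝ} {e : ι → ℝ}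

/-- The variational inequality for the truncated game. -/
theorem exists_truncated_solution (he : HasComparison L e) (hconv : ∀ i, ConvexOn ℝ univ (L · i))
    (hcont : ∀ i, Continuous (L · i)) (hΦ : ∀ i, Continuous (Φ · i))
    (hΦmono : ∀ m w, 0 ≤ ∑ i, (Φ m i - Φ w i) * (m i - w i)) (G : ι → ℝ) {R R' : ℝ} (hR : 0 ≤ R)
    (hR' : 0 ≤ R') :
    ∃ z ∈ truncation e R R', (∀ v : ι → ℝ, (∀ i, |v i| ≤ R * e i) →
        ∑ i, G i * (v i - z.1 i) ≤ ∑ i, z.2 i * (L v i - L z.1 i)) ∧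
      ∀ w : ι → ℝ, (∀ i, 0 ≤ w i) → ∑ i, w i ≤ R' →
        0 ≤ ∑ i, (Φ z.2 i - L z.1 i) * (w i - z.2 i) := by
  -- With the Lagrangian `Λ(u, m) = ∑ mᵢ (L u)ᵢ - ∑ Gᵢ uᵢ`, this is `Λ(y.1, z.2) - Λ(z.1, y.2)` plus
  -- the `Φ` term. The Lagrangian part is antisymmetric, so monotonicity of `φ` is exactly that of
  -- `Φ`. Convexity in `y` needs `z.2 ≥ 0`, which the truncation supplies.
  set φ : (ι → ℝ) × (ι → ℝ) → (ι → ℝ) × (ι → ℝ) → ℝ := fun z y =>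
    (∑ i, z.2 i * L y.1 i - ∑ i, G i * y.1 i) - (∑ i, y.2 i * L z.1 i - ∑ i, G i * z.1 i)
      + ∑ i, Φ z.2 i * (y.2 i - z.2 i) with hφ
  obtain ⟨z, hz, hzy⟩ := exists_equilibrium (C := truncation e R R')
    ⟨0, fun i => by simpa using mul_nonneg hR (he.pos i).le, fun i => by simp, by simpa⟩
    (convex_truncation e R R') (isCompact_truncation e R R') φ
    (fun x _ => by simp [hφ])
    (fun x _ y _ => by
      have := hΦmono x.2 y.2
      have h2 : ∑ i, (Φ x.2 i - Φ y.2 i) * (x.2 i - y.2 i)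
          = - (∑ i, Φ x.2 i * (y.2 i - x.2 i) + ∑ i, Φ y.2 i * (x.2 i - y.2 i)) := by
        rw [← Finset.sum_add_distrib, ← Finset.sum_neg_distrib]
        exact Finset.sum_congr rfl fun i _ => by ring
      simp only [hφ]
      linarith)
    (fun x hx => by
      refine ⟨convex_truncation e R R', fun y _ w _ a b ha hb hab => ?_⟩
      have hL : ∀ i, x.2 i * L (a • y.1 + b • w.1) i
          ≤ a * (x.2 i * L y.1 i) + b * (x.2 i * L w.1 i) := fun i => by
        have h := (hconv i).2 (mem_univ y.1) (mem_univ w.1) ha hb hab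
        have := mul_le_mul_of_nonneg_left h (hx.2.1 i)
        simp only [smul_eq_mul] at this
        linarith
      have hL' := Finset.sum_le_sum fun i (_ : i ∈ Finset.univ) => hL i
      rw [Finset.sum_add_distrib, ← Finset.mul_sum, ← Finset.mul_sum] at hL'
      have e1 : ∑ i, G i * (a • y.1 + b • w.1) i
          = a * ∑ i, G i * y.1 i + b * ∑ i, G i * w.1 i := by
        rw [Finset.mul_sum, Finset.mul_sum, ← Finset.sum_add_distrib]
        exact Finset.sum_congr rfl fun i _ => by simp; ring
      have e2 : ∑ i, (a • y.2 + b • w.2) i * L x.1 i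
          = a * ∑ i, y.2 i * L x.1 i + b * ∑ i, w.2 i * L x.1 i := by
        rw [Finset.mul_sum, Finset.mul_sum, ← Finset.sum_add_distrib]
        exact Finset.sum_congr rfl fun i _ => by simp; ring
      have e3 : ∑ i, Φ x.2 i * ((a • y.2 + b • w.2) i - x.2 i)
          = a * ∑ i, Φ x.2 i * (y.2 i - x.2 i) + b * ∑ i, Φ x.2 i * (w.2 i - x.2 i) := by
        rw [Finset.mul_sum, Finset.mul_sum, ← Finset.sum_add_distrib]
        refine Finset.sum_congr rfl fun i _ => ?_
        simp only [Pi.add_apply, Pi.smul_apply, smul_eq_mul]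
        linear_combination (Φ x.2 i * x.2 i) * hab
      have e4 : ∑ i, G i * x.1 i = a * ∑ i, G i * x.1 i + b * ∑ i, G i * x.1 i := by
        rw [← add_mul, hab, one_mul]
      simp only [hφ, Prod.fst_add, Prod.smul_fst, Prod.snd_add, Prod.smul_snd, smul_eq_mul]
      rw [e1, e2, e3]
      linarith)
    (fun x _ => by
      have : ∀ i, Continuous fun y : (ι → ℝ) × (ι → ℝ) => L y.1 i :=
        fun i => (hcont i).comp continuous_fst
      exact Continuous.continuousOn (by fun_prop))
    (fun y _ => by
      have h1 : ∀ i, Continuous fun y : (ι → ℝ) × (ι → ℝ) => L y.1 i :=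
        fun i => (hcont i).comp continuous_fst
      have h2 : ∀ i, Continuous fun y : (ι → ℝ) × (ι → ℝ) => Φ y.2 i :=
        fun i => (hΦ i).comp continuous_snd
      exact Continuous.continuousOn (by fun_prop))
  refine ⟨z, hz, fun v hv => ?_, fun w hw hw' => ?_⟩
  · have := hzy (v, z.2) ⟨hv, hz.2.1, hz.2.2⟩
    simp only [hφ, sub_self, mul_zero, Finset.sum_const_zero, add_zero] at this
    simp only [mul_sub, Finset.sum_sub_distrib]
    linarith
  · have := hzy (z.1, w) ⟨hz.1, hw, hw'⟩
    simp only [hφ] at this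
    have e1 : ∑ i, (Φ z.2 i - L z.1 i) * (w i - z.2 i)
        = ∑ i, Φ z.2 i * (w i - z.2 i) - (∑ i, w i * L z.1 i - ∑ i, z.2 i * L z.1 i) := by
      rw [← Finset.sum_sub_distrib, ← Finset.sum_sub_distrib]
      exact Finset.sum_congr rfl fun i _ => by ring
    linarith

/-- For a strictly positive source the truncation is inactive. -/
theorem exists_solution_of_pos (he : HasComparison L e) (hconv : ∀ i, ConvexOn ℝ univ (L · i))
    (hcont : ∀ i, Continuous (L · i)) (hΦ : ∀ i, Continuous (Φ · i))
    (hΦmono : ∀ m w, 0 ≤ ∑ i, (Φ m i - Φ w i) * (m i - w i)) {G : ι → ℝ} (hG : ∀ i, 0 < G i)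
    {R R' : ℝ} (hR0 : 0 < R) (hR' : ∑ i, G i * e i < R')
    (hR : ∀ m : ι → ℝ, (∀ i, 0 ≤ m i) → ∑ i, m i ≤ R' → ∀ i, |Φ m i| + |L 0 i| < R) :
    ∃ z ∈ truncation e R R', L z.1 = Φ z.2 ∧
      ∀ v : ι → ℝ, ∑ i, G i * (v i - z.1 i) ≤ ∑ i, z.2 i * (L v i - L z.1 i) := by
  classical
  have hR'0 : 0 ≤ R' :=
    (Finset.sum_nonneg fun i _ => mul_nonneg (hG i).le (he.pos i).le).trans hR'.le
  obtain ⟨⟨u, m⟩, ⟨hu, hm, hmR⟩, hvi, hwi⟩ :=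
    exists_truncated_solution he hconv hcont hΦ hΦmono G hR0.le hR'0
  simp only at hu hm hmR hvi hwi
  have hsingle : ∀ (a : ι → ℝ) (i : ι) (s : ℝ), ∑ j, a j * (Pi.single i s : ι → ℝ) j = a i * s := by
    intro a i s
    rw [Finset.sum_eq_single i (fun j _ hj => by simp [hj]) (by simp)]
    simp
  have hbound := hR m hm hmR
  -- raising `u` at a node where `m` vanishes contradicts positivity of the source
  have hraise : ∀ i s, 0 < s → m i = 0 → ¬ ∀ j, |(u + Pi.single i s : ι → ℝ) j| ≤ R * e j := by
    intro i s hs hmi hbox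
    have h1 := hvi _ hbox
    simp only [Pi.add_apply, add_sub_cancel_left, hsingle] at h1
    have h2 : ∑ j, m j * (L (u + Pi.single i s) j - L u j) ≤ 0 := by
      refine Finset.sum_nonpos fun j _ => ?_
      by_cases hj : j = i
      · rw [hj, hmi, zero_mul]
      · refine mul_nonpos_of_nonneg_of_nonpos (hm j) (sub_nonpos.2 (he.quasi _ _ j ?_ ?_))
        · simpa using hs.le
        · simp [hj]
    have := mul_pos (hG i) hs
    linarith
  have hstep : ∀ i s, (∀ j, j ≠ i → |(u + Pi.single i s : ι → ℝ) j| ≤ R * e j) := by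
    intro i s j hj
    simpa [hj] using hu j
  -- At the lower wall, comparison with `-R • e` gives `L u i ≤ L 0 i - R < Φ m i`. Removing the
  -- mass at `i` then forces `m i = 0`, and raising `u i` to zero contradicts `hraise`.
  have hlow : ∀ i, -(R * e i) < u i := by
    intro i
    by_contra hcon
    have hui : u i = -(R * e i) := le_antisymm (not_lt.1 hcon) (abs_le.1 (hu i)).1
    have h1 : L u i ≤ L (-(R • e)) i := by
      refine he.quasi _ _ i (fun j => ?_) ?_
      · simpa using (abs_le.1 (hu j)).1
      · simp [hui]
    have h2 := he.strict 0 R i hR0.le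
    rw [zero_sub] at h2
    have hb := hbound i
    have hpos : 0 < Φ m i - L u i := by
      linarith [neg_abs_le (Φ m i), le_abs_self (L 0 i)]
    have hmi : m i = 0 := by
      have h3 := hwi (m + Pi.single i (-m i)) (fun j => by
        by_cases hj : j = i
        · subst hj; simp
        · simpa [hj] using hm j) (by
        simp only [Pi.add_apply, Finset.sum_add_distrib, Finset.sum_pi_single',
          Finset.mem_univ, if_true]
        linarith [hm i])
      simp only [Pi.add_apply, add_sub_cancel_left, hsingle] at h3
      have := hm i
      by_contra hne
      have hlt : 0 < m i := lt_of_le_of_ne this (Ne.symm hne)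
      nlinarith [mul_pos hpos hlt]
    refine hraise i (R * e i) (mul_pos hR0 (he.pos i)) hmi fun j => ?_
    by_cases hj : j = i
    · subst hj
      simpa [hui] using mul_nonneg hR0.le (he.pos j).le
    · exact hstep i _ j hj
  -- Since no lower wall is touched, `u - s • e` is admissible for small `s`. Testing with it bounds
  -- the total mass by `∑ Gᵢ eᵢ`, strictly below `R'`.
  have hmlt : ∑ i, m i < R' := by
    refine lt_of_le_of_lt ?_ hR'
    have hev : ∀ᶠ s in 𝓝[>] (0 : ℝ), ∀ i, -(R * e i) < u i - s * e i := by
      refine eventually_all.2 fun i => nhdsWithin_le_nhds ?_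
      have : Tendsto (fun s : ℝ => u i - s * e i) (𝓝 0) (𝓝 (u i - 0 * e i)) :=
        Continuous.tendsto (by fun_prop) 0
      exact this.eventually_const_lt (by simpa using hlow i)
    obtain ⟨s, hs, hs0⟩ := (hev.and self_mem_nhdsWithin).exists
    have hs0 : 0 < s := hs0
    have h1 := hvi (u - s • e) fun i => by
      rw [abs_le]
      have := (abs_le.1 (hu i)).2
      have := mul_pos hs0 (he.pos i)
      have := hs i
      constructor <;> simp only [Pi.sub_apply, Pi.smul_apply, smul_eq_mul] <;> linarith
    have h2 : ∑ i, m i * (L (u - s • e) i - L u i) ≤ ∑ i, m i * (-s) :=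
      Finset.sum_le_sum fun i _ =>
        mul_le_mul_of_nonneg_left (by linarith [he.strict u s i hs0.le]) (hm i)
    have h3 : ∑ i, G i * ((u - s • e) i - u i) = -s * ∑ i, G i * e i := by
      rw [Finset.mul_sum]
      exact Finset.sum_congr rfl fun i _ => by simp; ring
    rw [← Finset.sum_mul] at h2
    rw [h3] at h1
    nlinarith
  -- The mass constraint is slack, so the remaining mass may be added at any single index.
  have hsup : ∀ i, L u i ≤ Φ m i := by
    intro i
    have h3 := hwi (m + Pi.single i (R' - ∑ j, m j)) (fun j => by
      by_cases hj : j = i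
      · subst hj; simpa using add_nonneg (hm j) (sub_nonneg.2 hmlt.le)
      · simpa [hj] using hm j) (by
      simp [Pi.add_apply, Finset.sum_add_distrib])
    simp only [Pi.add_apply, add_sub_cancel_left, hsingle] at h3
    have := nonneg_of_mul_nonneg_left h3 (sub_pos.2 hmlt)
    linarith
  -- At the upper wall, comparison with `R • e` would give `L u i ≥ L 0 i + R > Φ m i`.
  have hup : ∀ i, u i < R * e i := by
    intro i
    by_contra hcon
    have hui : u i = R * e i := le_antisymm (abs_le.1 (hu i)).2 (not_lt.1 hcon)
    have h1 : L (R • e) i ≤ L u i := by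
      refine he.quasi _ _ i (fun j => ?_) ?_
      · simpa using (abs_le.1 (hu j)).2
      · simp [hui]
    have h2 := he.strict (R • e) R i hR0.le
    rw [sub_self] at h2
    linarith [hbound i, hsup i, le_abs_self (Φ m i), neg_abs_le (L 0 i)]
  -- With the upper wall now at positive distance, `hraise` excludes vanishing mass. Thus mass can
  -- also be removed at each index, which yields equality in `hsup`.
  have hmpos : ∀ i, 0 < m i := by
    intro i
    refine lt_of_le_of_ne (hm i) fun h0 => ?_
    refine hraise i (R * e i - u i) (sub_pos.2 (hup i)) h0.symm fun j => ?_
    by_cases hj : j = i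
    · subst hj
      simp [abs_of_pos hR0, abs_of_pos (he.pos j)]
    · exact hstep i _ j hj
  refine ⟨(u, m), ⟨hu, hm, hmR⟩, ?_, fun v => ?_⟩
  · funext i
    refine le_antisymm (hsup i) ?_
    have h3 := hwi (m + Pi.single i (-m i)) (fun j => by
      by_cases hj : j = i
      · subst hj; simp
      · simpa [hj] using hm j) (by
      simp only [Pi.add_apply, Finset.sum_add_distrib, Finset.sum_pi_single',
        Finset.mem_univ, if_true]
      linarith [hm i])
    simp only [Pi.add_apply, add_sub_cancel_left, hsingle] at h3
    have := hmpos i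
    simp only
    nlinarith
  · simp only
    -- `u` lies strictly inside the box, so a short step towards any `v` is admissible; convexity
    -- scales the resulting inequality up to `v` itself.
    have hev : ∀ᶠ t in 𝓝[>] (0 : ℝ), ∀ i, |(1 - t) * u i + t * v i| < R * e i := by
      refine eventually_all.2 fun i => nhdsWithin_le_nhds ?_
      have : Tendsto (fun t : ℝ => |(1 - t) * u i + t * v i|) (𝓝 0)
          (𝓝 |(1 - 0) * u i + 0 * v i|) := Continuous.tendsto (by fun_prop) 0
      refine this.eventually_lt_const ?_
      simpa [abs_lt] using ⟨hlow i, hup i⟩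
    obtain ⟨t, ⟨ht, ht1⟩, ht0⟩ := ((hev.and (nhdsWithin_le_nhds
      (Iio_mem_nhds (zero_lt_one' ℝ)))).and self_mem_nhdsWithin).exists
    have ht0 : 0 < t := ht0
    have ht1 : t < 1 := ht1
    have h1 := hvi ((1 - t) • u + t • v) fun i => by simpa using (ht i).le
    have h2 : ∑ i, m i * (L ((1 - t) • u + t • v) i - L u i)
        ≤ t * ∑ i, m i * (L v i - L u i) := by
      rw [Finset.mul_sum]
      refine Finset.sum_le_sum fun i _ => ?_
      have h := (hconv i).2 (mem_univ u) (mem_univ v) (by linarith : 0 ≤ 1 - t) ht0.le (by ring)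
      simp only [smul_eq_mul] at h
      have := mul_le_mul_of_nonneg_left (sub_le_sub_right h (L u i)) (hm i)
      linarith
    have h3 : ∑ i, G i * (((1 - t) • u + t • v) i - u i) = t * ∑ i, G i * (v i - u i) := by
      rw [Finset.mul_sum]
      exact Finset.sum_congr rfl fun i _ => by simp; ring
    rw [h3] at h1
    exact le_of_mul_le_mul_left (h1.trans h2) ht0

/-- Solvability of the finite-dimensional game: `L u = Φ m`, and `u` minimises the convex function
`v ↦ ∑ i, m i * L v i - ∑ i, G i * v i`. -/
theorem exists_game_solution (he : HasComparison L e) (hconv : ∀ i, ConvexOn ℝ univ (L · i))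
    (hcont : ∀ i, Continuous (L · i)) (hΦ : ∀ i, Continuous (Φ · i))
    (hΦmono : ∀ m w, 0 ≤ ∑ i, (Φ m i - Φ w i) * (m i - w i)) {G : ι → ℝ} (hG : ∀ i, 0 ≤ G i) :
    ∃ u m : ι → ℝ, (∀ i, 0 ≤ m i) ∧ L u = Φ m ∧
      ∀ v : ι → ℝ, ∑ i, G i * (v i - u i) ≤ ∑ i, m i * (L v i - L u i) := by
  -- The perturbations `1 / (k + 1)` of the source are at most one, so this mass bound, and hence
  -- `R` below, serves all of them and the limit takes place in one compact set.
  set R' : ℝ := ∑ i, (G i + 1) * e i + 1 with hR'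
  have hcomp : IsCompact {m : ι → ℝ | (∀ i, 0 ≤ m i) ∧ ∑ i, m i ≤ R'} := by
    have := (isCompact_truncation e 0 R').image continuous_snd
    convert this using 1
    ext m
    constructor
    · rintro ⟨h1, h2⟩
      exact ⟨(0, m), ⟨by simp, h1, h2⟩, rfl⟩
    · rintro ⟨z, hz, rfl⟩
      exact hz.2
  have hbd : ∃ B : ℝ, ∀ m : ι → ℝ, (∀ i, 0 ≤ m i) → ∑ i, m i ≤ R' → ∀ i,
      |Φ m i| + |L 0 i| ≤ B := by
    have hc : Continuous fun m : ι → ℝ => ∑ i, (|Φ m i| + |L 0 i|) :=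
      continuous_finsetSum _ fun i _ => ((hΦ i).abs.add continuous_const)
    obtain ⟨B, hB⟩ := hcomp.bddAbove_image hc.continuousOn
    refine ⟨B, fun m h1 h2 i => le_trans ?_ (hB ⟨m, ⟨h1, h2⟩, rfl⟩)⟩
    exact Finset.single_le_sum (f := fun i => |Φ m i| + |L 0 i|) (fun j _ => by positivity)
      (Finset.mem_univ i)
  obtain ⟨B, hB⟩ := hbd
  set R : ℝ := |B| + 1 with hR
  have hex : ∀ k : ℕ, ∃ z ∈ truncation e R R', L z.1 = Φ z.2 ∧ ∀ v : ι → ℝ,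
      ∑ i, (G i + 1 / ((k : ℝ) + 1)) * (v i - z.1 i) ≤ ∑ i, z.2 i * (L v i - L z.1 i) := by
    intro k
    refine exists_solution_of_pos he hconv hcont hΦ hΦmono
      (fun i => add_pos_of_nonneg_of_pos (hG i) (by positivity)) (by positivity) ?_ ?_
    · have : ∑ i, (G i + 1 / ((k : ℝ) + 1)) * e i ≤ ∑ i, (G i + 1) * e i := by
        refine Finset.sum_le_sum fun i _ => mul_le_mul_of_nonneg_right ?_ (he.pos i).le
        have : 1 / ((k : ℝ) + 1) ≤ 1 := by
          rw [div_le_one (by positivity)]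
          have : (0 : ℝ) ≤ k := by positivity
          linarith
        linarith
      linarith
    · intro m h1 h2 i
      exact lt_of_le_of_lt (hB m h1 h2 i) (by linarith [le_abs_self B])
  choose z hz hLz hzv using hex
  obtain ⟨y, hy, s, hs, hlim⟩ := (isCompact_truncation e R R').tendsto_subseq hz
  have h1 : Tendsto (fun k => (z (s k)).1) atTop (𝓝 y.1) :=
    (continuous_fst.tendsto y).comp hlim
  have h2 : Tendsto (fun k => (z (s k)).2) atTop (𝓝 y.2) :=
    (continuous_snd.tendsto y).comp hlim
  have hLlim : ∀ i, Tendsto (fun k => L (z (s k)).1 i) atTop (𝓝 (L y.1 i)) := fun i =>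
    ((hcont i).tendsto y.1).comp h1
  refine ⟨y.1, y.2, hy.2.1, ?_, fun v => ?_⟩
  · funext i
    refine tendsto_nhds_unique (hLlim i) ?_
    simp only [hLz]
    exact ((hΦ i).tendsto y.2).comp h2
  · have hl : Tendsto (fun k => ∑ i, (G i + 1 / ((s k : ℝ) + 1)) * (v i - (z (s k)).1 i)) atTop
        (𝓝 (∑ i, G i * (v i - y.1 i))) := by
      refine tendsto_finsetSum _ fun i _ => ?_
      have hk : Tendsto (fun k => 1 / ((s k : ℝ) + 1)) atTop (𝓝 0) :=
        tendsto_one_div_add_atTop_nhds_zero_nat.comp hs.tendsto_atTop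
      have := (tendsto_const_nhds (x := G i)).add hk
      rw [add_zero] at this
      exact this.mul (tendsto_const_nhds.sub ((tendsto_pi_nhds.1 h1) i))
    have hr : Tendsto (fun k => ∑ i, (z (s k)).2 i * (L v i - L (z (s k)).1 i)) atTop
        (𝓝 (∑ i, y.2 i * (L v i - L y.1 i))) :=
      tendsto_finsetSum _ fun i _ =>
        ((tendsto_pi_nhds.1 h2) i).mul (tendsto_const_nhds.sub (hLlim i))
    exact le_of_tendsto_of_tendsto' hl hr fun k => hzv (s k) v

end FiniteSystem

end MFG

end

/-! ### Abstract discretisations with a maximum principle -/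

noncomputable section

namespace MFG

open MeasureTheory Set
open scoped ContDiff ENNReal

open Filter Topology

variable {n : ℕ}

/-- Bounded measurable functions. -/
def BddMeas {F : Type*} [NormedAddCommGroup F] [MeasurableSpace F] (h : Euc n → F) : Prop :=
  Measurable h ∧ ∃ C, ∀ x, ‖h x‖ ≤ C

namespace BddMeas

variable {h k : Euc n → ℝ} {p q : Euc n → Euc n}

theorem const {F : Type*} [NormedAddCommGroup F] [MeasurableSpace F] (a : F) :
    BddMeas (n := n) fun _ => a := ⟨measurable_const, ‖a‖, fun _ => le_rfl⟩

theorem add {F : Type*} [NormedAddCommGroup F] [MeasurableSpace F] [MeasurableAdd₂ F]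
    {h k : Euc n → F} (hh : BddMeas h) (hk : BddMeas k) : BddMeas fun x => h x + k x := by
  obtain ⟨hm, C, hC⟩ := hh
  obtain ⟨km, D, hD⟩ := hk
  exact ⟨hm.add km, C + D, fun x => (norm_add_le _ _).trans (add_le_add (hC x) (hD x))⟩

theorem smul {F : Type*} [NormedAddCommGroup F] [NormedSpace ℝ F] [MeasurableSpace F]
    [MeasurableSMul₂ ℝ F] {k : Euc n → F} (hh : BddMeas h) (hk : BddMeas k) :
    BddMeas fun x => h x • k x := by
  obtain ⟨hm, C, hC⟩ := hh
  obtain ⟨km, D, hD⟩ := hk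
  refine ⟨hm.smul km, C * D, fun x => ?_⟩
  rw [norm_smul]
  exact mul_le_mul (hC x) (hD x) (norm_nonneg _) ((norm_nonneg _).trans (hC x))

theorem mul (hh : BddMeas h) (hk : BddMeas k) : BddMeas fun x => h x * k x := hh.smul hk

theorem sub (hh : BddMeas h) (hk : BddMeas k) : BddMeas fun x => h x - k x := by
  simpa [sub_eq_add_neg] using hh.add ((BddMeas.const (-1)).mul hk)

theorem norm (hp : BddMeas p) : BddMeas fun x => ‖p x‖ := by
  obtain ⟨hm, C, hC⟩ := hp
  exact ⟨hm.norm, C, fun x => by simpa using hC x⟩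

theorem inner (hp : BddMeas p) (hq : BddMeas q) : BddMeas fun x => inner ℝ (p x) (q x) := by
  obtain ⟨hm, C, hC⟩ := hp
  obtain ⟨km, D, hD⟩ := hq
  refine ⟨hm.inner km, C * D, fun x => (norm_inner_le_norm _ _).trans ?_⟩
  exact mul_le_mul (hC x) (hD x) (norm_nonneg _) ((norm_nonneg _).trans (hC x))

theorem sum {F : Type*} [NormedAddCommGroup F] [MeasurableSpace F] [MeasurableAdd₂ F] {ι : Type*}
    {s : Finset ι} {h : ι → Euc n → F} (hh : ∀ i ∈ s, BddMeas (h i)) :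
    BddMeas fun x => ∑ i ∈ s, h i x := by
  classical
  induction s using Finset.induction_on with
  | empty => simpa using BddMeas.const (0 : F)
  | insert a s ha ih =>
    simp only [Finset.sum_insert ha]
    exact (hh a (by simp)).add (ih fun i hi => hh i (by simp [hi]))

theorem integrable {ρ : Measure (Euc n)} [IsFiniteMeasure ρ] (hh : BddMeas h) :
    Integrable h ρ := by
  obtain ⟨hm, C, hC⟩ := hh
  exact Integrable.of_bound hm.aestronglyMeasurable C (ae_of_all _ hC)

theorem memLp {p : Euc n → Euc n} {ρ : Measure (Euc n)} [IsFiniteMeasure ρ] (hp : BddMeas p)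
    (r : ℝ≥0∞) : MemLp p r ρ := by
  obtain ⟨hm, C, hC⟩ := hp
  exact MemLp.of_bound hm.aestronglyMeasurable C (ae_of_all _ hC)

end BddMeas

/-- Data of a finite element discretisation with basis functions `ξ i`, whose gradients are `g i`,
and with a diffusion coefficient `d` large enough to guarantee a discrete maximum principle for all
drifts bounded by `β`; `e` are the coefficients of a discrete supersolution. -/
structure Scheme (n : ℕ) (ι : Type*) [Fintype ι] where
  ρ : Measure (Euc n)
  finite : IsFiniteMeasure ρ
  ξ : ι → Euc n → ℝ
  g : ι → Euc n → Euc n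
  d : Euc n → ℝ
  κ : ℝ
  β : ℝ
  e : ι → ℝ
  β_nonneg : 0 ≤ β
  bddMeas_ξ : ∀ i, BddMeas (ξ i)
  bddMeas_g : ∀ i, BddMeas (g i)
  bddMeas_d : BddMeas d
  ξ_nonneg : ∀ i x, 0 ≤ ξ i x
  acute : ∀ i j, i ≠ j → ∀ᵐ x ∂ρ,
    d x * inner ℝ (g i x) (g j x) + β * ‖g i x‖ * ξ j x + κ * ξ i x * ξ j x ≤ 0
  e_pos : ∀ i, 0 < e i
  super : ∀ i, 1 ≤ ∫ x, (d x * inner ℝ (∑ j, e j • g j x) (g i x)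
    - β * ‖∑ j, e j • g j x‖ * ξ i x + κ * (∑ j, e j * ξ j x) * ξ i x) ∂ρ

namespace Scheme

variable {ι : Type*} [Fintype ι] (S : Scheme n ι)

instance : IsFiniteMeasure S.ρ := S.finite

/-- The discrete function with coefficients `w`. -/
def val (w : ι → ℝ) (x : Euc n) : ℝ := ∑ i, w i * S.ξ i x

/-- The gradient of the discrete function with coefficients `w`. -/
def gr (w : ι → ℝ) (x : Euc n) : Euc n := ∑ i, w i • S.g i x

theorem bddMeas_val (w : ι → ℝ) : BddMeas (S.val w) :=
  BddMeas.sum fun i _ => (BddMeas.const (w i)).mul (S.bddMeas_ξ i)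

theorem bddMeas_gr (w : ι → ℝ) : BddMeas (S.gr w) :=
  BddMeas.sum fun i _ => (BddMeas.const (w i)).smul (S.bddMeas_g i)

theorem val_add (u w : ι → ℝ) (x : Euc n) : S.val (u + w) x = S.val u x + S.val w x := by
  simp [val, add_mul, Finset.sum_add_distrib]

theorem val_smul (a : ℝ) (w : ι → ℝ) (x : Euc n) : S.val (a • w) x = a * S.val w x := by
  simp [val, Finset.mul_sum, mul_assoc]

theorem gr_add (u w : ι → ℝ) (x : Euc n) : S.gr (u + w) x = S.gr u x + S.gr w x := by
  simp [gr, add_smul, Finset.sum_add_distrib]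

theorem gr_smul (a : ℝ) (w : ι → ℝ) (x : Euc n) : S.gr (a • w) x = a • S.gr w x := by
  simp [gr, Finset.smul_sum, mul_smul]

theorem val_nonneg {w : ι → ℝ} (hw : ∀ i, 0 ≤ w i) (x : Euc n) : 0 ≤ S.val w x :=
  Finset.sum_nonneg fun i _ => mul_nonneg (hw i) (S.ξ_nonneg i x)

/-- Hamiltonians that are Lipschitz in the gradient variable with constant `β`. -/
structure LipHam (h : Euc n → Euc n → ℝ) : Prop where
  bddMeas : ∀ p : Euc n → Euc n, BddMeas p → BddMeas fun x => h x (p x)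
  lip : ∀ x p q, h x p - h x q ≤ S.β * ‖p - q‖

/-- The integrand of the discrete Hamilton–Jacobi–Bellman operator. -/
def integrand (h : Euc n → Euc n → ℝ) (u : ι → ℝ) (i : ι) (x : Euc n) : ℝ :=
  S.d x * inner ℝ (S.gr u x) (S.g i x) + h x (S.gr u x) * S.ξ i x + S.κ * S.val u x * S.ξ i x

/-- The discrete Hamilton–Jacobi–Bellman operator with Hamiltonian `h`. -/
def op (h : Euc n → Euc n → ℝ) (u : ι → ℝ) (i : ι) : ℝ := ∫ x, S.integrand h u i x ∂S.ρ

variable {S} {h : Euc n → Euc n → ℝ}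

theorem LipHam.integrable (hh : S.LipHam h) (u : ι → ℝ) (i : ι) :
    Integrable (S.integrand h u i) S.ρ := by
  apply BddMeas.integrable
  exact ((S.bddMeas_d.mul ((S.bddMeas_gr u).inner (S.bddMeas_g i))).add
    ((hh.bddMeas _ (S.bddMeas_gr u)).mul (S.bddMeas_ξ i))).add
    (((BddMeas.const S.κ).mul (S.bddMeas_val u)).mul (S.bddMeas_ξ i))

/-- The Lipschitz bound replaces the Hamiltonian increment by `β` times the norm of the gradient
increment. For `quasi`, the increment has non-negative coefficients and none at `i`, so `acute`
makes each contribution non-positive. For `strict`, the increment is `-s • S.e` and the bound leaves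
`s` times the integral in `super`. -/
theorem LipHam.hasComparison (hh : S.LipHam h) : HasComparison (S.op h) S.e where
  pos := S.e_pos
  quasi u w i huw hi := by
    refine integral_mono_ae (hh.integrable w i) (hh.integrable u i) ?_
    have hac : ∀ᵐ x ∂S.ρ, ∀ j, j ≠ i → S.d x * inner ℝ (S.g j x) (S.g i x)
        + S.β * ‖S.g j x‖ * S.ξ i x + S.κ * S.ξ j x * S.ξ i x ≤ 0 := by
      refine ae_all_iff.2 fun j => ?_
      by_cases hj : j = i
      · simp [hj]
      · filter_upwards [S.acute j i hj] with x hx _ using hx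
    filter_upwards [hac] with x hx
    obtain ⟨t, ht⟩ : ∃ t, t = w - u := ⟨_, rfl⟩
    have hw : w = u + t := by rw [ht]; abel
    have ht0 : ∀ j, 0 ≤ t j := fun j => by rw [ht]; simpa using huw j
    have hti : t i = 0 := by rw [ht]; simp [hi]
    have hlip : h x (S.gr u x + S.gr t x) - h x (S.gr u x) ≤ S.β * ∑ j, t j * ‖S.g j x‖ := by
      refine (hh.lip x _ _).trans (mul_le_mul_of_nonneg_left ?_ S.β_nonneg)
      rw [add_sub_cancel_left]
      refine (norm_sum_le _ _).trans (Finset.sum_le_sum fun j _ => ?_)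
      rw [norm_smul, Real.norm_eq_abs, abs_of_nonneg (ht0 j)]
    have hsum : S.d x * inner ℝ (S.gr t x) (S.g i x) + S.β * (∑ j, t j * ‖S.g j x‖) * S.ξ i x
        + S.κ * S.val t x * S.ξ i x
        = ∑ j, t j * (S.d x * inner ℝ (S.g j x) (S.g i x)
          + S.β * ‖S.g j x‖ * S.ξ i x + S.κ * S.ξ j x * S.ξ i x) := by
      simp only [gr, val, sum_inner, inner_smul_left, Finset.mul_sum, Finset.sum_mul,
        ← Finset.sum_add_distrib]
      refine Finset.sum_congr rfl fun j _ => ?_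
      simp
      ring
    have hneg : ∑ j, t j * (S.d x * inner ℝ (S.g j x) (S.g i x)
          + S.β * ‖S.g j x‖ * S.ξ i x + S.κ * S.ξ j x * S.ξ i x) ≤ 0 := by
      refine Finset.sum_nonpos fun j _ => ?_
      by_cases hj : j = i
      · rw [hj, hti, zero_mul]
      · exact mul_nonpos_of_nonneg_of_nonpos (ht0 j) (hx j hj)
    have := mul_le_mul_of_nonneg_right hlip (S.ξ_nonneg i x)
    simp only [integrand, hw, gr_add, val_add, inner_add_left]
    linarith
  strict u s i hs := by
    have hint : Integrable (fun x => S.d x * inner ℝ (S.gr S.e x) (S.g i x)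
        - S.β * ‖S.gr S.e x‖ * S.ξ i x + S.κ * S.val S.e x * S.ξ i x) S.ρ := by
      apply BddMeas.integrable
      exact ((S.bddMeas_d.mul ((S.bddMeas_gr _).inner (S.bddMeas_g i))).sub
        (((BddMeas.const S.β).mul (S.bddMeas_gr _).norm).mul (S.bddMeas_ξ i))).add
        (((BddMeas.const S.κ).mul (S.bddMeas_val _)).mul (S.bddMeas_ξ i))
    have h1 : S.op h (u - s • S.e) i ≤ S.op h u i - s * ∫ x, (S.d x * inner ℝ (S.gr S.e x) (S.g i x)
        - S.β * ‖S.gr S.e x‖ * S.ξ i x + S.κ * S.val S.e x * S.ξ i x) ∂S.ρ := by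
      rw [op, op, ← integral_const_mul, ← integral_sub (hh.integrable u i) (hint.const_mul s)]
      refine integral_mono (hh.integrable _ i) ((hh.integrable u i).sub (hint.const_mul s)) ?_
      intro x
      have e1 : u - s • S.e = u + (-s) • S.e := by rw [neg_smul, sub_eq_add_neg]
      have hlip := hh.lip x (S.gr u x + (-s) • S.gr S.e x) (S.gr u x)
      rw [add_sub_cancel_left, norm_smul, Real.norm_eq_abs, abs_neg, abs_of_nonneg hs] at hlip
      have := mul_le_mul_of_nonneg_right hlip (S.ξ_nonneg i x)
      simp only [integrand, e1, gr_add, val_add, gr_smul, val_smul, inner_add_left,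
        inner_smul_left, RCLike.conj_to_real]
      linarith
    have h2 := mul_le_mul_of_nonneg_left (S.super i) hs
    simp only [gr, val] at h1
    linarith

/-- The Hamiltonian is the only nonlinear term, and it is weighted by the non-negative function `ξ
i`. -/
theorem LipHam.convexOn_op (hh : S.LipHam h) (hconv : ∀ x, ConvexOn ℝ univ (h x)) (i : ι) :
    ConvexOn ℝ univ (S.op h · i) := by
  refine ⟨convex_univ, fun u _ w _ a b ha hb hab => ?_⟩
  simp only [op, smul_eq_mul]
  rw [← integral_const_mul, ← integral_const_mul, ← integral_add ((hh.integrable u i).const_mul a)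
    ((hh.integrable w i).const_mul b)]
  refine integral_mono (hh.integrable _ i) (((hh.integrable u i).const_mul a).add
    ((hh.integrable w i).const_mul b)) fun x => ?_
  have h1 := (hconv x).2 (mem_univ (S.gr u x)) (mem_univ (S.gr w x)) ha hb hab
  simp only [smul_eq_mul] at h1
  have := mul_le_mul_of_nonneg_right h1 (S.ξ_nonneg i x)
  simp only [integrand, gr_add, val_add, gr_smul, val_smul, inner_add_left,
    inner_smul_left, RCLike.conj_to_real]
  linarith

theorem LipHam.integrable_form (hh : S.LipHam h) (u w : ι → ℝ) :
    Integrable (fun x => S.d x * inner ℝ (S.gr u x) (S.gr w x)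
      + h x (S.gr u x) * S.val w x + S.κ * S.val u x * S.val w x) S.ρ := by
  apply BddMeas.integrable
  exact ((S.bddMeas_d.mul ((S.bddMeas_gr u).inner (S.bddMeas_gr w))).add
    ((hh.bddMeas _ (S.bddMeas_gr u)).mul (S.bddMeas_val w))).add
    (((BddMeas.const S.κ).mul (S.bddMeas_val u)).mul (S.bddMeas_val w))

/-- The operator tested with a discrete function. -/
theorem LipHam.sum_op (hh : S.LipHam h) (u w : ι → ℝ) :
    ∑ i, w i * S.op h u i = ∫ x, (S.d x * inner ℝ (S.gr u x) (S.gr w x)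
      + h x (S.gr u x) * S.val w x + S.κ * S.val u x * S.val w x) ∂S.ρ := by
  simp only [op, ← integral_const_mul]
  rw [← integral_finsetSum _ fun i _ => (hh.integrable u i).const_mul (w i)]
  congr 1
  funext x
  rw [show S.gr w x = ∑ i, w i • S.g i x from rfl, show S.val w x = ∑ i, w i * S.ξ i x from rfl]
  simp only [integrand, inner_sum, inner_smul_right, Finset.mul_sum, ← Finset.sum_add_distrib]
  exact Finset.sum_congr rfl fun i _ => by ring

variable (S)

/-- The linear Hamiltonian of a drift. -/
def drift (c : Euc n → Euc n) (x p : Euc n) : ℝ := inner ℝ (c x) p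

-- A drift bounded by `β` is itself an admissible Hamiltonian, so the linearised operators inherit
-- the same comparison principle with the same supersolution.
variable {S} in
theorem lipHam_drift {c : Euc n → Euc n} (hc : Measurable c) (hcβ : ∀ x, ‖c x‖ ≤ S.β) :
    S.LipHam (drift c) where
  bddMeas p hp := BddMeas.inner ⟨hc, S.β, hcβ⟩ hp
  lip x p q := by
    rw [drift, drift, ← inner_sub_right]
    exact (real_inner_le_norm _ _).trans (mul_le_mul_of_nonneg_right (hcβ x) (norm_nonneg _))

/-- The discrete operator of a linear Hamiltonian, as a linear map. -/
def linOp {c : Euc n → Euc n} (hc : Measurable c) (hcβ : ∀ x, ‖c x‖ ≤ S.β) :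
    (ι → ℝ) →ₗ[ℝ] (ι → ℝ) where
  toFun := S.op (drift c)
  map_add' u w := by
    funext i
    rw [Pi.add_apply, op, op, op, ← integral_add ((lipHam_drift hc hcβ).integrable u i)
      ((lipHam_drift hc hcβ).integrable w i)]
    congr 1
    funext x
    simp only [integrand, drift, gr_add, val_add, inner_add_left, inner_add_right]
    ring
  map_smul' a w := by
    funext i
    rw [Pi.smul_apply, op, op, RingHom.id_apply, smul_eq_mul, ← integral_const_mul]
    congr 1
    funext x
    simp only [integrand, drift, gr_smul, val_smul, inner_smul_left, inner_smul_right,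
      RCLike.conj_to_real]
    ring

variable {S}

/-- Solutions of the discrete Kolmogorov–Fokker–Planck equation are non-negative. -/
theorem nonneg_of_kfp {c : Euc n → Euc n} (hc : Measurable c) (hcβ : ∀ x, ‖c x‖ ≤ S.β)
    {G m : ι → ℝ} (hG : ∀ i, 0 ≤ G i)
    (hm : ∀ w, ∑ i, m i * S.op (drift c) w i = ∑ i, G i * w i) (i : ι) : 0 ≤ m i := by
  classical
  exact HasComparison.nonneg_of_transpose (L := S.linOp hc hcβ)
    (lipHam_drift hc hcβ).hasComparison hG hm i

/-- Uniqueness by monotonicity. -/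
theorem eq_of_solutions (hh : S.LipHam h) {Φ : (ι → ℝ) → ι → ℝ} {G : ι → ℝ} (hG : ∀ i, 0 ≤ G i)
    (hΦ : ∀ m w : ι → ℝ, ∑ i, (Φ m i - Φ w i) * (m i - w i) ≤ 0 → m = w)
    {u₁ u₂ m₁ m₂ : ι → ℝ} {c₁ c₂ : Euc n → Euc n}
    (hc₁ : Measurable c₁) (hcβ₁ : ∀ x, ‖c₁ x‖ ≤ S.β) (hc₂ : Measurable c₂)
    (hcβ₂ : ∀ x, ‖c₂ x‖ ≤ S.β)
    (hs₁ : ∀ᵐ x ∂S.ρ, ∀ q, h x (S.gr u₁ x) + inner ℝ (c₁ x) (q - S.gr u₁ x) ≤ h x q)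
    (hs₂ : ∀ᵐ x ∂S.ρ, ∀ q, h x (S.gr u₂ x) + inner ℝ (c₂ x) (q - S.gr u₂ x) ≤ h x q)
    (hu₁ : S.op h u₁ = Φ m₁) (hu₂ : S.op h u₂ = Φ m₂)
    (hm₁ : ∀ w, ∑ i, m₁ i * S.op (drift c₁) w i = ∑ i, G i * w i)
    (hm₂ : ∀ w, ∑ i, m₂ i * S.op (drift c₂) w i = ∑ i, G i * w i) : u₁ = u₂ ∧ m₁ = m₂ := by
  -- The subgradient inequality, integrated against `ξ i ≥ 0`: the operator lies above its
  -- linearisation at `u` with drift `c`.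
  have hsub : ∀ (u v : ι → ℝ) (c : Euc n → Euc n), Measurable c → (∀ x, ‖c x‖ ≤ S.β) →
      (∀ᵐ x ∂S.ρ, ∀ q, h x (S.gr u x) + inner ℝ (c x) (q - S.gr u x) ≤ h x q) →
      ∀ i, S.op h u i + S.op (drift c) (v - u) i ≤ S.op h v i := by
    intro u v c hc hcβ hs i
    rw [op, op, op, ← integral_add (hh.integrable u i) ((lipHam_drift hc hcβ).integrable _ i)]
    refine integral_mono_ae ((hh.integrable u i).add ((lipHam_drift hc hcβ).integrable _ i))
      (hh.integrable v i) ?_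
    filter_upwards [hs] with x hx
    obtain ⟨t, ht⟩ : ∃ t, t = v - u := ⟨_, rfl⟩
    have hv : v = u + t := by rw [ht]; abel
    have h1 := hx (S.gr v x)
    rw [hv, gr_add, add_sub_cancel_left] at h1
    have := mul_le_mul_of_nonneg_right h1 (S.ξ_nonneg i x)
    rw [← ht, hv]
    simp only [integrand, gr_add, val_add, inner_add_left, drift]
    linarith
  have hpos₁ := nonneg_of_kfp hc₁ hcβ₁ hG hm₁
  have hpos₂ := nonneg_of_kfp hc₂ hcβ₂ hG hm₂
  -- The first density equation is tested with `u₂ - u₁`; non-negativity of `m₁` permits use of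
  -- `hsub`. Adding the symmetric inequality cancels `G` and leaves the monotonicity pairing.
  have h1 : ∑ i, G i * (u₂ - u₁) i ≤ ∑ i, m₁ i * (Φ m₂ i - Φ m₁ i) := by
    rw [← hm₁, ← hu₁, ← hu₂]
    exact Finset.sum_le_sum fun i _ => mul_le_mul_of_nonneg_left
      (by linarith [hsub u₁ u₂ c₁ hc₁ hcβ₁ hs₁ i]) (hpos₁ i)
  have h2 : ∑ i, G i * (u₁ - u₂) i ≤ ∑ i, m₂ i * (Φ m₁ i - Φ m₂ i) := by
    rw [← hm₂, ← hu₁, ← hu₂]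
    exact Finset.sum_le_sum fun i _ => mul_le_mul_of_nonneg_left
      (by linarith [hsub u₂ u₁ c₂ hc₂ hcβ₂ hs₂ i]) (hpos₂ i)
  have h3 : ∑ i, G i * (u₂ - u₁) i + ∑ i, G i * (u₁ - u₂) i = 0 := by
    rw [← Finset.sum_add_distrib]
    exact Finset.sum_eq_zero fun i _ => by simp only [Pi.sub_apply]; ring
  have h4 : ∑ i, (Φ m₁ i - Φ m₂ i) * (m₁ i - m₂ i)
      = -(∑ i, m₁ i * (Φ m₂ i - Φ m₁ i) + ∑ i, m₂ i * (Φ m₁ i - Φ m₂ i)) := by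
    rw [← Finset.sum_add_distrib, ← Finset.sum_neg_distrib]
    exact Finset.sum_congr rfl fun i _ => by ring
  have hm : m₁ = m₂ := hΦ m₁ m₂ (by linarith)
  exact ⟨hh.hasComparison.eq_of_eq (by rw [hu₁, hu₂, hm]), hm⟩

end Scheme

end MFG

end

/-! ### Selections of the subdifferential -/

noncomputable section

namespace MFG

open MeasureTheory Set
open scoped ContDiff ENNReal

open Filter Topology

variable {n : ℕ}

/-- In `L²`, an almost everywhere constraint with closed values is closed. -/
theorem isClosed_setOf_ae_mem {X F : Type*} [MeasurableSpace X] {ρ : Measure X}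
    [NormedAddCommGroup F] (K : X → Set F) (hK : ∀ x, IsClosed (K x)) :
    IsClosed {c : Lp F 2 ρ | ∀ᵐ x ∂ρ, c x ∈ K x} := by
  refine IsSeqClosed.isClosed fun c c₀ hc hlim => ?_
  -- Convergence in `L²` gives almost everywhere convergence along a subsequence, which suffices for
  -- closed pointwise constraints.
  obtain ⟨s, -, hs⟩ := (tendstoInMeasure_of_tendsto_Lp hlim).exists_seq_tendsto_ae
  have hall : ∀ᵐ x ∂ρ, ∀ k, c (s k) x ∈ K x := ae_all_iff.2 fun k => hc (s k)
  change ∀ᵐ x ∂ρ, c₀ x ∈ K x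
  filter_upwards [hs, hall] with x hx hx'
  exact (hK x).mem_of_tendsto hx (Eventually.of_forall hx')

theorem convex_setOf_ae_mem {X F : Type*} [MeasurableSpace X] {ρ : Measure X}
    [NormedAddCommGroup F] [NormedSpace ℝ F] (K : X → Set F) (hK : ∀ x, Convex ℝ (K x)) :
    Convex ℝ {c : Lp F 2 ρ | ∀ᵐ x ∂ρ, c x ∈ K x} := by
  intro c hc c' hc' s t hs ht hst
  change ∀ᵐ x ∂ρ, (s • c + t • c' : Lp F 2 ρ) x ∈ K x
  filter_upwards [hc, hc', Lp.coeFn_add (s • c) (t • c'), Lp.coeFn_smul s c,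
    Lp.coeFn_smul t c'] with x h1 h2 h3 h4 h5
  rw [h3, Pi.add_apply, h4, h5]
  exact hK x h1 h2 hs ht hst

variable {A : Type*} {b : Euc n → A → Euc n} {f : Euc n → A → ℝ}

/-- Approximate subgradients of norm at most `β`. -/
def approxSubdiff (b : Euc n → A → Euc n) (f : Euc n → A → ℝ) (β δ : ℝ) (x p : Euc n) :
    Set (Euc n) :=
  {c | ‖c‖ ≤ β ∧ ∀ q, hamiltonian b f x p - δ + inner ℝ c (q - p) ≤ hamiltonian b f x q}

theorem isClosed_approxSubdiff (β δ : ℝ) (x p : Euc n) :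
    IsClosed (approxSubdiff b f β δ x p) := by
  have h1 : IsClosed {c : Euc n | ‖c‖ ≤ β} := isClosed_le continuous_norm continuous_const
  have h2 : IsClosed {c : Euc n | ∀ q, hamiltonian b f x p - δ + inner ℝ c (q - p)
      ≤ hamiltonian b f x q} := by
    simp only [ofPred_forall]
    exact isClosed_iInter fun q => isClosed_le (by fun_prop) continuous_const
  exact h1.inter h2

theorem convex_approxSubdiff (β δ : ℝ) (x p : Euc n) :
    Convex ℝ (approxSubdiff b f β δ x p) := by
  rintro c ⟨h1, h2⟩ c' ⟨h1', h2'⟩ s t hs ht hst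
  refine ⟨?_, fun q => ?_⟩
  · refine (norm_add_le _ _).trans ?_
    rw [norm_smul, norm_smul, Real.norm_eq_abs, Real.norm_eq_abs, abs_of_nonneg hs,
      abs_of_nonneg ht]
    calc s * ‖c‖ + t * ‖c'‖ ≤ s * β + t * β := by gcongr
      _ = β := by rw [← add_mul, hst, one_mul]
  · have k1 := mul_le_mul_of_nonneg_left (h2 q) hs
    have k2 := mul_le_mul_of_nonneg_left (h2' q) ht
    rw [inner_add_left, inner_smul_left, inner_smul_left, RCLike.conj_to_real, RCLike.conj_to_real]
    linear_combination k1 + k2 - (hamiltonian b f x p - δ - hamiltonian b f x q) * hst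

theorem hamiltonian_le [Nonempty A] {x p : Euc n} {r : ℝ}
    (h : ∀ α, inner ℝ (b x α) p - f x α ≤ r) : hamiltonian b f x p ≤ r := ciSup_le h

variable [MetricSpace A]

/-- Bounded measurable control data. -/
structure ControlData (b : Euc n → A → Euc n) (f : Euc n → A → ℝ) (β : ℝ) : Prop where
  b_meas : ∀ α, Measurable (b · α)
  f_meas : ∀ α, Measurable (f · α)
  b_cont : ∀ x, Continuous (b x)
  f_cont : ∀ x, Continuous (f x)
  b_le : ∀ x α, ‖b x α‖ ≤ β
  f_le : ∃ C, ∀ x α, |f x α| ≤ C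

namespace ControlData

variable {β : ℝ}

theorem bddAbove (hc : ControlData b f β) (x p : Euc n) :
    BddAbove (range fun α => inner ℝ (b x α) p - f x α) := by
  obtain ⟨C, hC⟩ := hc.f_le
  refine ⟨β * ‖p‖ + C, ?_⟩
  rintro _ ⟨α, rfl⟩
  have h1 := (real_inner_le_norm (b x α) p).trans
    (mul_le_mul_of_nonneg_right (hc.b_le x α) (norm_nonneg p))
  have h2 := neg_abs_le (f x α)
  have h3 := hC x α
  simp only
  linarith

theorem le_hamiltonian (hc : ControlData b f β) (x p : Euc n) (α : A) :
    inner ℝ (b x α) p - f x α ≤ hamiltonian b f x p :=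
  le_ciSup (hc.bddAbove x p) α

variable [Nonempty A]

theorem hamiltonian_sub_le (hc : ControlData b f β) (x p q : Euc n) :
    hamiltonian b f x p - hamiltonian b f x q ≤ β * ‖p - q‖ := by
  rw [sub_le_iff_le_add]
  refine hamiltonian_le fun α => ?_
  have h1 := hc.le_hamiltonian x q α
  have h2 := (real_inner_le_norm (b x α) (p - q)).trans
    (mul_le_mul_of_nonneg_right (hc.b_le x α) (norm_nonneg _))
  rw [inner_sub_right] at h2
  linarith

theorem convexOn_hamiltonian (hc : ControlData b f β) (x : Euc n) :
    ConvexOn ℝ univ (hamiltonian b f x) := by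
  refine ⟨convex_univ, fun p _ q _ s t hs ht hst => hamiltonian_le fun α => ?_⟩
  have h1 := mul_le_mul_of_nonneg_left (hc.le_hamiltonian x p α) hs
  have h2 := mul_le_mul_of_nonneg_left (hc.le_hamiltonian x q α) ht
  simp only [inner_add_right, inner_smul_right, smul_eq_mul]
  linear_combination h1 + h2 + f x α * hst

/-- The subgradient inequality at `p + c` and the Lipschitz bound give `‖c‖² ≤ β ‖c‖`. -/
theorem norm_le_of_mem_subdiff (hc : ControlData b f β) {x p c : Euc n}
    (h : c ∈ subdiff b f x p) : ‖c‖ ≤ β := by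
  have h1 := h (p + c)
  have h2 := hc.hamiltonian_sub_le x (p + c) p
  rw [add_sub_cancel_left, real_inner_self_eq_norm_sq] at h1
  rw [add_sub_cancel_left] at h2
  have hβ : 0 ≤ β := (norm_nonneg _).trans (hc.b_le 0 (Classical.arbitrary A))
  by_contra hcon
  push Not at hcon
  nlinarith [norm_nonneg c]

variable [CompactSpace A]

/-- Near-maximising controls form a non-empty open set, which a dense sequence must meet. Countably
many controls suffice both for measurability of the supremum and for choosing the first
near-maximiser measurably. -/
theorem exists_denseSeq_lt (hc : ControlData b f β) (x p : Euc n) {ε : ℝ} (hε : 0 < ε) :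
    ∃ k, hamiltonian b f x p - ε <
      inner ℝ (b x (TopologicalSpace.denseSeq A k)) p - f x (TopologicalSpace.denseSeq A k) := by
  obtain ⟨α, hα⟩ := exists_lt_of_lt_ciSup (f := fun α => inner ℝ (b x α) p - f x α)
    (sub_lt_self (hamiltonian b f x p) hε)
  have hcont : Continuous fun α => inner ℝ (b x α) p - f x α :=
    ((hc.b_cont x).inner continuous_const).sub (hc.f_cont x)
  obtain ⟨_, hy, k, rfl⟩ := (TopologicalSpace.denseRange_denseSeq A).inter_open_nonempty _
    (isOpen_lt continuous_const hcont) ⟨α, hα⟩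
  exact ⟨k, hy⟩

theorem hamiltonian_eq_iSup_denseSeq (hc : ControlData b f β) (x p : Euc n) :
    hamiltonian b f x p = ⨆ k, (inner ℝ (b x (TopologicalSpace.denseSeq A k)) p
      - f x (TopologicalSpace.denseSeq A k)) := by
  refine le_antisymm (le_of_forall_pos_sub_le fun ε hε => ?_)
    (ciSup_le fun k => hc.le_hamiltonian x p _)
  obtain ⟨k, hk⟩ := hc.exists_denseSeq_lt x p hε
  refine hk.le.trans (le_ciSup (f := fun k => inner ℝ (b x (TopologicalSpace.denseSeq A k)) p
      - f x (TopologicalSpace.denseSeq A k)) ⟨hamiltonian b f x p, ?_⟩ k)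
  rintro _ ⟨j, rfl⟩
  exact hc.le_hamiltonian x p _

theorem measurable_hamiltonian (hc : ControlData b f β) {p : Euc n → Euc n} (hp : Measurable p) :
    Measurable fun x => hamiltonian b f x (p x) := by
  simp only [hc.hamiltonian_eq_iSup_denseSeq]
  exact Measurable.iSup fun k => ((hc.b_meas _).inner hp).sub (hc.f_meas _)

theorem bddMeas_hamiltonian (hc : ControlData b f β) {p : Euc n → Euc n} (hp : BddMeas p) :
    BddMeas fun x => hamiltonian b f x (p x) := by
  refine ⟨hc.measurable_hamiltonian hp.1, ?_⟩
  obtain ⟨-, P, hP⟩ := hp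
  obtain ⟨C, hC⟩ := hc.f_le
  have hβ : 0 ≤ β := (norm_nonneg _).trans (hc.b_le 0 (Classical.arbitrary A))
  have h : ∀ x α, |inner ℝ (b x α) (p x) - f x α| ≤ β * P + C := fun x α =>
    (abs_sub _ _).trans (add_le_add ((abs_real_inner_le_norm _ _).trans
      (mul_le_mul (hc.b_le x α) (hP x) (norm_nonneg _) hβ)) (hC x α))
  refine ⟨β * P + C, fun x => ?_⟩
  rw [Real.norm_eq_abs, abs_le]
  refine ⟨?_, hamiltonian_le fun α => (le_abs_self _).trans (h x α)⟩
  exact (neg_le_of_abs_le (h x (Classical.arbitrary A))).trans (hc.le_hamiltonian x _ _)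

/-- Measurable selections of approximate subgradients. -/
theorem exists_approx_selection (hc : ControlData b f β) {p : Euc n → Euc n} (hp : Measurable p)
    {ε : ℝ} (hε : 0 < ε) : ∃ c : Euc n → Euc n, Measurable c ∧ (∀ x, ‖c x‖ ≤ β) ∧
      ∀ x q, hamiltonian b f x (p x) - ε + inner ℝ (c x) (q - p x) ≤ hamiltonian b f x q := by
  classical
  have hex := fun x => hc.exists_denseSeq_lt x (p x) hε
  refine ⟨fun x => b x (TopologicalSpace.denseSeq A (Nat.find (hex x))), ?_, fun x => hc.b_le x _,
    fun x q => ?_⟩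
  · exact Measurable.find (f := fun k x => b x (TopologicalSpace.denseSeq A k))
      (fun k => hc.b_meas _) (fun k => measurableSet_lt
        ((hc.measurable_hamiltonian hp).sub measurable_const)
        (((hc.b_meas _).inner hp).sub (hc.f_meas _))) hex
  · have h1 := Nat.find_spec (hex x)
    have h2 := hc.le_hamiltonian x q (TopologicalSpace.denseSeq A (Nat.find (hex x)))
    simp only [inner_sub_right]
    linarith

end ControlData

namespace Scheme

variable {ι : Type*} [Fintype ι] {S : Scheme n ι} [CompactSpace A] [Nonempty A]

theorem _root_.MFG.ControlData.lipHam (hc : ControlData b f S.β) : S.LipHam (hamiltonian b f) where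
  bddMeas _ hp := hc.bddMeas_hamiltonian hp
  lip := hc.hamiltonian_sub_le

/-- A directional selection: approximate subgradients along `gr u` whose weighted integral against
`gr v` nearly dominates the directional increment of the source functional. -/
theorem exists_directional_selection (hc : ControlData b f S.β) {G u m : ι → ℝ}
    (hm : ∀ i, 0 ≤ m i) (hvi : ∀ v : ι → ℝ, ∑ i, G i * (v i - u i)
      ≤ ∑ i, m i * (S.op (hamiltonian b f) v i - S.op (hamiltonian b f) u i))
    (v : ι → ℝ) {δ : ℝ} (hδ : 0 < δ) :
    ∃ c : Euc n → Euc n, Measurable c ∧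
      (∀ x, c x ∈ approxSubdiff b f S.β δ x (S.gr u x)) ∧
      ∑ i, G i * v i - δ ≤ ∑ i, m i * S.op (drift c) v i := by
  obtain ⟨-, P, hP⟩ := S.bddMeas_gr v
  have hP0 : 0 ≤ P := (norm_nonneg _).trans (hP 0)
  set I : ℝ := ∫ x, S.val m x ∂S.ρ with hI
  have hI0 : 0 ≤ I := integral_nonneg fun x => S.val_nonneg hm x
  -- `t² + 2βtP` is the subgradient error caused by moving from `u + t • v` back to `u`, and `t I`
  -- is the loss in the integrated inequality; `t` makes both at most `δ`.
  obtain ⟨t, ht0, ht⟩ : ∃ t > 0, t * (t + 2 * S.β * P + I) ≤ δ := by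
    have hβ := S.β_nonneg
    have hden : 0 < 1 + 2 * S.β * P + I := by positivity
    refine ⟨min 1 (δ / (1 + 2 * S.β * P + I)), by positivity, ?_⟩
    set t := min 1 (δ / (1 + 2 * S.β * P + I)) with ht
    have h1 : t ≤ 1 := min_le_left _ _
    have h2 : t ≤ δ / (1 + 2 * S.β * P + I) := min_le_right _ _
    have h0 : 0 ≤ t := by positivity
    rw [le_div_iff₀ hden] at h2
    nlinarith
  have hmeas : Measurable (S.gr (u + t • v)) := (S.bddMeas_gr _).1
  -- Selecting at the shifted point bounds the increment of `H` from `u` to `u + t • v` by `t` times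
  -- the drift term plus the selection error. This error is `t²` so that it still vanishes after
  -- division by `t`.
  obtain ⟨c, hcm, hcβ, hcs⟩ := hc.exists_approx_selection hmeas (pow_pos ht0 2)
  refine ⟨c, hcm, fun x => ⟨hcβ x, fun q => ?_⟩, ?_⟩
  · have h1 := hcs x q
    have h2 := hc.hamiltonian_sub_le x (S.gr u x) (S.gr (u + t • v) x)
    have e1 : S.gr (u + t • v) x = S.gr u x + t • S.gr v x := by rw [gr_add, gr_smul]
    have h3 : inner ℝ (c x) (t • S.gr v x) ≤ S.β * (t * P) := by
      refine (real_inner_le_norm _ _).trans (mul_le_mul (hcβ x) ?_ (norm_nonneg _) S.β_nonneg)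
      rw [norm_smul, Real.norm_eq_abs, abs_of_pos ht0]
      exact mul_le_mul_of_nonneg_left (hP x) ht0.le
    have h4 : S.β * ‖S.gr u x - S.gr (u + t • v) x‖ ≤ S.β * (t * P) := by
      refine mul_le_mul_of_nonneg_left ?_ S.β_nonneg
      rw [e1, sub_add_cancel_left, norm_neg, norm_smul, Real.norm_eq_abs, abs_of_pos ht0]
      exact mul_le_mul_of_nonneg_left (hP x) ht0.le
    have h5 : inner ℝ (c x) (q - S.gr (u + t • v) x)
        = inner ℝ (c x) (q - S.gr u x) - inner ℝ (c x) (t • S.gr v x) := by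
      rw [e1, ← inner_sub_right]; congr 1; abel
    have h6 : 0 ≤ t * I := by positivity
    nlinarith
  · have h1 := hvi (u + t • v)
    simp only [Pi.add_apply, add_sub_cancel_left, Pi.smul_apply, smul_eq_mul] at h1
    have e1 : ∑ i, G i * (t * v i) = t * ∑ i, G i * v i := by
      rw [Finset.mul_sum]; exact Finset.sum_congr rfl fun i _ => by ring
    have h2 : ∑ i, m i * (S.op (hamiltonian b f) (u + t • v) i - S.op (hamiltonian b f) u i)
        ≤ t * ∑ i, m i * S.op (drift c) v i + t ^ 2 * I := by
      have hd := lipHam_drift hcm hcβ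
      simp only [mul_sub, Finset.sum_sub_distrib]
      have i1 := hc.lipHam.integrable_form (u + t • v) m
      have i2 := hc.lipHam.integrable_form u m
      have i3 := (hd.integrable_form v m).const_mul t
      have i4 := (S.bddMeas_val m).integrable (ρ := S.ρ).const_mul (t ^ 2)
      rw [hc.lipHam.sum_op, hc.lipHam.sum_op, hd.sum_op, hI, ← integral_const_mul,
        ← integral_const_mul, ← integral_sub i1 i2, ← integral_add i3 i4]
      refine integral_mono (i1.sub i2) (i3.add i4) fun x => ?_
      have h4 := mul_le_mul_of_nonneg_right (hcs x (S.gr u x)) (S.val_nonneg hm x)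
      simp only [gr_add, gr_smul, val_add, val_smul, inner_add_left, inner_smul_left,
        RCLike.conj_to_real, drift, sub_add_cancel_left, inner_neg_right,
        inner_smul_right] at h4 ⊢
      linarith
    rw [e1] at h1
    have h3 : t * (∑ i, G i * v i - t * I) ≤ t * ∑ i, m i * S.op (drift c) v i := by
      linarith
    have h4 := le_of_mul_le_mul_left h3 ht0
    have hβ := S.β_nonneg
    have h5 : 0 ≤ t * (t + 2 * S.β * P) := by positivity
    linarith

/-- From the variational inequality for `u` to a drift in the subdifferential that solves the
discrete Kolmogorov–Fokker–Planck equation. -/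
theorem exists_selection (hc : ControlData b f S.β) {G u m : ι → ℝ}
    (hm : ∀ i, 0 ≤ m i) (hvi : ∀ v : ι → ℝ, ∑ i, G i * (v i - u i)
      ≤ ∑ i, m i * (S.op (hamiltonian b f) v i - S.op (hamiltonian b f) u i)) :
    ∃ c : Euc n → Euc n, Measurable c ∧ (∀ x, ‖c x‖ ≤ S.β) ∧
      (∀ᵐ x ∂S.ρ, c x ∈ subdiff b f x (S.gr u x)) ∧
      ∀ w, ∑ i, m i * S.op (drift c) w i = ∑ i, G i * w i := by
  classical
  have hMg : ∀ i, BddMeas fun x => S.val m x • S.g i x := fun i =>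
    (S.bddMeas_val m).smul (S.bddMeas_g i)
  set γ : ι → Lp (Euc n) 2 S.ρ := fun i => ((hMg i).memLp 2).toLp _ with hγ
  set a : ι → ℝ := fun i => ∫ x, (S.d x * inner ℝ (S.g i x) (S.gr m x)
    + S.κ * S.ξ i x * S.val m x) ∂S.ρ with ha
  set D : ℝ → Set (Lp (Euc n) 2 S.ρ) := fun δ =>
    {c | ∀ᵐ x ∂S.ρ, c x ∈ approxSubdiff b f S.β δ x (S.gr u x)} with hD
  have hinner : ∀ (c : Lp (Euc n) 2 S.ρ) (i : ι),
      inner ℝ (γ i) c = ∫ x, S.val m x * inner ℝ (c x) (S.g i x) ∂S.ρ := by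
    intro c i
    rw [L2.inner_def]
    refine integral_congr_ae ?_
    filter_upwards [((hMg i).memLp 2).coeFn_toLp] with x hx
    rw [hγ, hx, inner_smul_left, RCLike.conj_to_real, real_inner_comm]
  -- the Kolmogorov–Fokker–Planck operator in terms of the pairing with `γ`
  have hform : ∀ (c : Euc n → Euc n), Measurable c → (∀ x, ‖c x‖ ≤ S.β) → ∀ w : ι → ℝ,
      ∑ i, m i * S.op (drift c) w i
        = ∑ i, w i * (a i + ∫ x, S.val m x * inner ℝ (c x) (S.g i x) ∂S.ρ) := by
    intro c hcm hcβ w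
    rw [(lipHam_drift hcm hcβ).sum_op]
    have i1 : ∀ i, Integrable (fun x => S.d x * inner ℝ (S.g i x) (S.gr m x)
        + S.κ * S.ξ i x * S.val m x) S.ρ := fun i => BddMeas.integrable
      ((S.bddMeas_d.mul ((S.bddMeas_g i).inner (S.bddMeas_gr m))).add
        (((BddMeas.const S.κ).mul (S.bddMeas_ξ i)).mul (S.bddMeas_val m)))
    have i2 : ∀ i, Integrable (fun x => S.val m x * inner ℝ (c x) (S.g i x)) S.ρ := fun i =>
      BddMeas.integrable ((S.bddMeas_val m).mul (BddMeas.inner ⟨hcm, S.β, hcβ⟩ (S.bddMeas_g i)))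
    simp only [ha, ← integral_add (i1 _) (i2 _), ← integral_const_mul]
    have i3 : ∀ i, Integrable (fun x => w i * (S.d x * inner ℝ (S.g i x) (S.gr m x)
        + S.κ * S.ξ i x * S.val m x + S.val m x * inner ℝ (c x) (S.g i x))) S.ρ := fun i =>
      ((i1 i).add (i2 i)).const_mul (w i)
    rw [← integral_finsetSum _ fun i _ => i3 i]
    congr 1
    funext x
    rw [drift, show S.gr w x = ∑ i, w i • S.g i x from rfl,
      show S.val w x = ∑ i, w i * S.ξ i x from rfl]
    simp only [inner_sum, sum_inner, inner_smul_right, inner_smul_left, RCLike.conj_to_real,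
      Finset.mul_sum, Finset.sum_mul, ← Finset.sum_add_distrib]
    exact Finset.sum_congr rfl fun i _ => by ring
  have hDconv : ∀ δ, Convex ℝ (D δ) := fun δ =>
    convex_setOf_ae_mem _ fun x => convex_approxSubdiff _ _ _ _
  have hDcl : ∀ δ, IsClosed (D δ) := fun δ =>
    isClosed_setOf_ae_mem _ fun x => isClosed_approxSubdiff _ _ _ _
  set T : Lp (Euc n) 2 S.ρ →ₗ[ℝ] (ι → ℝ) := LinearMap.pi fun i => (innerSL ℝ (γ i)).toLinearMap
    with hT
  have hTi : ∀ c i, T c i = inner ℝ (γ i) c := fun c i => rfl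
  -- Otherwise a hyperplane separates the target from the convex image. Its normal supplies a
  -- direction `v`, and a directional selection along `v` with error at most the gap crosses the
  -- hyperplane.
  have hclosure : ∀ δ > 0, (fun i => G i - a i) ∈ closure (T '' D δ) := by
    intro δ hδ
    by_contra hcon
    obtain ⟨φ, r, hφ1, hφ2⟩ := geometric_hahn_banach_point_closed
      (((hDconv δ).linear_image T).closure) isClosed_closure hcon
    set v : ι → ℝ := fun i => -φ (Pi.single i 1) with hv
    have hφ : ∀ y : ι → ℝ, φ y = - ∑ i, v i * y i := by
      intro y
      conv_lhs => rw [← LinearMap.sum_single_apply (fun _ : ι => ℝ) y]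
      rw [map_sum, ← Finset.sum_neg_distrib]
      refine Finset.sum_congr rfl fun i _ => ?_
      have : (Pi.single i (y i) : ι → ℝ) = y i • Pi.single i 1 := by
        rw [← Pi.single_smul]; simp
      rw [this, map_smul, hv, smul_eq_mul]
      ring
    set η := min δ (r - φ fun i => G i - a i) with hη
    have hη0 : 0 < η := lt_min hδ (by linarith)
    obtain ⟨c, hcm, hcs, hcv⟩ := exists_directional_selection hc hm hvi v hη0
    have hcβ : ∀ x, ‖c x‖ ≤ S.β := fun x => (hcs x).1
    have hcb : BddMeas c := ⟨hcm, S.β, hcβ⟩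
    set c' : Lp (Euc n) 2 S.ρ := (hcb.memLp 2).toLp c with hc'
    have hcc : c' =ᵐ[S.ρ] c := (hcb.memLp 2).coeFn_toLp
    have hmem : c' ∈ D δ := by
      change ∀ᵐ x ∂S.ρ, c' x ∈ _
      filter_upwards [hcc] with x hx
      rw [hx]
      exact ⟨hcβ x, fun q => by linarith [(hcs x).2 q, min_le_left δ (r - φ fun i => G i - a i)]⟩
    have h1 := hφ2 _ (subset_closure ⟨c', hmem, rfl⟩)
    have h2 : ∀ i, T c' i = ∫ x, S.val m x * inner ℝ (c x) (S.g i x) ∂S.ρ := fun i => by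
      rw [hTi, hinner]
      refine integral_congr_ae ?_
      filter_upwards [hcc] with x hx
      rw [hx]
    rw [hφ] at h1
    rw [hform c hcm hcβ v] at hcv
    have h3 := min_le_right δ (r - φ fun i => G i - a i)
    rw [← hη, hφ] at h3
    simp only [h2] at h1
    simp only [mul_add, mul_sub, Finset.sum_add_distrib, Finset.sum_sub_distrib] at h3 hcv
    have h4 : ∑ i, v i * G i = ∑ i, G i * v i := Finset.sum_congr rfl fun i _ => mul_comm _ _
    linarith
  -- Approximate subgradient fields that solve the density equation up to `1 / (k + 1)`: closed,
  -- convex, nested, and bounded in `L²` because of the pointwise bound `β`. A common member is an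
  -- exact subgradient almost everywhere and solves the equation exactly.
  set C : ℕ → Set (Lp (Euc n) 2 S.ρ) := fun k =>
    D (1 / ((k : ℝ) + 1)) ∩ {c | ∀ i, |inner ℝ (γ i) c - (G i - a i)| ≤ 1 / ((k : ℝ) + 1)} with hC
  obtain ⟨c, hcC⟩ := exists_mem_iInter_of_antitone_convex C
    (fun k l hkl c hcl => by
      have hle : 1 / ((l : ℝ) + 1) ≤ 1 / ((k : ℝ) + 1) := one_div_le_one_div_of_le
        (by positivity) (by have : (k : ℝ) ≤ l := by exact_mod_cast hkl
                            linarith)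
      refine ⟨?_, fun i => (hcl.2 i).trans hle⟩
      have h1 : ∀ᵐ x ∂S.ρ, c x ∈ approxSubdiff b f S.β _ x (S.gr u x) := hcl.1
      change ∀ᵐ x ∂S.ρ, c x ∈ _
      filter_upwards [h1] with x hx
      exact ⟨hx.1, fun q => by linarith [hx.2 q]⟩)
    (fun k => by
      refine (hDcl _).inter ?_
      simp only [ofPred_forall]
      exact isClosed_iInter fun i => isClosed_le (by fun_prop) continuous_const)
    (fun k => by
      refine (hDconv _).inter ?_
      intro c h1 c' h2 s t hs ht hst i
      have e1 : inner ℝ (γ i) (s • c + t • c') - (G i - a i)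
          = s * (inner ℝ (γ i) c - (G i - a i)) + t * (inner ℝ (γ i) c' - (G i - a i)) := by
        rw [inner_add_right, inner_smul_right, inner_smul_right]
        linear_combination (G i - a i) * hst
      rw [e1]
      refine (abs_add_le _ _).trans ?_
      rw [abs_mul, abs_mul, abs_of_nonneg hs, abs_of_nonneg ht]
      have k1 := mul_le_mul_of_nonneg_left (h1 i) hs
      have k2 := mul_le_mul_of_nonneg_left (h2 i) ht
      refine (add_le_add k1 k2).trans (le_of_eq ?_)
      rw [← add_mul, hst, one_mul])
    (fun k => by
      have hk : (0 : ℝ) < 1 / ((k : ℝ) + 1) := by positivity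
      obtain ⟨_, ⟨c, hcD, rfl⟩, hdist⟩ := Metric.mem_closure_iff.1 (hclosure _ hk) _ hk
      refine ⟨c, hcD, fun i => ?_⟩
      have := (dist_pi_lt_iff hk).1 hdist i
      rw [dist_comm, Real.dist_eq] at this
      exact this.le)
    (M := (S.ρ univ).toReal ^ (2 : ℝ≥0∞).toReal⁻¹ * S.β)
    (fun c hcC => by
      have h1 : ∀ᵐ x ∂S.ρ, c x ∈ approxSubdiff b f S.β _ x (S.gr u x) := hcC.1
      refine Lp.norm_le_of_ae_bound S.β_nonneg ?_
      filter_upwards [h1] with x hx using hx.1)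
  have hsub : ∀ᵐ x ∂S.ρ, ∀ k : ℕ, c x ∈ approxSubdiff b f S.β (1 / ((k : ℝ) + 1)) x (S.gr u x) :=
    ae_all_iff.2 fun k => (hcC k).1
  have hcm : Measurable c := (Lp.stronglyMeasurable c).measurable
  -- The bound holds only almost everywhere; setting the field to zero elsewhere makes it hold
  -- everywhere without changing any integral.
  set c' : Euc n → Euc n := {x | ‖c x‖ ≤ S.β}.indicator c with hc'
  have hc'm : Measurable c' := hcm.indicator (measurableSet_le hcm.norm measurable_const)
  have hc'β : ∀ x, ‖c' x‖ ≤ S.β := fun x => by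
    by_cases hx : ‖c x‖ ≤ S.β
    · rw [hc', indicator_of_mem (by exact hx)]; exact hx
    · rw [hc', indicator_of_notMem (by exact hx), norm_zero]; exact S.β_nonneg
  have hcc : ∀ᵐ x ∂S.ρ, c' x = c x := by
    filter_upwards [hsub] with x hx
    exact indicator_of_mem (s := {x | ‖c x‖ ≤ S.β}) (hx 0).1 c
  refine ⟨c', hc'm, hc'β, ?_, fun w => ?_⟩
  · filter_upwards [hsub, hcc] with x hx hx'
    rw [hx']
    intro q
    have hlim : Tendsto (fun k : ℕ => hamiltonian b f x (S.gr u x) - 1 / ((k : ℝ) + 1)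
        + inner ℝ (c x) (q - S.gr u x)) atTop (𝓝 (hamiltonian b f x (S.gr u x) - 0
        + inner ℝ (c x) (q - S.gr u x))) :=
      (tendsto_const_nhds.sub tendsto_one_div_add_atTop_nhds_zero_nat).add tendsto_const_nhds
    rw [sub_zero] at hlim
    exact le_of_tendsto' hlim fun k => (hx k).2 q
  · rw [hform c' hc'm hc'β w]
    refine Finset.sum_congr rfl fun i _ => ?_
    have h1 : inner ℝ (γ i) c = G i - a i := by
      have : |inner ℝ (γ i) c - (G i - a i)| ≤ 0 :=
        ge_of_tendsto' tendsto_one_div_add_atTop_nhds_zero_nat fun k => (hcC k).2 i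
      linarith [abs_nonpos_iff.1 this]
    have h2 : ∫ x, S.val m x * inner ℝ (c' x) (S.g i x) ∂S.ρ = G i - a i := by
      rw [← h1, hinner]
      refine integral_congr_ae ?_
      filter_upwards [hcc] with x hx
      rw [hx]
    rw [h2]
    ring

/-- Existence for the discrete mean field game. -/
theorem exists_solution (hc : ControlData b f S.β) {Φ : (ι → ℝ) → ι → ℝ} {G : ι → ℝ}
    (hΦ : ∀ i, Continuous (Φ · i))
    (hΦmono : ∀ m w, 0 ≤ ∑ i, (Φ m i - Φ w i) * (m i - w i)) (hG : ∀ i, 0 ≤ G i) :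
    ∃ (u m : ι → ℝ) (c : Euc n → Euc n), Measurable c ∧ (∀ x, ‖c x‖ ≤ S.β) ∧
      (∀ᵐ x ∂S.ρ, c x ∈ subdiff b f x (S.gr u x)) ∧ S.op (hamiltonian b f) u = Φ m ∧
      ∀ w, ∑ i, m i * S.op (drift c) w i = ∑ i, G i * w i := by
  have hconv := hc.lipHam.convexOn_op hc.convexOn_hamiltonian
  obtain ⟨u, m, hm, hum, hvi⟩ := exists_game_solution hc.lipHam.hasComparison hconv
    -- A finite convex function on a finite-dimensional space is continuous.
    (fun i => (hconv i).locallyLipschitz.continuous) hΦ hΦmono hG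
  obtain ⟨c, hcm, hcβ, hcs, hkfp⟩ := exists_selection hc hm hvi
  exact ⟨u, m, c, hcm, hcβ, hcs, hum, hkfp⟩

end Scheme

end MFG

end

/-! ### Weak gradients in `H¹₀(Ω)` -/

noncomputable section

namespace MFG

open MeasureTheory Set
open scoped ContDiff ENNReal

open Filter Topology

section Sobolev

variable {n : ℕ} {Ω : Set (Euc n)}

theorem memLp_restrict_of_hasCompactSupport {F : Type*} [NormedAddCommGroup F] {h : Euc n → F}
    (hc : Continuous h) (hs : HasCompactSupport h) : MemLp h 2 (volume.restrict Ω) :=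
  (hc.memLp_of_hasCompactSupport hs).restrict Ω

theorem setIntegral_eq_integral_of_ae {h k : Euc n → ℝ}
    (hhk : ∀ᵐ x ∂volume.restrict Ω, h x = k x) (hk : ∀ x, x ∉ Ω → k x = 0) :
    ∫ x in Ω, h x = ∫ x, k x := by
  rw [← setIntegral_eq_integral_of_forall_compl_eq_zero hk]
  exact integral_congr_ae hhk

/-- Integration by parts between two smooth functions, one of which has compact support. -/
theorem integral_mul_fderiv_eq_neg {φ ψ : Euc n → ℝ} (hφ : ContDiff ℝ ∞ φ) (hψ : ContDiff ℝ ∞ ψ)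
    (hs : HasCompactSupport φ) (v : Euc n) :
    ∫ x, ψ x * fderiv ℝ φ x v = - ∫ x, fderiv ℝ ψ x v * φ x := by
  have hφ' : Continuous fun x => fderiv ℝ φ x v :=
    (hφ.continuous_fderiv (by simp)).clm_apply continuous_const
  have hψ' : Continuous fun x => fderiv ℝ ψ x v :=
    (hψ.continuous_fderiv (by simp)).clm_apply continuous_const
  have hs' : HasCompactSupport fun x => fderiv ℝ φ x v := hs.fderiv_apply ℝ v
  refine integral_mul_fderiv_eq_neg_fderiv_mul_of_integrable ?_ ?_ ?_
    (fun x _ => (hψ.differentiable (by simp)) x) (fun x _ => (hφ.differentiable (by simp)) x)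
  · exact (hψ'.mul hφ.continuous).integrable_of_hasCompactSupport hs.mul_left
  · exact (hψ.continuous.mul hφ').integrable_of_hasCompactSupport hs'.mul_left
  · exact (hψ.continuous.mul hφ.continuous).integrable_of_hasCompactSupport hs.mul_left

/-- Integration by parts in `H¹₀(Ω)` against functions in `C_c^∞(ℝⁿ)`. -/
theorem integral_fn_mul_fderiv (v : H01 Ω) {φ : Euc n → ℝ} (hφ : ContDiff ℝ ∞ φ)
    (hs : HasCompactSupport φ) (y : Euc n) :
    ∫ x in Ω, fn v x * fderiv ℝ φ x y = - ∫ x in Ω, φ x * inner ℝ (grad v x) y := by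
  have hφ' : Continuous fun x => fderiv ℝ φ x y :=
    (hφ.continuous_fderiv (by simp)).clm_apply continuous_const
  have hs' : HasCompactSupport fun x => fderiv ℝ φ x y := hs.fderiv_apply ℝ y
  have h1 : MemLp (fun x => fderiv ℝ φ x y) 2 (volume.restrict Ω) :=
    memLp_restrict_of_hasCompactSupport hφ' hs'
  have h2 : MemLp (fun x => φ x • y) 2 (volume.restrict Ω) :=
    memLp_restrict_of_hasCompactSupport (hφ.continuous.smul continuous_const) hs.smul_right
  -- The identity is orthogonality to `k` in `L² × L²`, a closed linear condition, so it need only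
  -- be checked on test pairs. There the test pair has its support in `Ω`, so `φ` need not.
  set k : WithLp 2 (L2 Ω × L2Vec Ω) := WithLp.toLp 2 (h1.toLp _, h2.toLp _) with hk
  have hinner : ∀ w : WithLp 2 (L2 Ω × L2Vec Ω), inner ℝ k w
      = (∫ x in Ω, w.fst x * fderiv ℝ φ x y) + ∫ x in Ω, φ x * inner ℝ (w.snd x) y := by
    intro w
    rw [WithLp.prod_inner_apply, L2.inner_def, L2.inner_def]
    congr 1
    · refine integral_congr_ae ?_
      filter_upwards [h1.coeFn_toLp] with x hx
      simp only [hk]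
      rw [hx]
      simp
    · refine integral_congr_ae ?_
      filter_upwards [h2.coeFn_toLp] with x hx
      simp only [hk]
      rw [hx, inner_smul_left, real_inner_comm]
      simp
  have hle : H01 Ω ≤ LinearMap.ker (innerSL ℝ k).toLinearMap := by
    refine Submodule.topologicalClosure_minimal _ (Submodule.span_le.2 ?_)
      (innerSL ℝ k).isClosed_ker
    rintro w ⟨ψ, hψ, hψs, hψΩ, hw1, hw2⟩
    change inner ℝ k w = 0
    rw [hinner]
    have e1 : ∫ x in Ω, w.fst x * fderiv ℝ φ x y = ∫ x, ψ x * fderiv ℝ φ x y := by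
      refine setIntegral_eq_integral_of_ae ?_ ?_
      · filter_upwards [hw1] with x hx
        rw [hx]
      · intro x hx
        rw [image_eq_zero_of_notMem_tsupport fun h => hx (hψΩ h), zero_mul]
    have e2 : ∫ x in Ω, φ x * inner ℝ (w.snd x) y = ∫ x, fderiv ℝ ψ x y * φ x := by
      refine setIntegral_eq_integral_of_ae ?_ ?_
      · filter_upwards [hw2] with x hx
        rw [hx, mul_comm, gradient, InnerProductSpace.toDual_symm_apply]
      · intro x hx
        have : fderiv ℝ ψ x = 0 := image_eq_zero_of_notMem_tsupport
          fun h => hx (hψΩ (tsupport_fderiv_subset ℝ h))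
        simp [this]
    rw [e1, e2, integral_mul_fderiv_eq_neg hφ hψ hs, neg_add_cancel]
  have h3 : inner ℝ k (v : WithLp 2 (L2 Ω × L2Vec Ω)) = 0 := hle v.2
  rw [hinner] at h3
  exact eq_neg_of_add_eq_zero_left h3

/-- The gradient of an affine function. -/
def affGrad (a : Euc n →ᵃ[ℝ] ℝ) : Euc n :=
  (InnerProductSpace.toDual ℝ (Euc n)).symm (LinearMap.toContinuousLinearMap a.linear)

theorem inner_affGrad (a : Euc n →ᵃ[ℝ] ℝ) (y : Euc n) : inner ℝ (affGrad a) y = a.linear y := by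
  rw [affGrad, InnerProductSpace.toDual_symm_apply]
  rfl

theorem hasFDerivAt_affine (a : Euc n →ᵃ[ℝ] ℝ) (x : Euc n) :
    HasFDerivAt a (LinearMap.toContinuousLinearMap a.linear) x := by
  have h : (a : Euc n → ℝ) = fun x => LinearMap.toContinuousLinearMap a.linear x + a 0 := by
    funext x
    have := a.map_vadd 0 x
    simpa using this
  rw [h]
  exact (ContinuousLinearMap.hasFDerivAt _).add_const _

theorem contDiff_affine (a : Euc n →ᵃ[ℝ] ℝ) : ContDiff ℝ ∞ a := by
  have h : (a : Euc n → ℝ) = fun x => LinearMap.toContinuousLinearMap a.linear x + a 0 := by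
    funext x
    have := a.map_vadd 0 x
    simpa using this
  rw [h]
  exact (ContinuousLinearMap.contDiff _).add contDiff_const

/-- The weak gradient of a function that is affine on an open set. -/
theorem grad_eq_of_affine (hΩ : Bornology.IsBounded Ω) (v : H01 Ω) {U : Set (Euc n)}
    (hU : IsOpen U) (hUΩ : U ⊆ Ω) (a : Euc n →ᵃ[ℝ] ℝ)
    (ha : ∀ᵐ x ∂volume.restrict Ω, x ∈ U → fn v x = a x) :
    ∀ᵐ x ∂volume.restrict Ω, x ∈ U → grad v x = affGrad a := by
  have : IsFiniteMeasure (volume.restrict Ω) := ⟨by simpa using hΩ.measure_lt_top⟩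
  have hgi : Integrable (grad v) (volume.restrict Ω) :=
    (Lp.memLp (grad v)).integrable (by norm_num)
  -- The fundamental lemma of the calculus of variations on `U`: test functions supported in `U` see
  -- only the affine representative of `v`.
  have key := hU.ae_eq_zero_of_integral_contDiff_smul_eq_zero (μ := volume.restrict Ω)
    (f := fun x => grad v x - affGrad a)
    ((hgi.sub (integrable_const _)).locallyIntegrable.locallyIntegrableOn U) ?_
  · filter_upwards [key] with x hx hxU using sub_eq_zero.1 (hx hxU)
  intro φ hφ hs hsU
  have hφi : Integrable φ (volume.restrict Ω) :=
    (hφ.continuous.integrable_of_hasCompactSupport hs).restrict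
  obtain ⟨C, hC⟩ := hs.exists_bound_of_continuous hφ.continuous
  have i1 : Integrable (fun x => φ x • (grad v x - affGrad a)) (volume.restrict Ω) :=
    (hgi.sub (integrable_const _)).bdd_smul C hφ.continuous.aestronglyMeasurable
      (ae_of_all _ hC)
  have i2 : Integrable (fun x => φ x • grad v x) (volume.restrict Ω) :=
    hgi.bdd_smul C hφ.continuous.aestronglyMeasurable (ae_of_all _ hC)
  refine ext_inner_left ℝ fun y => ?_
  rw [inner_zero_right, ← integral_inner i1]
  have e0 : ∀ x, inner ℝ y (φ x • (grad v x - affGrad a))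
      = φ x * inner ℝ (grad v x) y - a.linear y * φ x := by
    intro x
    rw [inner_smul_right, inner_sub_right, real_inner_comm, real_inner_comm (affGrad a),
      inner_affGrad]
    ring
  have i3 : Integrable (fun x => φ x * inner ℝ (grad v x) y) (volume.restrict Ω) := by
    have := i2.inner_const (𝕜 := ℝ) y
    refine this.congr (ae_of_all _ fun x => ?_)
    simp [inner_smul_left]
  simp only [e0]
  rw [integral_sub i3 (hφi.const_mul _)]
  have h1 := integral_fn_mul_fderiv v hφ hs y
  have h2 : ∫ x in Ω, fn v x * fderiv ℝ φ x y = ∫ x, a x * fderiv ℝ φ x y := by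
    refine setIntegral_eq_integral_of_ae ?_ ?_
    · filter_upwards [ha] with x hx
      by_cases hxU : x ∈ U
      · rw [hx hxU]
      · have : fderiv ℝ φ x = 0 := image_eq_zero_of_notMem_tsupport
          fun h => hxU (hsU (tsupport_fderiv_subset ℝ h))
        simp [this]
    · intro x hx
      have : fderiv ℝ φ x = 0 := image_eq_zero_of_notMem_tsupport
        fun h => hx (hUΩ (hsU (tsupport_fderiv_subset ℝ h)))
      simp [this]
  have h3 : ∫ x in Ω, a.linear y * φ x = ∫ x, fderiv ℝ a x y * φ x := by
    refine setIntegral_eq_integral_of_ae ?_ ?_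
    · refine ae_of_all _ fun x => ?_
      simp only [(hasFDerivAt_affine a x).fderiv]
      rfl
    · intro x hx
      rw [image_eq_zero_of_notMem_tsupport fun h => hx (hUΩ (hsU h)), mul_zero]
  rw [h3]
  rw [h2, integral_mul_fderiv_eq_neg hφ (contDiff_affine a) hs] at h1
  linarith

theorem fn_sub (v w : H01 Ω) : fn (v - w) = fn v - fn w := rfl

theorem fn_add (v w : H01 Ω) : fn (v + w) = fn v + fn w := rfl

theorem fn_smul (a : ℝ) (v : H01 Ω) : fn (a • v) = a • fn v := rfl

/-- The embedding of `H¹₀(Ω)` into `L²(Ω)` is injective. -/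
theorem fn_injective (hΩo : IsOpen Ω) (hΩ : Bornology.IsBounded Ω) :
    Function.Injective (fn (Ω := Ω)) := by
  intro v w hvw
  have h0 : fn (v - w) = 0 := by rw [fn_sub, hvw, sub_self]
  -- The difference is represented by the zero affine function on all of `Ω`, so its weak gradient
  -- vanishes too.
  have h1 := grad_eq_of_affine hΩ (v - w) hΩo le_rfl 0 (by
    rw [h0]
    filter_upwards [Lp.coeFn_zero ℝ 2 (volume.restrict Ω)] with x hx _
    rw [hx]; rfl)
  have h2 : grad (v - w) = 0 := by
    refine Lp.ext ?_
    filter_upwards [h1, ae_restrict_mem hΩo.measurableSet,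
      Lp.coeFn_zero (Euc n) 2 (volume.restrict Ω)] with x hx hxΩ h0
    rw [hx hxΩ, h0, affGrad]
    simp
  have h3 : ((v - w : H01 Ω) : WithLp 2 (L2 Ω × L2Vec Ω)) = 0 := by
    apply (WithLp.ofLp_injective 2)
    exact Prod.ext h0 h2
  exact sub_eq_zero.1 (Subtype.ext h3)

end Sobolev

end MFG

end

/-! ### Mollification and Lipschitz functions -/

noncomputable section

namespace MFG

open MeasureTheory Set
open scoped ContDiff ENNReal

open Filter Topology

section Mollification

open scoped Convolution NNReal

variable {n : ℕ} {Ω : Set (Euc n)}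

/-- A shrinking sequence of bump functions. -/
def shrinkingBump (n k : ℕ) : ContDiffBump (0 : Euc n) where
  rIn := 1 / ((k : ℝ) + 1)
  rOut := 2 / ((k : ℝ) + 1)
  rIn_pos := by positivity
  rIn_lt_rOut := by gcongr; norm_num

theorem tendsto_shrinkingBump (n : ℕ) :
    Tendsto (fun k => (shrinkingBump n k).rOut) atTop (𝓝 0) := by
  have := (tendsto_one_div_add_atTop_nhds_zero_nat (𝕜 := ℝ)).const_mul 2
  rw [mul_zero] at this
  refine this.congr fun k => ?_
  simp only [shrinkingBump]
  ring

theorem contDiff_normed_convolution (φ : ContDiffBump (0 : Euc n)) {w : Euc n → ℝ}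
    (hw : LocallyIntegrable w) :
    ContDiff ℝ ∞ (φ.normed volume ⋆[ContinuousLinearMap.lsmul ℝ ℝ, volume] w) :=
  φ.hasCompactSupport_normed.contDiff_convolution_left _ φ.contDiff_normed hw

/-- An element of `H¹₀(Ω)` with bounded gradient, extended by zero, is Lipschitz on `ℝⁿ`. -/
theorem exists_lipschitz_representative (hΩo : IsOpen Ω) (hΩ : Bornology.IsBounded Ω) (v : H01 Ω)
    {K : ℝ≥0} (hK : ∀ᵐ x ∂volume.restrict Ω, ‖grad v x‖ ≤ K) :
    ∃ w : Euc n → ℝ, LipschitzWith K w ∧ w =ᵐ[volume] Ω.indicator (fn v) := by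
  have : IsFiniteMeasure (volume.restrict Ω) := ⟨by simpa using hΩ.measure_lt_top⟩
  set w : Euc n → ℝ := Ω.indicator (fn v) with hw
  have hfi : Integrable (fn v) (volume.restrict Ω) := (Lp.memLp (fn v)).integrable (by norm_num)
  have hwi : Integrable w := (integrable_indicator_iff hΩo.measurableSet).2 hfi
  have hgi : Integrable (grad v) (volume.restrict Ω) :=
    (Lp.memLp (grad v)).integrable (by norm_num)
  have hlip : ∀ φ : ContDiffBump (0 : Euc n),
      LipschitzWith K (φ.normed volume ⋆[ContinuousLinearMap.lsmul ℝ ℝ, volume] w) := by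
    intro φ
    have hφs : HasCompactSupport (φ.normed volume) := φ.hasCompactSupport_normed
    have hφd : ContDiff ℝ 1 (φ.normed volume) := φ.contDiff_normed
    have hder := fun x => hφs.hasFDerivAt_convolution_left
      (ContinuousLinearMap.lsmul ℝ ℝ) hφd hwi.locallyIntegrable x
    refine lipschitzWith_of_nnnorm_fderiv_le (𝕜 := ℝ) (fun x => (hder x).differentiableAt)
      fun x => ?_
    rw [(hder x).fderiv, ← NNReal.coe_le_coe, coe_nnnorm]
    refine ContinuousLinearMap.opNorm_le_bound _ K.2 fun y => ?_
    -- The derivative of the convolution at `x` is, up to sign, an integral of `fn v` against the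
    -- derivative of this reflected bump. Its support may leave `Ω`, hence the need for integration
    -- by parts against all of `C_c^∞(ℝⁿ)`.
    set ψ : Euc n → ℝ := fun z => φ.normed volume (x - z) with hψ
    have hψd : ContDiff ℝ ∞ ψ := φ.contDiff_normed.comp (contDiff_const.sub contDiff_id)
    have hψs : HasCompactSupport ψ :=
      φ.hasCompactSupport_normed.comp_homeomorph (Homeomorph.subLeft x)
    have hψ' : ∀ z, fderiv ℝ ψ z y = - fderiv ℝ (φ.normed volume) (x - z) y := by
      intro z
      have h1 : HasFDerivAt (φ.normed volume) (fderiv ℝ (φ.normed volume) (x - z)) (x - z) :=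
        ((φ.contDiff_normed (n := 1)).differentiable (by simp) _).hasFDerivAt
      have h2 := h1.comp z ((hasFDerivAt_id z).const_sub x)
      have h3 : fderiv ℝ ψ z = _ := h2.fderiv
      rw [h3]
      simp
    have hval : ((fderiv ℝ (φ.normed volume)
        ⋆[(ContinuousLinearMap.lsmul ℝ ℝ).precompL (Euc n), volume] w) x) y
        = ∫ z in Ω, ψ z * inner ℝ (grad v z) y := by
      rw [convolution_eq_swap, ContinuousLinearMap.integral_apply]
      · have e1 := integral_fn_mul_fderiv v hψd hψs y
        rw [← neg_eq_iff_eq_neg] at e1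
        rw [← e1, ← integral_neg, ← integral_indicator hΩo.measurableSet]
        congr 1
        funext z
        by_cases hz : z ∈ Ω
        · rw [indicator_of_mem hz, hψ', hw, indicator_of_mem hz]
          simp [mul_comm]
        · rw [indicator_of_notMem hz, hw, indicator_of_notMem hz]
          simp
      · exact ((hφs.fderiv ℝ).convolutionExists_left _ (hφd.continuous_fderiv (by simp))
          hwi.locallyIntegrable x).integrable_swap
    rw [hval]
    have hψ0 : ∀ z, 0 ≤ ψ z := fun z => φ.nonneg_normed _
    have hψi : Integrable ψ := hψd.continuous.integrable_of_hasCompactSupport hψs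
    calc ‖∫ z in Ω, ψ z * inner ℝ (grad v z) y‖ ≤ ∫ z in Ω, ψ z * (K * ‖y‖) := by
          refine norm_integral_le_of_norm_le (hψi.restrict.mul_const _) ?_
          filter_upwards [hK] with z hz
          rw [norm_mul, Real.norm_eq_abs, abs_of_nonneg (hψ0 z)]
          refine mul_le_mul_of_nonneg_left ((norm_inner_le_norm _ _).trans ?_) (hψ0 z)
          exact mul_le_mul_of_nonneg_right hz (norm_nonneg _)
      _ = (∫ z in Ω, ψ z) * (K * ‖y‖) := integral_mul_const _ _
      _ ≤ 1 * (K * ‖y‖) := by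
          refine mul_le_mul_of_nonneg_right ?_ (by positivity)
          refine (setIntegral_le_integral hψi (ae_of_all _ hψ0)).trans (le_of_eq ?_)
          rw [hψ, integral_sub_left_eq_self (fun z => φ.normed volume z) volume x,
            φ.integral_normed]
      _ = K * ‖y‖ := one_mul _
  -- Mollifications converge at almost every point; `K := 2` is the fixed ratio of outer to inner
  -- radius. The uniform Lipschitz bound passes to the limit on this set, and the limit is then
  -- extended to the whole space.
  have hae := ContDiffBump.ae_convolution_tendsto_right_of_locallyIntegrable
    (φ := shrinkingBump n) (l := atTop) (K := 2) (μ := volume) (tendsto_shrinkingBump n)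
    (Eventually.of_forall fun k => by
      simp only [shrinkingBump]; exact le_of_eq (by ring)) hwi.locallyIntegrable
  set s : Set (Euc n) := {x | Tendsto (fun k => ((shrinkingBump n k).normed volume
    ⋆[ContinuousLinearMap.lsmul ℝ ℝ, volume] w) x) atTop (𝓝 (w x))} with hs
  have hlips : LipschitzOnWith K w s := by
    refine LipschitzOnWith.of_dist_le_mul fun x hx y hy => ?_
    exact le_of_tendsto' (hx.dist hy) fun k => (hlip _).dist_le_mul x y
  obtain ⟨w', hw', heq⟩ := hlips.extend_real
  refine ⟨w', hw', ?_⟩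
  filter_upwards [hae] with x hx using (heq hx).symm

/-- Convolution with a normalised bump preserves the Lipschitz constant. -/
theorem lipschitzWith_normed_convolution (φ : ContDiffBump (0 : Euc n)) {w : Euc n → ℝ} {K : ℝ≥0}
    (hw : LipschitzWith K w) :
    LipschitzWith K (φ.normed volume ⋆[ContinuousLinearMap.lsmul ℝ ℝ, volume] w) := by
  refine LipschitzWith.of_dist_le_mul fun x y => ?_
  have hi : ∀ x, Integrable fun t => φ.normed volume t * w (x - t) := fun x =>
    ((φ.contDiff_normed (n := 1)).continuous.mul
      (hw.continuous.comp (continuous_const.sub continuous_id))).integrable_of_hasCompactSupport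
      φ.hasCompactSupport_normed.mul_right
  rw [Real.dist_eq]
  simp only [convolution, ContinuousLinearMap.lsmul_apply, smul_eq_mul]
  rw [← integral_sub (hi x) (hi y), ← Real.norm_eq_abs]
  have hb : ∀ t, ‖φ.normed volume t * w (x - t) - φ.normed volume t * w (y - t)‖
      ≤ φ.normed volume t * (K * dist x y) := fun t => by
    rw [← mul_sub, norm_mul, Real.norm_eq_abs, abs_of_nonneg (φ.nonneg_normed t)]
    refine mul_le_mul_of_nonneg_left ?_ (φ.nonneg_normed t)
    have := hw.dist_le_mul (x - t) (y - t)
    rwa [dist_sub_right, dist_eq_norm] at this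
  refine (norm_integral_le_of_norm_le ((φ.integrable_normed).mul_const _)
    (ae_of_all _ hb)).trans (le_of_eq ?_)
  rw [integral_mul_const, φ.integral_normed, one_mul]

/-- A non-negative Lipschitz function that vanishes off `Ω` is uniformly close to test functions
with controlled gradient. -/
theorem exists_test_function (hΩo : IsOpen Ω) (hΩ : Bornology.IsBounded Ω) {w : Euc n → ℝ}
    {K : ℝ≥0} (hw : LipschitzWith K w) (hw0 : ∀ x, 0 ≤ w x) (hwΩ : ∀ x, x ∉ Ω → w x = 0) {δ : ℝ}
    (hδ : 0 < δ) : ∃ φ : Euc n → ℝ, ContDiff ℝ ∞ φ ∧ HasCompactSupport φ ∧ tsupport φ ⊆ Ω ∧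
      (∀ x, |φ x - w x| ≤ δ) ∧ ∀ x, ‖fderiv ℝ φ x‖ ≤ K := by
  -- Lowering `w` by `δ / 2` confines the support to the compact set `{w ≥ δ / 2}` inside `Ω`, which
  -- leaves room to mollify. Truncation and mollification cost `δ / 2` each and keep the Lipschitz
  -- constant.
  set w' : Euc n → ℝ := fun x => max (w x - δ / 2) 0 with hw'
  have hwl : LipschitzWith K w' := by
    refine LipschitzWith.of_dist_le_mul fun x y => ?_
    have h1 := hw.dist_le_mul x y
    rw [Real.dist_eq] at h1 ⊢
    refine le_trans (abs_max_sub_max_le_abs _ _ _) ?_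
    simpa using h1
  set C : Set (Euc n) := {x | δ / 2 ≤ w x} with hC
  have hCΩ : C ⊆ Ω := fun x hx => by
    by_contra h
    have := hwΩ x h
    have hx : δ / 2 ≤ w x := hx
    linarith
  have hCc : IsCompact C := Metric.isCompact_of_isClosed_isBounded
    (isClosed_le continuous_const hw.continuous) (hΩ.subset hCΩ)
  obtain ⟨ε, hε, hεΩ⟩ := hCc.exists_cthickening_subset_open hΩo hCΩ
  have hev : ∀ᶠ k in atTop, (shrinkingBump n k).rOut < min ε (δ / 2 / (K + 1)) :=
    (tendsto_shrinkingBump n).eventually_lt_const (by positivity)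
  obtain ⟨k, hk⟩ := hev.exists
  set β := shrinkingBump n k with hβ
  have hk1 : β.rOut < ε := hk.trans_le (min_le_left _ _)
  have hk2 : K * β.rOut ≤ δ / 2 := by
    have h2 : β.rOut ≤ δ / 2 / (K + 1) := hk.le.trans (min_le_right _ _)
    rw [le_div_iff₀ (by positivity)] at h2
    nlinarith [β.rOut_pos]
  have hsupp : Function.support (β.normed volume ⋆[ContinuousLinearMap.lsmul ℝ ℝ, volume] w')
      ⊆ Metric.cthickening ε C := by
    refine (support_convolution_subset _).trans ?_
    rintro _ ⟨y, hy, z, hz, rfl⟩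
    rw [β.support_normed_eq] at hy
    have hzC : z ∈ C := by
      by_contra hcon
      have hcon : ¬ δ / 2 ≤ w z := hcon
      exact hz (max_eq_right (by linarith))
    refine Metric.mem_cthickening_of_dist_le (y + z) z ε C hzC ?_
    rw [dist_eq_norm, add_sub_cancel_right]
    exact ((mem_ball_zero_iff.1 hy).trans hk1).le
  have htsupp : tsupport (β.normed volume ⋆[ContinuousLinearMap.lsmul ℝ ℝ, volume] w')
      ⊆ Metric.cthickening ε C := closure_minimal hsupp Metric.isClosed_cthickening
  refine ⟨_, contDiff_normed_convolution β hwl.continuous.locallyIntegrable,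
    hCc.cthickening.of_isClosed_subset (isClosed_tsupport _) htsupp, htsupp.trans hεΩ,
    fun x => ?_, fun x => ?_⟩
  · have h1 : dist ((β.normed volume ⋆[ContinuousLinearMap.lsmul ℝ ℝ, volume] w') x) (w' x)
        ≤ δ / 2 := by
      refine β.dist_normed_convolution_le hwl.continuous.aestronglyMeasurable fun y hy => ?_
      refine (hwl.dist_le_mul y x).trans ((mul_le_mul_of_nonneg_left ?_ K.2).trans hk2)
      exact (Metric.mem_ball.1 hy).le
    have h2 : |w' x - w x| ≤ δ / 2 := by
      rw [hw', abs_le]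
      have := hw0 x
      constructor
      · have := le_max_left (w x - δ / 2) 0
        simp only
        linarith
      · have : max (w x - δ / 2) 0 ≤ w x := max_le (by linarith) (hw0 x)
        simp only
        linarith
    rw [Real.dist_eq] at h1
    have := abs_sub_le ((β.normed volume ⋆[ContinuousLinearMap.lsmul ℝ ℝ, volume] w') x)
      (w' x) (w x)
    linarith
  · exact norm_fderiv_le_of_lipschitz ℝ (lipschitzWith_normed_convolution β hwl)

/-- A non-negative Lipschitz function that vanishes off `Ω` belongs to `H¹₀(Ω)`. -/
theorem exists_H01_of_lipschitz (hΩo : IsOpen Ω) (hΩ : Bornology.IsBounded Ω) {w : Euc n → ℝ}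
    {K : ℝ≥0} (hw : LipschitzWith K w) (hw0 : ∀ x, 0 ≤ w x) (hwΩ : ∀ x, x ∉ Ω → w x = 0) :
    ∃ v : H01 Ω, fn v =ᵐ[volume.restrict Ω] w := by
  have : IsFiniteMeasure (volume.restrict Ω) := ⟨by simpa using hΩ.measure_lt_top⟩
  obtain ⟨B, hB⟩ : ∃ B, ∀ x, ‖w x‖ ≤ B := by
    refine HasCompactSupport.exists_bound_of_continuous ?_ hw.continuous
    refine HasCompactSupport.of_support_subset_isCompact hΩ.isCompact_closure ?_
    intro x hx
    by_contra h
    exact hx (hwΩ x fun h' => h (subset_closure h'))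
  have hB0 : 0 ≤ B := (norm_nonneg _).trans (hB 0)
  have hwL : MemLp w 2 (volume.restrict Ω) :=
    MemLp.of_bound hw.continuous.aestronglyMeasurable B (ae_of_all _ hB)
  set W : L2 Ω := hwL.toLp w with hW
  set m : ℝ := ((volume.restrict Ω) univ).toReal ^ (2 : ℝ≥0∞).toReal⁻¹ with hm
  have hm0 : 0 ≤ m := by positivity
  set M : ℝ := Real.sqrt ((m * (B + 1)) ^ 2 + (m * K) ^ 2) with hM
  -- Test functions close to `w` have uniformly bounded gradients but need not converge in `H¹₀(Ω)`.
  -- The nested convex sets replace weak compactness; a common member has function part exactly `w`.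
  set C : ℕ → Set (WithLp 2 (L2 Ω × L2Vec Ω)) := fun k =>
    ((H01 Ω : Set (WithLp 2 (L2 Ω × L2Vec Ω))) ∩ Metric.closedBall 0 M)
      ∩ {z | ‖z.fst - W‖ ≤ m * (1 / ((k : ℝ) + 1))} with hC
  obtain ⟨v, hv⟩ := exists_mem_iInter_of_antitone_convex C
    (fun k l hkl z hz => by
      refine ⟨hz.1, le_trans hz.2 (mul_le_mul_of_nonneg_left ?_ hm0)⟩
      refine one_div_le_one_div_of_le (by positivity) ?_
      have : (k : ℝ) ≤ l := by exact_mod_cast hkl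
      linarith)
    (fun k => by
      refine ((Submodule.isClosed_topologicalClosure _).inter Metric.isClosed_closedBall).inter
        (isClosed_le ?_ continuous_const)
      exact (((WithLp.prod_continuous_ofLp 2 _ _).fst).sub continuous_const).norm)
    (fun k => by
      refine ((H01 Ω).convex.inter (convex_closedBall _ _)).inter ?_
      intro z hz z' hz' s t hs ht hst
      have hz : ‖z.fst - W‖ ≤ _ := hz
      have hz' : ‖z'.fst - W‖ ≤ _ := hz'
      change ‖(s • z + t • z').fst - W‖ ≤ _
      have e1 : (s • z + t • z').fst - W = s • (z.fst - W) + t • (z'.fst - W) := by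
        have : W = s • W + t • W := by rw [← add_smul, hst, one_smul]
        rw [WithLp.add_fst, WithLp.smul_fst, WithLp.smul_fst]
        nth_rewrite 1 [this]
        rw [smul_sub, smul_sub]
        abel
      rw [e1]
      refine (norm_add_le _ _).trans ?_
      rw [norm_smul, norm_smul, Real.norm_eq_abs, Real.norm_eq_abs, abs_of_nonneg hs,
        abs_of_nonneg ht]
      refine (add_le_add (mul_le_mul_of_nonneg_left hz hs)
        (mul_le_mul_of_nonneg_left hz' ht)).trans (le_of_eq ?_)
      rw [← add_mul, hst, one_mul])
    (fun k => by
      have hk : (0 : ℝ) < 1 / ((k : ℝ) + 1) := by positivity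
      have hk1 : 1 / ((k : ℝ) + 1) ≤ 1 := by
        rw [div_le_one (by positivity)]
        have : (0 : ℝ) ≤ k := by positivity
        linarith
      obtain ⟨φ, hφ, hφs, hφΩ, hφw, hφ'⟩ := exists_test_function hΩo hΩ hw hw0 hwΩ hk
      have hgb : ∀ x, ‖gradient φ x‖ ≤ K := fun x => by
        rw [gradient, LinearIsometryEquiv.norm_map]; exact hφ' x
      have hgc : Continuous (gradient φ) :=
        (InnerProductSpace.toDual ℝ (Euc n)).symm.continuous.comp
          (hφ.continuous_fderiv (by simp))
      have hφB : ∀ x, ‖φ x‖ ≤ B + 1 := fun x => by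
        have h1 := hφw x
        have h2 := hB x
        rw [Real.norm_eq_abs] at h2 ⊢
        have := abs_sub_abs_le_abs_sub (φ x) (w x)
        linarith
      have h1 : MemLp φ 2 (volume.restrict Ω) :=
        MemLp.of_bound hφ.continuous.aestronglyMeasurable _ (ae_of_all _ hφB)
      have h2 : MemLp (gradient φ) 2 (volume.restrict Ω) :=
        MemLp.of_bound hgc.aestronglyMeasurable _ (ae_of_all _ hgb)
      refine ⟨WithLp.toLp 2 (h1.toLp _, h2.toLp _), ⟨?_, ?_⟩, ?_⟩
      · refine Submodule.le_topologicalClosure _ (Submodule.subset_span ?_)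
        exact ⟨φ, hφ, hφs, hφΩ, h1.coeFn_toLp, h2.coeFn_toLp⟩
      · rw [mem_closedBall_zero_iff, hM]
        refine Real.le_sqrt_of_sq_le ?_
        rw [WithLp.prod_norm_sq_eq_of_L2]
        have n1 : ‖h1.toLp φ‖ ≤ m * (B + 1) := by
          refine Lp.norm_le_of_ae_bound (by positivity) ?_
          filter_upwards [h1.coeFn_toLp] with x hx
          rw [hx]; exact hφB x
        have n2 : ‖h2.toLp (gradient φ)‖ ≤ m * K := by
          refine Lp.norm_le_of_ae_bound K.2 ?_
          filter_upwards [h2.coeFn_toLp] with x hx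
          rw [hx]; exact hgb x
        exact add_le_add (pow_le_pow_left₀ (norm_nonneg _) n1 2)
          (pow_le_pow_left₀ (norm_nonneg _) n2 2)
      · change ‖h1.toLp φ - W‖ ≤ _
        refine Lp.norm_le_of_ae_bound hk.le ?_
        filter_upwards [Lp.coeFn_sub (h1.toLp φ) W, h1.coeFn_toLp, hwL.coeFn_toLp]
          with x e1 e2 e3
        rw [e1, Pi.sub_apply, e2, e3]
        exact hφw x)
    (M := M) (fun z hz => mem_closedBall_zero_iff.1 hz.1.2)
  refine ⟨⟨v, (hv 0).1.1⟩, ?_⟩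
  have h0 : v.fst = W := by
    have hlim : Tendsto (fun k : ℕ => m * (1 / ((k : ℝ) + 1))) atTop (𝓝 (m * 0)) :=
      tendsto_one_div_add_atTop_nhds_zero_nat.const_mul m
    rw [mul_zero] at hlim
    have : ‖v.fst - W‖ ≤ 0 := ge_of_tendsto' hlim fun k => (hv k).2
    exact sub_eq_zero.1 (norm_le_zero_iff.1 this)
  change v.fst =ᵐ[volume.restrict Ω] w
  rw [h0]
  exact hwL.coeFn_toLp

end Mollification

end MFG

end

/-! ### Simplices, conforming meshes and hat functions -/

noncomputable section

namespace MFG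

open MeasureTheory Set
open scoped ContDiff ENNReal

open Filter Topology

section Geometry

open scoped NNReal

variable {n : ℕ} {Ω : Set (Euc n)}

/-- A continuous function that is Lipschitz with the same constant on the members of a finite closed
cover is Lipschitz. -/
theorem lipschitzWith_of_finite_closed_cover {E ι : Type*} [NormedAddCommGroup E] [NormedSpace ℝ E]
    [Finite ι] {h : E → ℝ} {K : ℝ≥0} (hh : Continuous h) (C : ι → Set E)
    (hcl : ∀ i, IsClosed (C i)) (hcov : ∀ x, ∃ i, x ∈ C i)
    (hlip : ∀ i, LipschitzOnWith K h (C i)) : LipschitzWith K h := by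
  refine LipschitzWith.of_le_add_mul K fun y z => ?_
  set p : ℝ → E := fun t => z + t • (y - z) with hp
  have hpc : Continuous p := by fun_prop
  have key := image_le_of_liminf_slope_right_le_deriv_boundary (f := fun t => h (p t)) (a := 0)
    (b := 1) (B := fun t => h z + t * (K * dist y z)) (B' := fun _ => K * dist y z)
    (hh.comp hpc).continuousOn (by simp [hp]) (by fun_prop)
    (fun t _ => by
      have := ((hasDerivAt_id t).mul_const (K * dist y z)).const_add (h z)
      simpa using this.hasDerivWithinAt)
    (fun t _ r hr => by
      -- One of the finitely many sets contains `p s` for `s` arbitrarily close to `t` from the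
      -- right, and by closedness also `p t`. Its Lipschitz bound controls the lower right slope,
      -- which is all the comparison lemma requires.
      obtain ⟨i, hi⟩ : ∃ i, ∃ᶠ s in 𝓝[>] t, p s ∈ C i := by
        by_contra hcon
        push Not at hcon
        have hall : ∀ᶠ s in 𝓝[>] t, ∀ i, p s ∉ C i := eventually_all.2 fun i => by
          simpa using hcon i
        obtain ⟨s, hs⟩ := hall.exists
        obtain ⟨i, hi⟩ := hcov (p s)
        exact hs i hi
      have hti : p t ∈ C i := (hcl i).mem_of_frequently_of_tendsto hi
        ((hpc.tendsto t).mono_left nhdsWithin_le_nhds)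
      refine (hi.and_eventually self_mem_nhdsWithin).mono fun s ⟨hs, hst⟩ => ?_
      have hst : 0 < s - t := sub_pos.2 hst
      have h1 := (le_abs_self _).trans ((hlip i).dist_le_mul _ hs _ hti)
      have h2 : dist (p s) (p t) = (s - t) * dist y z := by
        rw [dist_eq_norm, dist_eq_norm]
        have : p s - p t = (s - t) • (y - z) := by simp only [hp]; module
        rw [this, norm_smul, Real.norm_eq_abs, abs_of_pos hst]
      rw [h2] at h1
      refine lt_of_le_of_lt ?_ hr
      rw [slope_def_field, div_le_iff₀ hst]
      linarith)
  have := key (right_mem_Icc.2 zero_le_one)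
  simpa [hp] using this

/-- Moving a boundary point slightly in the direction `-e` puts it strictly below the graph, where a
whole neighbourhood misses `Ω`. So no boundary point is interior to the closure. -/
theorem interior_closure_eq (hΩo : IsOpen Ω) (hΩ : HasLipschitzBoundary Ω) :
    interior (closure Ω) = Ω := by
  refine subset_antisymm (fun x hx => ?_) (interior_maximal subset_closure hΩo)
  by_contra hxΩ
  have hfr : x ∈ frontier Ω := ⟨interior_subset hx, by rwa [hΩo.interior_eq]⟩
  obtain ⟨r, hr, e, he, L, g, hg, hball⟩ := hΩ x hfr
  set P := (ℝ ∙ e)ᗮ.orthogonalProjectionOnto with hP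
  have hle : inner ℝ e x ≤ g (P x) := by
    by_contra hcon
    exact hxΩ ((hball x (Metric.mem_ball_self hr)).2 (not_le.1 hcon))
  have hPe : P e = 0 := by
    rw [hP, Submodule.orthogonalProjectionOnto_eq_zero_iff, Submodule.orthogonal_orthogonal]
    exact Submodule.mem_span_singleton_self e
  have hlim : Tendsto (fun t : ℝ => x - t • e) (𝓝[>] 0) (𝓝 x) := by
    have : Tendsto (fun t : ℝ => x - t • e) (𝓝 0) (𝓝 (x - (0 : ℝ) • e)) :=
      Continuous.tendsto (by fun_prop) 0
    rw [zero_smul, sub_zero] at this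
    exact this.mono_left nhdsWithin_le_nhds
  obtain ⟨t, ⟨ht1, ht2⟩, ht0⟩ := ((hlim.eventually (Metric.ball_mem_nhds x hr)).and
    (hlim.eventually (isOpen_interior.mem_nhds hx))).and self_mem_nhdsWithin |>.exists
  have ht0 : 0 < t := ht0
  have hcl : x - t • e ∈ closure Ω := interior_subset ht2
  have hopen : IsOpen ({y | inner ℝ e y < g (P y)} ∩ Metric.ball x r) :=
    (isOpen_lt (by fun_prop) (hg.continuous.comp P.continuous)).inter Metric.isOpen_ball
  have hmem : x - t • e ∈ {y | inner ℝ e y < g (P y)} ∩ Metric.ball x r := by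
    refine ⟨?_, ht1⟩
    change inner ℝ e (x - t • e) < g (P (x - t • e))
    rw [map_sub, map_smul, hPe, smul_zero, sub_zero, inner_sub_right, inner_smul_right,
      real_inner_self_eq_norm_sq, he]
    linarith
  obtain ⟨y, ⟨hy1, hy2⟩, hyΩ⟩ := mem_closure_iff.1 hcl _ hopen hmem
  have hy1 : inner ℝ e y < g (P y) := hy1
  exact absurd ((hball y hy2).1 hyΩ) (not_lt.2 hy1.le)

namespace Simp

variable (K : Simp n)

theorem mem_cell {x : Euc n} : x ∈ K.cell ↔ ∀ i, 0 ≤ K.coord i x := by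
  rw [cell, K.convexHull_eq_nonneg_coord]; rfl

theorem convex_cell : Convex ℝ K.cell := convex_convexHull ℝ _

theorem isCompact_cell : IsCompact K.cell := (finite_range K).isCompact_convexHull (𝕜 := ℝ)

theorem isClosed_cell : IsClosed K.cell := K.isCompact_cell.isClosed

theorem nonempty_interior_cell : (interior K.cell).Nonempty :=
  ⟨_, K.centroid_mem_interior_convexHull⟩

theorem closure_interior_cell : closure (interior K.cell) = K.cell := by
  rw [K.convex_cell.closure_interior_eq_closure_of_nonempty_interior K.nonempty_interior_cell,
    K.isClosed_cell.closure_eq]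

theorem vertex_mem_cell (i : Fin (n + 1)) : K i ∈ K.cell := subset_convexHull ℝ _ ⟨i, rfl⟩

theorem coord_le_one {x : Euc n} (hx : x ∈ K.cell) (i : Fin (n + 1)) : K.coord i x ≤ 1 := by
  rw [← K.sum_coord_apply_eq_one x]
  exact Finset.single_le_sum (f := fun i => K.coord i x) (fun j _ => K.mem_cell.1 hx j)
    (Finset.mem_univ i)

theorem eq_vertex_of_coord_eq_one {x : Euc n} (hx : x ∈ K.cell) {i : Fin (n + 1)}
    (h : K.coord i x = 1) : x = K i := by
  classical
  refine K.ext_elem fun j => ?_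
  rw [K.coord_apply]
  split_ifs with hj
  · rw [hj, h]
  · have h1 : K.coord i x + K.coord j x ≤ ∑ l, K.coord l x := by
      rw [← Finset.sum_pair (f := fun l => K.coord l x) (Ne.symm hj)]
      exact Finset.sum_le_sum_of_subset_of_nonneg (Finset.subset_univ _)
        fun l _ _ => K.mem_cell.1 hx l
    rw [K.sum_coord_apply_eq_one] at h1
    exact le_antisymm (by linarith) (K.mem_cell.1 hx j)

/-- A vertex of a simplex in the convex hull of a subset `S` of the simplex belongs to `S`. -/
theorem vertex_mem_of_mem_convexHull {S : Set (Euc n)} (hS : S ⊆ K.cell) {i : Fin (n + 1)}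
    (h : K i ∈ convexHull ℝ S) : K i ∈ S := by
  by_contra hcon
  have hsub : S ⊆ {y | K.coord i y < 1} := fun y hy => by
    refine lt_of_le_of_ne (K.coord_le_one (hS hy) i) fun h1 => hcon ?_
    rwa [← K.eq_vertex_of_coord_eq_one (hS hy) h1]
  have hconv : Convex ℝ {y | K.coord i y < 1} :=
    (convex_Iio (1 : ℝ)).affine_preimage (K.coord i)
  have : K.coord i (K i) < 1 := convexHull_min hsub hconv h
  rw [K.coord_apply_eq] at this
  exact lt_irrefl _ this

/-- The affine function on the simplex that takes the value one at `p` if `p` is a vertex, and that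
vanishes at all other vertices. -/
def nodalAff (p : Euc n) : Euc n →ᵃ[ℝ] ℝ :=
  open Classical in ∑ i, if K i = p then K.coord i else 0

theorem nodalAff_vertex (i : Fin (n + 1)) : K.nodalAff (K i) = K.coord i := by
  classical
  rw [nodalAff, Finset.sum_eq_single i]
  · simp
  · intro j _ hj
    rw [if_neg fun h => hj (K.ind.injective h)]
  · simp

theorem nodalAff_of_notMem {p : Euc n} (hp : p ∉ range K) : K.nodalAff p = 0 := by
  classical
  rw [nodalAff]
  exact Finset.sum_eq_zero fun i _ => if_neg fun h => hp ⟨i, h⟩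

theorem nodalAff_apply_vertex (p : Euc n) (i : Fin (n + 1)) [Decidable (K i = p)] :
    K.nodalAff p (K i) = if K i = p then 1 else 0 := by
  split_ifs with h
  · rw [← h, nodalAff_vertex, K.coord_apply_eq]
  · by_cases hp : p ∈ range K
    · obtain ⟨j, rfl⟩ := hp
      rw [nodalAff_vertex, K.coord_apply_ne fun hij => h (by rw [hij])]
    · rw [nodalAff_of_notMem K hp]; rfl

theorem nodalAff_nonneg {x : Euc n} (hx : x ∈ K.cell) (p : Euc n) : 0 ≤ K.nodalAff p x := by
  by_cases hp : p ∈ range K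
  · obtain ⟨j, rfl⟩ := hp
    rw [nodalAff_vertex]; exact K.mem_cell.1 hx j
  · rw [nodalAff_of_notMem K hp]; exact le_rfl

theorem nodalAff_le_one {x : Euc n} (hx : x ∈ K.cell) (p : Euc n) : K.nodalAff p x ≤ 1 := by
  by_cases hp : p ∈ range K
  · obtain ⟨j, rfl⟩ := hp
    rw [nodalAff_vertex]; exact K.coord_le_one hx j
  · rw [nodalAff_of_notMem K hp]; exact zero_le_one

theorem mem_range_of_nodalAff_pos {p x : Euc n} (h : 0 < K.nodalAff p x) : p ∈ range K := by
  by_contra hp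
  rw [nodalAff_of_notMem K hp] at h
  exact lt_irrefl _ h

/-- `G` is used both as evaluation at a point and as `affGrad`, so values and gradients of nodal
sums reduce to the vertices of one element in the same way. -/
theorem sum_smul_nodalAff {E : Type*} [AddCommGroup E] [Module ℝ E] (s : Finset (Euc n))
    (F : Euc n → ℝ) (G : (Euc n →ᵃ[ℝ] ℝ) → E) (hG : G 0 = 0) [DecidableEq (Euc n)] :
    ∑ p ∈ s, F p • G (K.nodalAff p) = ∑ i, if K i ∈ s then F (K i) • G (K.coord i) else 0 := by
  have h : ∀ p, G (K.nodalAff p) = ∑ i, if K i = p then G (K.coord i) else 0 := by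
    intro p
    by_cases hp : p ∈ range K
    · obtain ⟨j, rfl⟩ := hp
      rw [nodalAff_vertex, Finset.sum_eq_single j]
      · simp
      · intro i _ hi
        rw [if_neg fun h => hi (K.ind.injective h)]
      · simp
    · rw [nodalAff_of_notMem K hp, hG]
      exact (Finset.sum_eq_zero fun i _ => if_neg fun h => hp ⟨i, h⟩).symm
  simp only [h, Finset.smul_sum]
  rw [Finset.sum_comm]
  refine Finset.sum_congr rfl fun i _ => ?_
  simp only [smul_ite, smul_zero]
  rw [Finset.sum_ite_eq]

theorem sum_mul_nodalAff (s : Finset (Euc n)) (F : Euc n → ℝ) (x : Euc n) [DecidableEq (Euc n)] :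
    ∑ p ∈ s, F p * K.nodalAff p x = ∑ i, if K i ∈ s then F (K i) * K.coord i x else 0 :=
  K.sum_smul_nodalAff s F (fun a => a x) rfl

end Simp

namespace Mesh

variable (T : Mesh Ω)

theorem cell_subset {K : Simp n} (hK : K ∈ T.elements) : K.cell ⊆ closure Ω := by
  rw [← T.iUnion_eq]
  exact subset_biUnion_of_mem (u := fun K : Simp n => K.cell) hK

theorem exists_mem_cell {x : Euc n} (hx : x ∈ closure Ω) : ∃ K ∈ T.elements, x ∈ K.cell := by
  rw [← T.iUnion_eq] at hx
  simpa using hx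

/-- A point of `K'` is a limit of interior points of `K'`; if it were interior to `K`, the two
interiors would meet. This turns conformity, stated for frontiers, into a statement about cells. -/
theorem mem_frontier_of_mem_inter {K K' : Simp n} (hK : K ∈ T.elements) (hK' : K' ∈ T.elements)
    (hne : K ≠ K') {x : Euc n} (hx : x ∈ K.cell) (hx' : x ∈ K'.cell) : x ∈ frontier K.cell := by
  refine ⟨subset_closure hx, fun hint => ?_⟩
  rw [← K'.closure_interior_cell] at hx'
  obtain ⟨y, hy, hy'⟩ := mem_closure_iff.1 hx' _ isOpen_interior hint
  exact disjoint_left.1 (T.disjoint_interior K hK K' hK' hne) hy hy'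

/-- The local nodal functions of two elements agree on their intersection. -/
theorem nodalAff_eq {K K' : Simp n} (hK : K ∈ T.elements) (hK' : K' ∈ T.elements)
    {x : Euc n} (hx : x ∈ K.cell) (hx' : x ∈ K'.cell) (p : Euc n) :
    K.nodalAff p x = K'.nodalAff p x := by
  classical
  by_cases hne : K = K'
  · rw [hne]
  obtain ⟨S, hS, hSeq⟩ := T.conforming K hK K' hK' hne
  obtain ⟨S', hS', hSeq'⟩ := T.conforming K' hK' K hK (Ne.symm hne)
  rw [inter_comm, hSeq] at hSeq'
  have hxS : x ∈ convexHull ℝ S := by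
    rw [← hSeq]
    exact ⟨T.mem_frontier_of_mem_inter hK hK' hne hx hx',
      T.mem_frontier_of_mem_inter hK' hK (Ne.symm hne) hx' hx⟩
  -- Conformity in the two orders represents the same intersection as the hull of vertices of `K`
  -- and as the hull of vertices of `K'`. As vertices are extreme points, the first set lies in the
  -- second. Both affine functions then agree on `S`, hence on its hull.
  have hSK' : S ⊆ range K' := by
    intro q hq
    obtain ⟨i, rfl⟩ := hS hq
    have h1 : K i ∈ convexHull ℝ S' := by
      rw [← hSeq']; exact subset_convexHull ℝ S hq
    refine hS' (K.vertex_mem_of_mem_convexHull ?_ h1)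
    intro y hy
    have : y ∈ convexHull ℝ S := by rw [hSeq']; exact subset_convexHull ℝ S' hy
    rw [← hSeq] at this
    exact K.isClosed_cell.frontier_subset this.1
  have hsub : S ⊆ (K.nodalAff p - K'.nodalAff p) ⁻¹' {0} := by
    intro q hq
    obtain ⟨i, hi⟩ := hS hq
    obtain ⟨j, hj⟩ := hSK' hq
    have h1 := K.nodalAff_apply_vertex p i
    have h2 := K'.nodalAff_apply_vertex p j
    rw [hi] at h1
    rw [hj] at h2
    simp [h1, h2]
  have := convexHull_min hsub ((convex_singleton (0 : ℝ)).affine_preimage _) hxS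
  exact sub_eq_zero.1 (by simpa using this)

/-- An element contains `p` only if `p` is one of its vertices, for vertices `p` of the mesh. -/
theorem mem_range_of_mem_cell {K K' : Simp n} (hK : K ∈ T.elements) (hK' : K' ∈ T.elements)
    {i : Fin (n + 1)} (h : K i ∈ K'.cell) : K i ∈ range K' := by
  refine K'.mem_range_of_nodalAff_pos (x := K i) ?_
  rw [← T.nodalAff_eq hK hK' (K.vertex_mem_cell i) h, K.nodalAff_vertex, K.coord_apply_eq]
  exact zero_lt_one

/-- Points near `z` in `Ω` lie in elements that contain `z`. -/
theorem eventually_mem_cell {z : Euc n} :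
    ∀ᶠ y in 𝓝 z, ∀ K ∈ T.elements, y ∈ K.cell → z ∈ K.cell := by
  refine (Finset.eventually_all T.elements).2 fun K _ => ?_
  by_cases hz : z ∈ K.cell
  · exact Eventually.of_forall fun y _ => hz
  · filter_upwards [K.isClosed_cell.isOpen_compl.mem_nhds hz] with y hy hy' using absurd hy' hy

/-- The hat function of an interior vertex is positive only inside `Ω`. -/
theorem mem_of_nodalAff_pos (hΩo : IsOpen Ω) (hΩ : interior (closure Ω) = Ω) {K : Simp n}
    (hK : K ∈ T.elements) {x p : Euc n} (hp : p ∈ Ω) (hx : x ∈ K.cell)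
    (hpos : 0 < K.nodalAff p x) : x ∈ Ω := by
  obtain ⟨i, rfl⟩ := K.mem_range_of_nodalAff_pos hpos
  have hlim : Tendsto (fun s : ℝ => AffineMap.lineMap (K i) x s) (𝓝[>] 0) (𝓝 (K i)) := by
    have : Tendsto (fun s : ℝ => AffineMap.lineMap (K i) x s) (𝓝 0)
        (𝓝 (AffineMap.lineMap (K i) x (0 : ℝ))) :=
      Continuous.tendsto AffineMap.lineMap_continuous 0
    rw [AffineMap.lineMap_apply_zero] at this
    exact this.mono_left nhdsWithin_le_nhds
  obtain ⟨s, ⟨hsΩ, hs1⟩, hs0⟩ := ((hlim.eventually (hΩo.mem_nhds hp)).and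
    (nhdsWithin_le_nhds (Iio_mem_nhds (zero_lt_one' ℝ)))).and self_mem_nhdsWithin |>.exists
  have hs0 : 0 < s := hs0
  have hs1 : s < 1 := hs1
  -- A homothety centred at the vertex that moves `x` into `Ω`. For `y` near `x`, an element
  -- containing `D y` has the centre as a vertex. Undoing the homothety rescales its other
  -- coordinates by a positive factor, and the coordinate of the centre stays positive by
  -- continuity. So `y` lies in that element, and `x` is interior to `closure Ω`.
  set D : Euc n → Euc n := fun y => AffineMap.lineMap (K i) y s with hD
  have hDc : Continuous D := by
    have : D = fun y => s • (y - K i) + K i := by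
      funext y; simp [hD, AffineMap.lineMap_apply]
    rw [this]; fun_prop
  have hcoord : ∀ (K' : Simp n) (l : Fin (n + 1)) (y : Euc n),
      K'.coord l (D y) = (1 - s) * K'.coord l (K i) + s * K'.coord l y := by
    intro K' l y
    rw [hD, AffineMap.apply_lineMap, AffineMap.lineMap_apply_module, smul_eq_mul, smul_eq_mul]
  have hzK : D x ∈ K.cell := K.convex_cell.lineMap_mem (K.vertex_mem_cell i) hx ⟨hs0.le, hs1.le⟩
  rw [← hΩ, mem_interior_iff_mem_nhds]
  have hev1 : ∀ᶠ y in 𝓝 x, D y ∈ Ω := (hDc.tendsto x).eventually (hΩo.mem_nhds hsΩ)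
  have hev2 := (hDc.tendsto x).eventually (T.eventually_mem_cell (z := D x))
  have hev3 : ∀ᶠ y in 𝓝 x, ∀ K' ∈ T.elements, ∀ j, 0 < K'.coord j x → 0 < K'.coord j y := by
    refine (Finset.eventually_all T.elements).2 fun K' _ => eventually_all.2 fun j => ?_
    by_cases hj : 0 < K'.coord j x
    · have hc : Continuous (K'.coord j) := (contDiff_affine (K'.coord j)).continuous
      filter_upwards [(hc.tendsto x).eventually_const_lt hj] with y hy _ using hy
    · exact Eventually.of_forall fun y h => absurd h hj
  filter_upwards [hev1, hev2, hev3] with y h1 h2 h3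
  obtain ⟨K', hK', hyK'⟩ := T.exists_mem_cell (subset_closure h1)
  have hzK' := h2 K' hK' hyK'
  have hag := T.nodalAff_eq hK hK' hzK hzK' (K i)
  have hpos' : 0 < K'.nodalAff (K i) (D x) := by
    rw [← hag, K.nodalAff_vertex, hcoord, K.coord_apply_eq]
    rw [K.nodalAff_vertex] at hpos
    have := mul_pos hs0 hpos
    linarith
  obtain ⟨j, hj⟩ := K'.mem_range_of_nodalAff_pos hpos'
  refine T.cell_subset hK' (K'.mem_cell.2 fun l => ?_)
  by_cases hl : l = j
  · subst hl
    refine (h3 K' hK' l ?_).le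
    rw [K.nodalAff_vertex, ← hj, K'.nodalAff_vertex, hcoord, hcoord, ← hj, K'.coord_apply_eq,
      hj, K.coord_apply_eq] at hag
    rw [K.nodalAff_vertex] at hpos
    have : s * K'.coord l x = s * K.coord i x := by linarith
    rwa [mul_left_cancel₀ hs0.ne' this]
  · have h4 := K'.mem_cell.1 hyK' l
    rw [hcoord, ← hj, K'.coord_apply_ne hl, mul_zero, zero_add] at h4
    exact nonneg_of_mul_nonneg_right h4 hs0

/-- The hat function of `p`, extended by zero outside `closure Ω`. -/
def hat (p x : Euc n) : ℝ :=
  open Classical in if h : ∃ K ∈ T.elements, x ∈ K.cell then (Classical.choose h).nodalAff p x else 0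

theorem hat_eq {K : Simp n} (hK : K ∈ T.elements) {x : Euc n} (hx : x ∈ K.cell) (p : Euc n) :
    T.hat p x = K.nodalAff p x := by
  have h : ∃ K ∈ T.elements, x ∈ K.cell := ⟨K, hK, hx⟩
  rw [hat, dif_pos h]
  exact T.nodalAff_eq (Classical.choose_spec h).1 hK (Classical.choose_spec h).2 hx p

theorem hat_nonneg (p x : Euc n) : 0 ≤ T.hat p x := by
  by_cases h : ∃ K ∈ T.elements, x ∈ K.cell
  · obtain ⟨K, hK, hx⟩ := h
    rw [T.hat_eq hK hx]; exact K.nodalAff_nonneg hx p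
  · rw [hat, dif_neg h]

theorem hat_le_one (p x : Euc n) : T.hat p x ≤ 1 := by
  by_cases h : ∃ K ∈ T.elements, x ∈ K.cell
  · obtain ⟨K, hK, hx⟩ := h
    rw [T.hat_eq hK hx]; exact K.nodalAff_le_one hx p
  · rw [hat, dif_neg h]; exact zero_le_one

theorem hat_eq_zero (hΩo : IsOpen Ω) (hΩ : interior (closure Ω) = Ω) {p : Euc n} (hp : p ∈ Ω)
    {x : Euc n} (hx : x ∉ Ω) : T.hat p x = 0 := by
  by_cases h : ∃ K ∈ T.elements, x ∈ K.cell
  · obtain ⟨K, hK, hxK⟩ := h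
    rw [T.hat_eq hK hxK]
    refine le_antisymm (not_lt.1 fun hpos => hx ?_) (K.nodalAff_nonneg hxK p)
    exact T.mem_of_nodalAff_pos hΩo hΩ hK hp hxK hpos
  · rw [hat, dif_neg h]

/-- The space is covered by `Ωᶜ`, where the hat function of an interior vertex vanishes, and by
finitely many cells, where it is affine. -/
theorem exists_lipschitzWith_hat (hΩo : IsOpen Ω) (hΩ : interior (closure Ω) = Ω) {p : Euc n}
    (hp : p ∈ Ω) : ∃ L : ℝ≥0, LipschitzWith L (T.hat p) := by
  set C : Option {K // K ∈ T.elements} → Set (Euc n) := fun o => o.elim Ωᶜ fun K => K.1.cell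
    with hC
  have hcl : ∀ o, IsClosed (C o) := by
    rintro (_ | K)
    · exact hΩo.isClosed_compl
    · exact K.1.isClosed_cell
  have hcov : ∀ x, ∃ o, x ∈ C o := fun x => by
    by_cases hx : x ∈ Ω
    · obtain ⟨K, hK, hxK⟩ := T.exists_mem_cell (subset_closure hx)
      exact ⟨some ⟨K, hK⟩, hxK⟩
    · exact ⟨none, hx⟩
  set L : ℝ≥0 := ∑ K ∈ T.elements, ‖affGrad (K.nodalAff p)‖₊ with hL
  have hlip : ∀ o, LipschitzOnWith L (T.hat p) (C o) := by
    rintro (_ | ⟨K, hK⟩)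
    · refine LipschitzOnWith.of_dist_le_mul fun x hx y hy => ?_
      rw [T.hat_eq_zero hΩo hΩ hp hx, T.hat_eq_zero hΩo hΩ hp hy, dist_self]
      positivity
    · refine LipschitzOnWith.of_dist_le_mul fun x hx y hy => ?_
      rw [T.hat_eq hK hx, T.hat_eq hK hy, Real.dist_eq]
      have h1 : K.nodalAff p x - K.nodalAff p y = inner ℝ (affGrad (K.nodalAff p)) (x - y) := by
        rw [inner_affGrad]
        exact ((K.nodalAff p).linearMap_vsub x y).symm
      rw [h1, dist_eq_norm]
      refine (abs_real_inner_le_norm _ _).trans (mul_le_mul_of_nonneg_right ?_ (norm_nonneg _))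
      have : ‖affGrad (K.nodalAff p)‖₊ ≤ L :=
        Finset.single_le_sum (f := fun K : Simp n => ‖affGrad (K.nodalAff p)‖₊)
          (fun _ _ => zero_le) hK
      exact_mod_cast this
  have hcont : Continuous (T.hat p) :=
    (locallyFinite_of_finite C).continuous (iUnion_eq_univ_iff.2 hcov) hcl
      fun o => (hlip o).continuousOn
  exact ⟨L, lipschitzWith_of_finite_closed_cover hcont C hcl hcov hlip⟩

end Mesh

end Geometry

end MFG

end

/-! ### The nodal basis of the finite element space -/

noncomputable section

namespace MFG

open MeasureTheory Set
open scoped ContDiff ENNReal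

open Filter Topology

section FiniteElements

open scoped NNReal

variable {n : ℕ} {Ω : Set (Euc n)}

theorem affGrad_sum_smul {ι : Type*} (s : Finset ι) (w : ι → ℝ) (a : ι → Euc n →ᵃ[ℝ] ℝ) :
    affGrad (∑ i ∈ s, w i • a i) = ∑ i ∈ s, w i • affGrad (a i) := by
  classical
  refine ext_inner_right ℝ fun y => ?_
  rw [inner_affGrad, sum_inner]
  simp only [inner_smul_left, inner_affGrad, RCLike.conj_to_real]
  induction s using Finset.induction_on with
  | empty => simp
  | insert i s hi ih => rw [Finset.sum_insert hi, Finset.sum_insert hi, ← ih]; simp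

theorem affine_sum_smul_apply {ι : Type*} (s : Finset ι) (w : ι → ℝ) (a : ι → Euc n →ᵃ[ℝ] ℝ)
    (x : Euc n) : (∑ i ∈ s, w i • a i) x = ∑ i ∈ s, w i * a i x := by
  classical
  induction s using Finset.induction_on with
  | empty => simp
  | insert i s hi ih => rw [Finset.sum_insert hi, Finset.sum_insert hi, ← ih]; simp

theorem coeFn_fn_sum {ι : Type*} (s : Finset ι) (w : ι → ℝ) (B : ι → H01 Ω) :
    fn (∑ i ∈ s, w i • B i) =ᵐ[volume.restrict Ω] fun x => ∑ i ∈ s, w i * fn (B i) x := by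
  classical
  induction s using Finset.induction_on with
  | empty =>
    simp only [Finset.sum_empty]
    exact Lp.coeFn_zero ℝ 2 (volume.restrict Ω)
  | insert i s hi ih =>
    rw [Finset.sum_insert hi, fn_add, fn_smul]
    filter_upwards [ih, Lp.coeFn_add (w i • fn (B i)) (fn (∑ j ∈ s, w j • B j)),
      Lp.coeFn_smul (w i) (fn (B i))] with x h1 h2 h3
    rw [h2, Pi.add_apply, h3, h1, Finset.sum_insert hi]
    rfl

namespace Mesh

variable (T : Mesh Ω)

/-- The vertices of the mesh that lie in `Ω`. -/
def nodes : Finset (Euc n) :=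
  open Classical in
  (T.elements.biUnion fun K => Finset.univ.image fun i : Fin (n + 1) => K i).filter (· ∈ Ω)

theorem mem_nodes {p : Euc n} : p ∈ T.nodes ↔ (∃ K ∈ T.elements, p ∈ range K) ∧ p ∈ Ω := by
  classical
  simp [nodes]

/-- The function that is constant on the interior of each element. -/
def pw {F : Type*} [AddCommMonoid F] (c : Simp n → F) (x : Euc n) : F :=
  ∑ K ∈ T.elements, (interior K.cell).indicator (fun _ => c K) x

theorem pw_eq {F : Type*} [AddCommMonoid F] (c : Simp n → F) {K : Simp n} (hK : K ∈ T.elements)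
    {x : Euc n} (hx : x ∈ interior K.cell) : T.pw c x = c K := by
  rw [pw, Finset.sum_eq_single K, indicator_of_mem hx]
  · intro K' hK' hne
    refine indicator_of_notMem (fun hx' => ?_) _
    exact disjoint_left.1 (T.disjoint_interior K' hK' K hK hne) hx' hx
  · exact fun h => absurd hK h

theorem bddMeas_pw {F : Type*} [NormedAddCommGroup F] [MeasurableSpace F] [MeasurableAdd₂ F]
    (c : Simp n → F) : BddMeas (T.pw c) := by
  refine BddMeas.sum fun K _ => ⟨measurable_const.indicator isOpen_interior.measurableSet, ‖c K‖,
    fun x => ?_⟩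
  exact norm_indicator_le_norm_self (fun _ => c K) x

theorem ae_notMem_frontier (K : Simp n) : ∀ᵐ x ∂(volume : Measure (Euc n)), x ∉ frontier K.cell :=
  measure_eq_zero_iff_ae_notMem.1 (K.convex_cell.addHaar_frontier volume)

theorem ae_mem_interior (hΩo : IsOpen Ω) :
    ∀ᵐ x ∂volume.restrict Ω, ∃ K ∈ T.elements, x ∈ interior K.cell := by
  have h0 : ∀ᵐ x ∂(volume : Measure (Euc n)), ∀ K ∈ T.elements, x ∉ frontier K.cell :=
    (Finset.eventually_all T.elements).2 fun K _ => ae_notMem_frontier K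
  filter_upwards [ae_restrict_of_ae h0, ae_restrict_mem hΩo.measurableSet] with x hx hxΩ
  obtain ⟨K, hK, hxK⟩ := T.exists_mem_cell (subset_closure hxΩ)
  refine ⟨K, hK, ?_⟩
  by_contra hint
  exact hx K hK ⟨subset_closure hxK, hint⟩

variable {T}

theorem interior_cell_subset (hΩ : interior (closure Ω) = Ω) {K : Simp n} (hK : K ∈ T.elements) :
    interior K.cell ⊆ Ω := by
  rw [← hΩ]
  exact interior_mono (T.cell_subset hK)

theorem exists_basis (hΩo : IsOpen Ω) (hΩb : Bornology.IsBounded Ω)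
    (hΩ : interior (closure Ω) = Ω) :
    ∃ B : T.nodes → H01 Ω, ∀ p, fn (B p) =ᵐ[volume.restrict Ω] T.hat p := by
  have h : ∀ p : T.nodes, ∃ v : H01 Ω, fn v =ᵐ[volume.restrict Ω] T.hat p := fun p => by
    obtain ⟨L, hL⟩ := T.exists_lipschitzWith_hat hΩo hΩ (T.mem_nodes.1 p.2).2
    exact exists_H01_of_lipschitz hΩo hΩb hL (T.hat_nonneg p)
      fun x hx => T.hat_eq_zero hΩo hΩ (T.mem_nodes.1 p.2).2 hx
  choose B hB using h
  exact ⟨B, hB⟩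

section Basis

variable {B : T.nodes → H01 Ω}

theorem fn_sum_basis (hB : ∀ p, fn (B p) =ᵐ[volume.restrict Ω] T.hat p)
    (w : T.nodes → ℝ) :
    fn (∑ p, w p • B p) =ᵐ[volume.restrict Ω] fun x => ∑ p, w p * T.hat p x := by
  filter_upwards [coeFn_fn_sum Finset.univ w B, ae_all_iff.2 hB] with x h1 h2
  rw [h1]
  exact Finset.sum_congr rfl fun p _ => by rw [h2]

theorem fn_sum_basis_eq (hB : ∀ p, fn (B p) =ᵐ[volume.restrict Ω] T.hat p)
    (w : T.nodes → ℝ) {K : Simp n} (hK : K ∈ T.elements) :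
    ∀ᵐ x ∂volume.restrict Ω, x ∈ K.cell → fn (∑ p, w p • B p) x
      = (∑ p : T.nodes, w p • K.nodalAff (p : Euc n)) x := by
  filter_upwards [fn_sum_basis hB w] with x hx hxK
  rw [hx, affine_sum_smul_apply]
  exact Finset.sum_congr rfl fun p _ => by rw [T.hat_eq hK hxK]

theorem sum_basis_mem_V (hB : ∀ p, fn (B p) =ᵐ[volume.restrict Ω] T.hat p)
    (w : T.nodes → ℝ) : ∑ p, w p • B p ∈ T.V :=
  fun _ hK => ⟨_, fn_sum_basis_eq hB w hK⟩

theorem grad_sum_basis (hB : ∀ p, fn (B p) =ᵐ[volume.restrict Ω] T.hat p)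
    (hΩo : IsOpen Ω) (hΩb : Bornology.IsBounded Ω)
    (hΩ : interior (closure Ω) = Ω) (w : T.nodes → ℝ) : grad (∑ p, w p • B p) =ᵐ[volume.restrict Ω]
      fun x => ∑ p, w p • T.pw (fun K => affGrad (K.nodalAff (p : Euc n))) x := by
  have h : ∀ᵐ x ∂volume.restrict Ω, ∀ K ∈ T.elements, x ∈ interior K.cell →
      grad (∑ p, w p • B p) x = affGrad (∑ p : T.nodes, w p • K.nodalAff (p : Euc n)) := by
    refine (Finset.eventually_all T.elements).2 fun K hK => ?_
    refine grad_eq_of_affine hΩb _ isOpen_interior (interior_cell_subset hΩ hK) _ ?_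
    filter_upwards [fn_sum_basis_eq hB w hK] with x hx hxK using hx (interior_subset hxK)
  filter_upwards [h, T.ae_mem_interior hΩo] with x hx ⟨K, hK, hxK⟩
  rw [hx K hK hxK, affGrad_sum_smul]
  exact Finset.sum_congr rfl fun p _ => by rw [T.pw_eq _ hK hxK]

/-- The finite element space is spanned by the hat functions of the interior vertices. -/
theorem exists_coeff (hB : ∀ p, fn (B p) =ᵐ[volume.restrict Ω] T.hat p)
    (hΩo : IsOpen Ω) (hΩb : Bornology.IsBounded Ω)
    (hΩ : interior (closure Ω) = Ω) {v : H01 Ω} (hv : v ∈ T.V) :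
    ∃ w : T.nodes → ℝ, v = ∑ p, w p • B p := by
  classical
  have hv' : ∀ K : T.elements, ∃ a : Euc n →ᵃ[ℝ] ℝ,
    ∀ᵐ x ∂volume.restrict Ω, x ∈ K.1.cell → fn v x = a x := fun K => hv K.1 K.2
  choose a ha using hv'
  have hgrad : ∀ᵐ x ∂volume.restrict Ω, ∀ K : T.elements, x ∈ interior K.1.cell →
      grad v x = affGrad (a K) := by
    refine ae_all_iff.2 fun K => ?_
    refine grad_eq_of_affine hΩb v isOpen_interior (interior_cell_subset hΩ K.2) _ ?_
    filter_upwards [ha K] with x hx hxK using hx (interior_subset hxK)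
  set L : ℝ≥0 := ∑ K : T.elements, ‖affGrad (a K)‖₊ with hL
  have hbound : ∀ᵐ x ∂volume.restrict Ω, ‖grad v x‖ ≤ L := by
    filter_upwards [hgrad, T.ae_mem_interior hΩo] with x hx ⟨K, hK, hxK⟩
    rw [hx ⟨K, hK⟩ hxK]
    have : ‖affGrad (a ⟨K, hK⟩)‖₊ ≤ L :=
      Finset.single_le_sum (f := fun K : T.elements => ‖affGrad (a K)‖₊)
        (fun _ _ => zero_le) (Finset.mem_univ _)
    exact_mod_cast this
  obtain ⟨w, hwL, hw⟩ := exists_lipschitz_representative hΩo hΩb v hbound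
  -- The representative vanishes almost everywhere, hence everywhere, on the open complement of
  -- `closure Ω`; by continuity it vanishes on the closure of that complement, which is `Ωᶜ` because
  -- `interior (closure Ω) = Ω`.
  have hwΩ : ∀ x, x ∉ Ω → w x = 0 := by
    have h1 : EqOn w (fun _ => 0) (closure Ω)ᶜ := by
      refine Measure.eqOn_open_of_ae_eq (μ := volume) ?_ isClosed_closure.isOpen_compl
        hwL.continuous.continuousOn continuousOn_const
      filter_upwards [ae_restrict_of_ae hw,
        ae_restrict_mem isClosed_closure.isOpen_compl.measurableSet] with x hx hxc
      rw [hx, indicator_of_notMem fun h => hxc (subset_closure h)]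
    have h2 := h1.closure hwL.continuous continuous_const
    intro x hx
    refine h2 ?_
    rw [closure_compl, hΩ]
    exact hx
  have hwK : ∀ K : T.elements, EqOn w (a K) K.1.cell := by
    intro K
    refine Measure.eqOn_of_ae_eq (μ := volume) ?_ hwL.continuous.continuousOn
      (contDiff_affine (a K)).continuous.continuousOn (K.1.closure_interior_cell.symm.subset)
    have h1 := ae_imp_of_ae_restrict (ha K)
    refine (ae_restrict_iff' K.1.isClosed_cell.measurableSet).2 ?_
    filter_upwards [hw, h1, ae_notMem_frontier K.1] with x e1 e2 e3 hxK
    have hxi : x ∈ interior K.1.cell := by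
      by_contra hint
      exact e3 ⟨subset_closure hxK, hint⟩
    have hxΩ := interior_cell_subset hΩ K.2 hxi
    rw [e1, indicator_of_mem hxΩ, e2 hxΩ hxK]
  -- The coefficients are the nodal values of the continuous representative. Vertices on the
  -- boundary drop out because it vanishes there, and on each cell an affine function is recovered
  -- from its vertex values.
  refine ⟨fun p => w p, fn_injective hΩo hΩb (Lp.ext ?_)⟩
  filter_upwards [ae_all_iff.2 ha, fn_sum_basis hB fun p => w p, T.ae_mem_interior hΩo]
    with x hx hx' ⟨K, hK, hxK⟩
  have hxc := interior_subset hxK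
  rw [hx', hx ⟨K, hK⟩ hxc, ← hwK ⟨K, hK⟩ hxc]
  have e1 : ∑ p : T.nodes, w p * T.hat p x = ∑ p ∈ T.nodes, w p * K.nodalAff p x := by
    rw [← Finset.sum_coe_sort T.nodes fun p => w p * K.nodalAff p x]
    exact Finset.sum_congr rfl fun p _ => by rw [T.hat_eq hK hxc]
  rw [e1, K.sum_mul_nodalAff]
  have e2 : ∀ i, (if K i ∈ T.nodes then w (K i) * K.coord i x else 0)
      = K.coord i x * a ⟨K, hK⟩ (K i) := by
    intro i
    rw [← hwK ⟨K, hK⟩ (K.vertex_mem_cell i)]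
    split_ifs with h
    · exact mul_comm _ _
    · rw [hwΩ (K i) fun h' => h (T.mem_nodes.2 ⟨⟨K, hK, i, rfl⟩, h'⟩), mul_zero]
  rw [Finset.sum_congr rfl fun i _ => e2 i, hwK ⟨K, hK⟩ hxc]
  conv_lhs => rw [← K.affineCombination_coord_eq_self x]
  rw [Finset.map_affineCombination _ _ _ (K.sum_coord_apply_eq_one x),
    Finset.affineCombination_eq_linear_combination _ _ _ (K.sum_coord_apply_eq_one x)]
  rfl

theorem hat_node {p q : Euc n} (hp : p ∈ T.nodes) [Decidable (p = q)] :
    T.hat q p = if p = q then 1 else 0 := by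
  obtain ⟨⟨K, hK, i, rfl⟩, -⟩ := T.mem_nodes.1 hp
  rw [T.hat_eq hK (K.vertex_mem_cell i), K.nodalAff_apply_vertex]

/-- The hat functions of the interior vertices are linearly independent. -/
theorem sum_basis_injective (hB : ∀ p, fn (B p) =ᵐ[volume.restrict Ω] T.hat p)
    (hΩo : IsOpen Ω) (hΩ : interior (closure Ω) = Ω) {w w' : T.nodes → ℝ}
    (h : ∑ p, w p • B p = ∑ p, w' p • B p) : w = w' := by
  classical
  have hc : ∀ w : T.nodes → ℝ, Continuous fun x => ∑ p, w p * T.hat p x := fun w =>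
    continuous_finsetSum _ fun p _ => by
      obtain ⟨L, hL⟩ := T.exists_lipschitzWith_hat hΩo hΩ (T.mem_nodes.1 p.2).2
      exact continuous_const.mul hL.continuous
  have heq : EqOn (fun x => ∑ p, w p * T.hat p x) (fun x => ∑ p, w' p * T.hat p x) Ω := by
    refine Measure.eqOn_open_of_ae_eq (μ := volume) ?_ hΩo (hc w).continuousOn (hc w').continuousOn
    filter_upwards [fn_sum_basis hB w, fn_sum_basis hB w'] with x h1 h2
    rw [← h1, ← h2, h]
  have hval : ∀ (w : T.nodes → ℝ) (q : T.nodes), ∑ p, w p * T.hat p q = w q := by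
    intro w q
    rw [Finset.sum_eq_single q]
    · rw [hat_node q.2, if_pos rfl, mul_one]
    · intro p _ hp
      rw [hat_node q.2, if_neg fun h => hp (Subtype.ext h.symm), mul_zero]
    · simp
  funext q
  rw [← hval w q, ← hval w' q]
  exact heq (T.mem_nodes.1 q.2).2

end Basis

end Mesh

end FiniteElements

end MFG

end

/-! ### Acute elements and the discrete maximum principle -/

noncomputable section

namespace MFG

open MeasureTheory Set
open scoped ContDiff ENNReal

open Filter Topology

section DiscreteMaximumPrinciple

variable {n : ℕ} {Ω : Set (Euc n)}

theorem exists_pos_le_of_finite {ι : Type*} [Finite ι] (h : ι → ℝ) (P : ι → Prop)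
    (hh : ∀ i, P i → 0 < h i) : ∃ s > 0, ∀ i, P i → s ≤ h i := by
  classical
  rcases isEmpty_or_nonempty ι with hι | hι
  · exact ⟨1, one_pos, fun i => (hι.false i).elim⟩
  obtain ⟨i, hi⟩ := Finite.exists_min fun i => if P i then h i else 1
  refine ⟨if P i then h i else 1, ?_, fun j hj => ?_⟩
  · split_ifs with hP
    · exact hh i hP
    · exact one_pos
  · have := hi j
    rwa [if_pos hj] at this

theorem exists_nonneg_ge_of_finite {ι : Type*} [Finite ι] (h : ι → ℝ) :
    ∃ C ≥ 0, ∀ i, h i ≤ C := by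
  obtain ⟨C, hC⟩ := Set.finite_range h |>.bddAbove
  exact ⟨max C 0, le_max_right _ _, fun i => (hC ⟨i, rfl⟩).trans (le_max_left _ _)⟩

namespace Simp

variable (K : Simp n)

theorem inner_hatGrad (i : Fin (n + 1)) (x y : Euc n) :
    inner ℝ (K.hatGrad i) (x - y) = K.coord i x - K.coord i y := by
  rw [show K.hatGrad i = affGrad (K.coord i) from rfl, inner_affGrad]
  exact (K.coord i).linearMap_vsub x y

theorem sum_hatGrad : ∑ i, K.hatGrad i = 0 := by
  refine ext_inner_right ℝ fun y => ?_
  rw [sum_inner, inner_zero_left, Finset.sum_congr rfl fun i _ => by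
    rw [← sub_zero y, K.inner_hatGrad i y 0], Finset.sum_sub_distrib, K.sum_coord_apply_eq_one,
    K.sum_coord_apply_eq_one, sub_self]

/-- The hat function drops from one to zero between its vertex and any other, over a distance of at
most the diameter. -/
theorem one_le_diam_mul (hn : 1 ≤ n) (i : Fin (n + 1)) : 1 ≤ K.diam * ‖K.hatGrad i‖ := by
  have : Nontrivial (Fin (n + 1)) := Fin.nontrivial_iff_two_le.2 (by omega)
  obtain ⟨j, hj⟩ := exists_ne i
  have h1 := K.inner_hatGrad i (K i) (K j)
  rw [K.coord_apply_eq, K.coord_apply_ne (Ne.symm hj), sub_zero] at h1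
  rw [← h1, mul_comm]
  refine (real_inner_le_norm _ _).trans (mul_le_mul_of_nonneg_left ?_ (norm_nonneg _))
  rw [← dist_eq_norm]
  exact Metric.dist_le_diam_of_mem K.isCompact_cell.isBounded (K.vertex_mem_cell i)
    (K.vertex_mem_cell j)

theorem diam_pos (hn : 1 ≤ n) : 0 < K.diam := by
  have := K.one_le_diam_mul hn 0
  by_contra hcon
  have h := mul_nonpos_of_nonpos_of_nonneg (not_lt.1 hcon) (norm_nonneg (K.hatGrad 0))
  linarith

theorem sigma_le (i : Fin (n + 1)) : K.sigma ≤ K.diam * ‖K.hatGrad i‖ :=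
  mul_le_mul_of_nonneg_left (ciInf_le (Set.finite_range _).bddBelow i) Metric.diam_nonneg

theorem one_le_sigma (hn : 1 ≤ n) : 1 ≤ K.sigma := by
  have hd := K.diam_pos hn
  have : 1 / K.diam ≤ ⨅ i, ‖K.hatGrad i‖ := le_ciInf fun i => by
    rw [div_le_iff₀ hd, mul_comm]; exact K.one_le_diam_mul hn i
  rw [sigma]
  rwa [div_le_iff₀ hd, mul_comm] at this

/-- A lower bound for the diffusion and drift terms tested with a nodal function. -/
theorem lower_bound {d β s C X l : ℝ} (hβ : 0 ≤ β) (hX : 0 ≤ X) (hd : 0 ≤ d) (hs : 0 ≤ s)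
    (hl : l ≤ 1) {i : Fin (n + 1)}
    (hneg : ∀ j, j ≠ i → s ≤ -(d * inner ℝ (K.hatGrad j) (K.hatGrad i) + β * ‖K.hatGrad j‖))
    (hC : ∀ j, d * |inner ℝ (K.hatGrad j) (K.hatGrad i)| + β * ‖K.hatGrad j‖ ≤ C)
    (c : Fin (n + 1) → ℝ) (hc : ∀ j, -X ≤ c i - c j) (j : Fin (n + 1)) :
    s * (c i - c j) - (n + 1) * (C * X) ≤ d * inner ℝ (∑ k, c k • K.hatGrad k) (K.hatGrad i)
      - β * ‖∑ k, c k • K.hatGrad k‖ * l := by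
  have hC0 : 0 ≤ C := le_trans (by positivity) (hC i)
  -- The hat gradients sum to zero, so only differences with the value at `i` matter. Non-negative
  -- differences gain at least `s` times themselves, while each negative one costs at most `C * X`.
  have e1 : ∑ k, c k • K.hatGrad k = -∑ k, (c i - c k) • K.hatGrad k := by
    simp only [sub_smul, Finset.sum_sub_distrib, ← Finset.smul_sum, K.sum_hatGrad, smul_zero,
      zero_sub, neg_neg]
  set t : Fin (n + 1) → ℝ := fun k => -(d * (c i - c k) * inner ℝ (K.hatGrad k) (K.hatGrad i))
    - β * (|c i - c k| * ‖K.hatGrad k‖) with ht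
  have h1 : ∑ k, t k ≤ d * inner ℝ (∑ k, c k • K.hatGrad k) (K.hatGrad i)
      - β * ‖∑ k, c k • K.hatGrad k‖ * l := by
    have h2 : ‖∑ k, c k • K.hatGrad k‖ ≤ ∑ k, |c i - c k| * ‖K.hatGrad k‖ := by
      rw [e1, norm_neg]
      refine (norm_sum_le _ _).trans (le_of_eq (Finset.sum_congr rfl fun k _ => ?_))
      rw [norm_smul, Real.norm_eq_abs]
    have h3 : β * ‖∑ k, c k • K.hatGrad k‖ * l ≤ ∑ k, β * (|c i - c k| * ‖K.hatGrad k‖) := by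
      rw [← Finset.mul_sum]
      refine le_trans (mul_le_of_le_one_right (by positivity) hl) ?_
      exact mul_le_mul_of_nonneg_left h2 hβ
    have h4 : d * inner ℝ (∑ k, c k • K.hatGrad k) (K.hatGrad i)
        = ∑ k, -(d * (c i - c k) * inner ℝ (K.hatGrad k) (K.hatGrad i)) := by
      rw [e1, inner_neg_left, sum_inner, mul_neg, Finset.mul_sum, ← Finset.sum_neg_distrib]
      refine Finset.sum_congr rfl fun k _ => ?_
      rw [inner_smul_left, RCLike.conj_to_real]
      ring
    rw [ht, Finset.sum_sub_distrib]
    linarith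
  have hpos : ∀ k, 0 ≤ c i - c k → s * (c i - c k) ≤ t k := by
    intro k hk
    by_cases hki : k = i
    · simp [ht, hki]
    · have := mul_le_mul_of_nonneg_right (hneg k hki) hk
      simp only [ht]
      rw [abs_of_nonneg hk]
      linarith
  have hnonpos : ∀ k, c i - c k ≤ 0 → -(C * X) ≤ t k := by
    intro k hk
    have h2 : |c i - c k| ≤ X := by rw [abs_of_nonpos hk]; linarith [hc k]
    have h3 : (c i - c k) * inner ℝ (K.hatGrad k) (K.hatGrad i)
        ≤ |c i - c k| * |inner ℝ (K.hatGrad k) (K.hatGrad i)| := by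
      rw [← abs_mul]; exact le_abs_self _
    have h4 := mul_le_mul_of_nonneg_left h3 hd
    have h5 := mul_le_mul_of_nonneg_left (hC k) (abs_nonneg (c i - c k))
    have h6 := mul_le_mul_of_nonneg_right h2 hC0
    simp only [ht]
    linarith
  have hCX : 0 ≤ C * X := mul_nonneg hC0 hX
  have h5 : ∀ k, 0 ≤ t k + C * X := fun k => by
    rcases le_total 0 (c i - c k) with hk | hk
    · have := hpos k hk
      have := mul_nonneg hs hk
      linarith
    · linarith [hnonpos k hk]
  have h6 : s * (c i - c j) ≤ t j + C * X := by
    rcases le_total 0 (c i - c j) with hk | hk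
    · linarith [hpos j hk]
    · have := mul_nonpos_of_nonneg_of_nonpos hs hk
      linarith [hnonpos j hk]
  have h7 := Finset.single_le_sum (fun k _ => h5 k) (Finset.mem_univ j)
  rw [Finset.sum_add_distrib, Finset.sum_const, Finset.card_univ, Fintype.card_fin,
    nsmul_eq_mul] at h7
  push_cast at h7
  linarith

end Simp

namespace Mesh

variable {T : Mesh Ω}

theorem sigma_le {K : Simp n} (hK : K ∈ T.elements) : T.sigma ≤ K.sigma :=
  ciInf_le (f := fun K : {K // K ∈ T.elements} => K.1.sigma) (Set.finite_range _).bddBelow ⟨K, hK⟩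

theorem one_le_sigma (hn : 1 ≤ n) {K : Simp n} (hK : K ∈ T.elements) : 1 ≤ T.sigma :=
  have : Nonempty {K // K ∈ T.elements} := ⟨⟨K, hK⟩⟩
  le_ciInf fun K => K.1.one_le_sigma hn

/-- The artificial diffusion dominates drift and reaction on strictly acute elements. -/
theorem diffusion_dominates (hn : 1 ≤ n) {ν κ μ θ β : ℝ} (hν : 0 < ν) (hκ : 0 ≤ κ) (hμ : 1 < μ)
    (hβ : 0 ≤ β) (hθ : θ ∈ Ioo 0 (Real.pi / 2)) (hT : T.StrictlyAcute θ) {K : Simp n}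
    (hK : K ∈ T.elements) {i j : Fin (n + 1)} (hij : i ≠ j) :
    (ν + T.gammaOn ν κ μ θ β K) * inner ℝ (K.hatGrad i) (K.hatGrad j) + β * ‖K.hatGrad i‖ + κ
      < 0 := by
  have hS : 0 < Real.sin θ := Real.sin_pos_of_pos_of_lt_pi hθ.1
    (by linarith [hθ.2, Real.pi_pos])
  have hac := hT K hK i j hij
  have hD := K.diam_pos hn
  have hσ1 := T.one_le_sigma hn hK
  have hσ : 0 < T.sigma := by linarith
  have hσj : T.sigma ≤ K.diam * ‖K.hatGrad j‖ := (T.sigma_le hK).trans (K.sigma_le j)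
  have hσi : 1 ≤ K.diam * ‖K.hatGrad i‖ := K.one_le_diam_mul hn i
  rw [gammaOn]
  set S := Real.sin θ
  set D := K.diam
  set σ := T.sigma
  set a := ‖K.hatGrad i‖
  set b := ‖K.hatGrad j‖
  have ha : 0 < a := by
    by_contra hcon
    have := mul_nonpos_of_nonneg_of_nonpos hD.le (not_lt.1 hcon)
    linarith
  have hb : 0 < b := by
    by_contra hcon
    have := mul_nonpos_of_nonneg_of_nonpos hD.le (not_lt.1 hcon)
    linarith
  set Q := (β * D + κ * D ^ 2) / (σ * S) with hQ
  have hQ0 : 0 ≤ Q := by positivity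
  set d := ν + max (μ * Q - ν) 0 with hd
  have hd1 : μ * Q ≤ d := by linarith [le_max_left (μ * Q - ν) 0]
  have hd2 : ν ≤ d := by linarith [le_max_right (μ * Q - ν) 0]
  -- Strictness has two sources: `ν > 0` when drift and reaction both vanish, and `μ > 1` otherwise.
  have hdQ : Q < d := by
    rcases hQ0.eq_or_lt with h | h
    · rw [← h]; linarith
    · nlinarith
  have h1 : d * inner ℝ (K.hatGrad i) (K.hatGrad j) ≤ d * (-S * a * b) :=
    mul_le_mul_of_nonneg_left hac (by linarith)
  have h2 : Q * (S * a * b) < d * (S * a * b) := mul_lt_mul_of_pos_right hdQ (by positivity)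
  -- The acuteness factor cancels the denominator; what remains uses `D * b ≥ σ` for one gradient
  -- and `D * a ≥ 1` for the reaction term.
  have h3 : β * a + κ ≤ Q * (S * a * b) := by
    have e1 : Q * (S * a * b) = (β * a + κ * (D * a)) * (D * b / σ) := by
      rw [hQ]; field_simp
    have h4 : 1 ≤ D * b / σ := by rwa [le_div_iff₀ hσ, one_mul]
    have h5 : β * a + κ ≤ β * a + κ * (D * a) := by nlinarith
    rw [e1]
    have h6 : 0 ≤ β * a + κ * (D * a) := by positivity
    nlinarith
  linarith

/-- Every interior vertex has a neighbour that is higher in a given direction. -/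
theorem exists_higher_neighbour (hΩo : IsOpen Ω) {η : Euc n} (hη : η ≠ 0) {p : Euc n}
    (hp : p ∈ T.nodes) :
    ∃ K ∈ T.elements, ∃ i j, K i = p ∧ inner ℝ η (K i) < inner ℝ η (K j) := by
  obtain ⟨⟨K₀, hK₀, i₀, rfl⟩, hpΩ⟩ := T.mem_nodes.1 hp
  have hlim : Tendsto (fun s : ℝ => K₀ i₀ + s • η) (𝓝[>] 0) (𝓝 (K₀ i₀)) := by
    have : Tendsto (fun s : ℝ => K₀ i₀ + s • η) (𝓝 0) (𝓝 (K₀ i₀ + (0 : ℝ) • η)) :=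
      Continuous.tendsto (by fun_prop) 0
    rw [zero_smul, add_zero] at this
    exact this.mono_left nhdsWithin_le_nhds
  obtain ⟨s, ⟨h1, h2⟩, hs⟩ := ((hlim.eventually (hΩo.mem_nhds hpΩ)).and
    (hlim.eventually T.eventually_mem_cell)).and self_mem_nhdsWithin |>.exists
  have hs : 0 < s := hs
  obtain ⟨K, hK, hsK⟩ := T.exists_mem_cell (subset_closure h1)
  obtain ⟨i, hi⟩ := T.mem_range_of_mem_cell hK₀ hK (h2 K hK hsK)
  refine ⟨K, hK, i, ?_⟩
  by_contra hcon
  push Not at hcon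
  have hsub : range K ⊆ {y | inner ℝ η y ≤ inner ℝ η (K i)} := by
    rintro _ ⟨j, rfl⟩
    exact hcon j hi
  have hconv : Convex ℝ {y | inner ℝ η y ≤ inner ℝ η (K i)} :=
    (convex_Iic (inner ℝ η (K i))).is_linear_preimage (innerSL ℝ η).toLinearMap.isLinear
  have := convexHull_min hsub hconv hsK
  change inner ℝ η (K₀ i₀ + s • η) ≤ inner ℝ η (K i) at this
  rw [hi, inner_add_right, inner_smul_right, real_inner_self_eq_norm_sq] at this
  have := mul_pos hs (pow_pos (norm_pos_iff.2 hη) 2)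
  linarith

end Mesh

end DiscreteMaximumPrinciple

end MFG

end

/-! ### The exponential supersolution -/

noncomputable section

namespace MFG

open MeasureTheory Set
open scoped ContDiff ENNReal

open Filter Topology

section Supersolution

variable {n : ℕ} {Ω : Set (Euc n)}

namespace Mesh

variable (T : Mesh Ω)

/-- The gradient of the hat function of the vertex `p`. -/
def gradHat (p x : Euc n) : Euc n := T.pw (fun K => affGrad (K.nodalAff p)) x

variable {T}

theorem gradHat_vertex {K : Simp n} (hK : K ∈ T.elements) {x : Euc n} (hx : x ∈ interior K.cell)
    (i : Fin (n + 1)) : T.gradHat (K i) x = K.hatGrad i := by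
  rw [gradHat, T.pw_eq _ hK hx, K.nodalAff_vertex]
  rfl

theorem affGrad_zero : affGrad (0 : Euc n →ᵃ[ℝ] ℝ) = 0 := by
  have := affGrad_sum_smul (n := n) (∅ : Finset ℕ) (fun _ => 0) fun _ => 0
  simpa using this

theorem gradHat_of_notMem {K : Simp n} (hK : K ∈ T.elements) {x : Euc n}
    (hx : x ∈ interior K.cell) {p : Euc n} (hp : p ∉ range K) : T.gradHat p x = 0 := by
  rw [gradHat, T.pw_eq _ hK hx, K.nodalAff_of_notMem hp, affGrad_zero]

theorem hat_of_notMem {K : Simp n} (hK : K ∈ T.elements) {x : Euc n}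
    (hx : x ∈ interior K.cell) {p : Euc n} (hp : p ∉ range K) : T.hat p x = 0 := by
  rw [T.hat_eq hK (interior_subset hx), K.nodalAff_of_notMem hp]
  rfl

theorem sum_smul_gradHat {K : Simp n} (hK : K ∈ T.elements) {x : Euc n}
    (hx : x ∈ interior K.cell) (w : Euc n → ℝ) [DecidableEq (Euc n)] :
    ∑ p : T.nodes, w p • T.gradHat p x
      = ∑ i, (if K i ∈ T.nodes then w (K i) else 0) • K.hatGrad i := by
  rw [Finset.sum_coe_sort T.nodes fun p => w p • T.gradHat p x]
  have := K.sum_smul_nodalAff T.nodes w affGrad affGrad_zero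
  simp only [gradHat, T.pw_eq _ hK hx]
  rw [this]
  refine Finset.sum_congr rfl fun i _ => ?_
  split_ifs
  · rfl
  · rw [zero_smul]

theorem bddMeas_hat (hΩo : IsOpen Ω) (hΩ : interior (closure Ω) = Ω) {p : Euc n}
    (hp : p ∈ Ω) : BddMeas (T.hat p) := by
  obtain ⟨L, hL⟩ := T.exists_lipschitzWith_hat hΩo hΩ hp
  refine ⟨hL.continuous.measurable, 1, fun x => ?_⟩
  rw [Real.norm_of_nonneg (T.hat_nonneg p x)]
  exact T.hat_le_one p x

/-- A discrete strict supersolution, of the form `M - exp (t ⟪η, x⟫)` at the interior vertices. -/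
theorem exists_supersolution (hn : 1 ≤ n) (hΩo : IsOpen Ω) (hΩb : Bornology.IsBounded Ω)
    (hΩ : interior (closure Ω) = Ω) {d : Euc n → ℝ} {D : Simp n → ℝ} {β κ : ℝ} (hβ : 0 ≤ β)
    (hκ : 0 ≤ κ) (hdm : BddMeas d) (hd : ∀ K ∈ T.elements, ∀ x ∈ interior K.cell, d x = D K)
    (hD : ∀ K ∈ T.elements, 0 ≤ D K)
    (hneg : ∀ K ∈ T.elements, ∀ i j, i ≠ j →
      D K * inner ℝ (K.hatGrad i) (K.hatGrad j) + β * ‖K.hatGrad i‖ < 0) :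
    ∃ e : T.nodes → ℝ, (∀ p, 0 < e p) ∧ ∀ p : T.nodes, 1 ≤ ∫ x in Ω,
      (d x * inner ℝ (∑ q, e q • T.gradHat q x) (T.gradHat p x)
        - β * ‖∑ q, e q • T.gradHat q x‖ * T.hat p x
        + κ * (∑ q, e q * T.hat q x) * T.hat p x) := by
  classical
  have hfin : IsFiniteMeasure (volume.restrict Ω) :=
    ⟨by rw [Measure.restrict_apply_univ]; exact hΩb.measure_lt_top⟩
  obtain ⟨η, hη⟩ : ∃ η : Euc n, η ≠ 0 := by
    have : Nonempty (Fin n) := ⟨⟨0, hn⟩⟩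
    exact exists_ne 0
  obtain ⟨s, hs, hs'⟩ := exists_pos_le_of_finite
    (fun a : T.elements × Fin (n + 1) × Fin (n + 1) =>
      -(D a.1.1 * inner ℝ (a.1.1.hatGrad a.2.1) (a.1.1.hatGrad a.2.2)
        + β * ‖a.1.1.hatGrad a.2.1‖)) (fun a => a.2.1 ≠ a.2.2)
    fun a ha => neg_pos.2 (hneg a.1.1 a.1.2 _ _ ha)
  obtain ⟨C, hC0, hC⟩ := exists_nonneg_ge_of_finite
    (fun a : T.elements × Fin (n + 1) × Fin (n + 1) =>
      D a.1.1 * |inner ℝ (a.1.1.hatGrad a.2.1) (a.1.1.hatGrad a.2.2)|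
        + β * ‖a.1.1.hatGrad a.2.1‖)
  obtain ⟨v, hv, hv'⟩ := exists_pos_le_of_finite
    (fun K : T.elements => (volume.restrict Ω).real (interior K.1.cell)) (fun _ => True)
    fun K _ => by
      rw [Measure.real, Measure.restrict_apply isOpen_interior.measurableSet,
        inter_eq_left.2 (interior_cell_subset hΩ K.2)]
      refine ENNReal.toReal_pos (isOpen_interior.measure_pos _ K.1.nonempty_interior_cell).ne' ?_
      exact (hΩb.subset (interior_cell_subset hΩ K.2)).measure_lt_top.ne
  obtain ⟨δ, hδ, hδ'⟩ := exists_pos_le_of_finite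
    (fun a : T.elements × Fin (n + 1) × Fin (n + 1) =>
      inner ℝ η (a.1.1 a.2.2) - inner ℝ η (a.1.1 a.2.1))
    (fun a => inner ℝ η (a.1.1 a.2.1) < inner ℝ η (a.1.1 a.2.2)) fun a ha => sub_pos.2 ha
  obtain ⟨R, hR0, hR⟩ := exists_nonneg_ge_of_finite (fun p : T.nodes => -inner ℝ η (p : Euc n))
  set W := (volume.restrict Ω).real univ with hW
  have hW0 : 0 ≤ W := measureReal_nonneg
  -- The steepness is chosen so that the gain `v * s * (t * δ)` on one element with a higher vertex
  -- beats the loss `(n + 1) * C` over all of `Ω` by exactly one, before the common factor `X p`.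
  set t := ((n + 1) * C * W + 1) / (v * s * δ) with ht
  have ht0 : 0 ≤ t := by positivity
  have htv : v * s * (t * δ) = (n + 1) * C * W + 1 := by
    rw [ht]; field_simp
  set X : Euc n → ℝ := fun q => Real.exp (t * (inner ℝ η q + R)) with hX
  have hXpos : ∀ q, 0 < X q := fun q => Real.exp_pos _
  obtain ⟨M₀, hM₀, hM₀'⟩ := exists_nonneg_ge_of_finite
    (fun a : T.elements × Fin (n + 1) => X (a.1.1 a.2))
  set M := M₀ + 1 with hM
  have hXM : ∀ K ∈ T.elements, ∀ i, X (K i) < M := fun K hK i => by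
    have := hM₀' (⟨K, hK⟩, i)
    simp only at this
    linarith
  have hE : ∀ p : T.nodes, 0 < M - X p := fun p => by
    obtain ⟨⟨K, hK, i, hi⟩, -⟩ := T.mem_nodes.1 p.2
    rw [← hi]
    linarith [hXM K hK i]
  refine ⟨fun p => M - X p, hE, fun p => ?_⟩
  set I : Euc n → ℝ := fun x => d x * inner ℝ (∑ q : T.nodes, (M - X q) • T.gradHat q x)
    (T.gradHat p x) - β * ‖∑ q : T.nodes, (M - X q) • T.gradHat q x‖ * T.hat p x
    + κ * (∑ q : T.nodes, (M - X q) * T.hat q x) * T.hat p x with hI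
  -- The shift `R` makes the exponent non-negative at interior vertices, so a surplus of `X p` is at
  -- least one.
  have hXp : 1 ≤ X p := Real.one_le_exp (mul_nonneg ht0 (by linarith [hR p]))
  have hpt : ∀ K ∈ T.elements, ∀ x ∈ interior K.cell, ∀ i j, K i = p →
      s * (X (K j) - X p) - (n + 1) * (C * X p) ≤ I x := by
    intro K hK x hx i j hi
    -- Boundary vertices carry the value zero, which is below `M - X`; this only helps the
    -- differences from the interior vertex `i`.
    set c : Fin (n + 1) → ℝ := fun k => if K k ∈ T.nodes then M - X (K k) else 0 with hc
    have hci : c i = M - X p := by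
      simp only [hc]
      rw [hi, if_pos p.2]
    have hck : ∀ k, X (K k) - X p ≤ c i - c k := fun k => by
      rw [hci]
      simp only [hc]
      split_ifs
      · linarith
      · linarith [hXM K hK k]
    have h1 := K.lower_bound (d := D K) (l := T.hat p x) (C := C) hβ (hXpos p).le (hD K hK) hs.le
      (T.hat_le_one p x) (fun j hj => hs' (⟨K, hK⟩, j, i) hj) (fun j => hC (⟨K, hK⟩, j, i)) c
      (fun k => by linarith [hck k, hXpos (K k)]) j
    have h2 := mul_le_mul_of_nonneg_left (hck j) hs.le
    have h3 : 0 ≤ κ * (∑ q : T.nodes, (M - X q) * T.hat q x) * T.hat p x :=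
      mul_nonneg (mul_nonneg hκ (Finset.sum_nonneg fun q _ =>
        mul_nonneg (hE q).le (T.hat_nonneg q x))) (T.hat_nonneg p x)
    simp only [hI]
    rw [hd K hK x hx, sum_smul_gradHat hK hx fun q => M - X q]
    rw [show T.gradHat p x = K.hatGrad i by rw [← hi, gradHat_vertex hK hx]]
    linarith
  obtain ⟨K, hK, i, j, hi, hij⟩ := T.exists_higher_neighbour hΩo hη p.2
  have hXj : X p * (t * δ) ≤ X (K j) - X p := by
    have h1 : X (K j) = X p * Real.exp (t * (inner ℝ η (K j) - inner ℝ η (K i))) := by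
      simp only [hX]
      rw [← Real.exp_add, ← hi]
      congr 1
      ring
    have h2 := mul_le_mul_of_nonneg_left (hδ' (⟨K, hK⟩, i, j) hij) ht0
    simp only at h2
    have h3 := Real.add_one_le_exp (t * (inner ℝ η (K j) - inner ℝ η (K i)))
    rw [h1]
    have h4 := mul_le_mul_of_nonneg_left (h2.trans (le_sub_iff_add_le.2 h3)) (hXpos p).le
    linarith
  have hCX : 0 ≤ (n + 1) * (C * X p) := by have := hXpos p; positivity
  set a := s * (X (K j) - X p)
  have hle : ∀ᵐ x ∂volume.restrict Ω, (interior K.cell).indicator (fun _ => a) x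
      + -((n + 1) * (C * X p)) ≤ I x := by
    filter_upwards [T.ae_mem_interior hΩo] with x ⟨K', hK', hx⟩
    by_cases hxK : x ∈ interior K.cell
    · rw [indicator_of_mem hxK]
      linarith [hpt K hK x hxK i j hi]
    · rw [indicator_of_notMem hxK]
      by_cases hp : (p : Euc n) ∈ range K'
      · obtain ⟨l, hl⟩ := hp
        have := hpt K' hK' x hx l l hl
        rw [hl, sub_self, mul_zero] at this
        linarith
      · simp only [hI]
        rw [gradHat_of_notMem hK' hx hp, hat_of_notMem hK' hx hp]
        simp only [inner_zero_right, mul_zero, sub_zero, add_zero]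
        linarith
  have hbI : BddMeas I := by
    have hh : ∀ q : T.nodes, BddMeas (T.hat q) := fun q =>
      bddMeas_hat hΩo hΩ (T.mem_nodes.1 q.2).2
    have hg : ∀ q : T.nodes, BddMeas (T.gradHat q) := fun q => T.bddMeas_pw _
    have hs : BddMeas fun x => ∑ q : T.nodes, (M - X q) • T.gradHat q x :=
      BddMeas.sum fun q _ => (BddMeas.const _).smul (hg q)
    have hs' : BddMeas fun x => ∑ q : T.nodes, (M - X q) * T.hat q x :=
      BddMeas.sum fun q _ => (BddMeas.const _).mul (hh q)
    exact ((hdm.mul (hs.inner (hg p))).sub (((BddMeas.const β).mul hs.norm).mul (hh p))).add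
      (((BddMeas.const κ).mul hs').mul (hh p))
  have hi1 : Integrable ((interior K.cell).indicator fun _ => a) (volume.restrict Ω) :=
    (integrable_const a).indicator isOpen_interior.measurableSet
  refine le_trans ?_ (integral_mono_ae (hi1.add (integrable_const _)) hbI.integrable hle)
  simp only [Pi.add_apply]
  rw [integral_add hi1 (integrable_const _), integral_const,
    integral_indicator_const a isOpen_interior.measurableSet, smul_eq_mul, smul_eq_mul, ← hW]
  have h0 : 0 ≤ X p * (t * δ) := mul_nonneg (hXpos p).le (mul_nonneg ht0 hδ.le)
  have h1 : v * (s * (X p * (t * δ))) ≤ (volume.restrict Ω).real (interior K.cell) * a :=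
    mul_le_mul (hv' ⟨K, hK⟩ trivial) (mul_le_mul_of_nonneg_left hXj hs.le)
      (mul_nonneg hs.le h0) measureReal_nonneg
  have h2 : v * (s * (X p * (t * δ))) = X p * ((n + 1) * C * W + 1) := by rw [← htv]; ring
  linarith

end Mesh

end Supersolution

end MFG

end

/-! ### The mesh discretisation in coefficients -/

noncomputable section

namespace MFG

open MeasureTheory Set
open scoped ContDiff ENNReal

open Filter Topology

section Discretisation

variable {n : ℕ} {Ω : Set (Euc n)}

namespace Mesh

variable {T : Mesh Ω}

/-- The finite element discretisation on a strictly acute mesh satisfies the requirements of a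
`Scheme`. -/
theorem exists_scheme (hn : 1 ≤ n) (hΩo : IsOpen Ω) (hΩb : Bornology.IsBounded Ω)
    (hΩ : interior (closure Ω) = Ω) {ν κ μ θ β : ℝ} (hν : 0 < ν) (hκ : 0 ≤ κ) (hμ : 1 < μ)
    (hβ : 0 ≤ β) (hθ : θ ∈ Ioo 0 (Real.pi / 2)) (hT : T.StrictlyAcute θ) :
    ∃ S : Scheme n T.nodes, S.ρ = volume.restrict Ω ∧ (S.ξ = fun p : T.nodes => T.hat p) ∧
      (S.g = fun p : T.nodes => T.gradHat p) ∧ (S.d = fun x => ν + T.gamma ν κ μ θ β x) ∧ S.κ = κ ∧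
      S.β = β := by
  have hdm : BddMeas fun x => ν + T.gamma ν κ μ θ β x :=
    (BddMeas.const ν).add (T.bddMeas_pw (T.gammaOn ν κ μ θ β))
  have hd : ∀ K ∈ T.elements, ∀ x ∈ interior K.cell,
      ν + T.gamma ν κ μ θ β x = ν + T.gammaOn ν κ μ θ β K := fun K hK x hx => by
    rw [← T.pw_eq (T.gammaOn ν κ μ θ β) hK hx]
    rfl
  have hdom : ∀ K ∈ T.elements, ∀ i j, i ≠ j → (ν + T.gammaOn ν κ μ θ β K)
      * inner ℝ (K.hatGrad i) (K.hatGrad j) + β * ‖K.hatGrad i‖ + κ < 0 :=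
    fun K hK i j hij => T.diffusion_dominates hn hν hκ hμ hβ hθ hT hK hij
  obtain ⟨e, he, hsuper⟩ := T.exists_supersolution hn hΩo hΩb hΩ hβ hκ hdm hd
    (fun K _ => add_nonneg hν.le (le_max_right _ _))
    fun K hK i j hij => by linarith [hdom K hK i j hij]
  refine ⟨{
    ρ := volume.restrict Ω
    finite := ⟨by rw [Measure.restrict_apply_univ]; exact hΩb.measure_lt_top⟩
    ξ := fun p => T.hat p
    g := fun p => T.gradHat p
    d := fun x => ν + T.gamma ν κ μ θ β x
    κ := κ
    β := β
    e := e
    β_nonneg := hβ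
    bddMeas_ξ := fun p => bddMeas_hat hΩo hΩ (T.mem_nodes.1 p.2).2
    bddMeas_g := fun p => T.bddMeas_pw _
    bddMeas_d := hdm
    ξ_nonneg := fun p x => T.hat_nonneg p x
    acute := ?_
    e_pos := he
    super := hsuper }, rfl, rfl, rfl, rfl, rfl, rfl⟩
  intro p q hpq
  filter_upwards [T.ae_mem_interior hΩo] with x ⟨K, hK, hx⟩
  by_cases hp : (p : Euc n) ∈ range K
  · by_cases hq : (q : Euc n) ∈ range K
    · obtain ⟨i, hi⟩ := hp
      obtain ⟨j, hj⟩ := hq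
      have hij : i ≠ j := fun h => hpq (Subtype.ext (by rw [← hi, ← hj, h]))
      have h1 := hdom K hK i j hij
      rw [hd K hK x hx, ← hi, ← hj, gradHat_vertex hK hx, gradHat_vertex hK hx]
      have h2 : β * ‖K.hatGrad i‖ * T.hat (K j) x ≤ β * ‖K.hatGrad i‖ :=
        mul_le_of_le_one_right (by positivity) (T.hat_le_one _ _)
      have h3 : κ * T.hat (K i) x * T.hat (K j) x ≤ κ := by
        rw [mul_assoc]
        exact mul_le_of_le_one_right hκ
          (mul_le_one₀ (T.hat_le_one _ _) (T.hat_nonneg _ _) (T.hat_le_one _ _))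
      linarith
    · rw [gradHat_of_notMem hK hx hq, hat_of_notMem hK hx hq]
      simp
  · rw [gradHat_of_notMem hK hx hp, hat_of_notMem hK hx hp]
    simp

end Mesh

namespace Scheme

variable {ι : Type*} [Fintype ι] {S : Scheme n ι} {B : ι → H01 Ω} {h h' : Euc n → Euc n → ℝ}

theorem integral_hjb (hΩo : IsOpen Ω) (hρ : S.ρ = volume.restrict Ω)
    (hval : ∀ w, fn (∑ i, w i • B i) =ᵐ[volume.restrict Ω] S.val w)
    (hgr : ∀ w, grad (∑ i, w i • B i) =ᵐ[volume.restrict Ω] S.gr w) (hh : S.LipHam h)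
    (hh' : ∀ x ∈ Ω, h' x = h x) (u w : ι → ℝ) :
    ∫ x in Ω, (S.d x * inner ℝ (grad (∑ i, u i • B i) x) (grad (∑ i, w i • B i) x)
      + h' x (grad (∑ i, u i • B i) x) * fn (∑ i, w i • B i) x
      + S.κ * fn (∑ i, u i • B i) x * fn (∑ i, w i • B i) x) = ∑ i, w i * S.op h u i := by
  rw [hh.sum_op, hρ]
  refine integral_congr_ae ?_
  filter_upwards [hval u, hval w, hgr u, hgr w, ae_restrict_mem hΩo.measurableSet]
    with x e1 e2 e3 e4 hx
  rw [e1, e2, e3, e4, hh' x hx]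

theorem integral_kfp (hρ : S.ρ = volume.restrict Ω)
    (hval : ∀ w, fn (∑ i, w i • B i) =ᵐ[volume.restrict Ω] S.val w)
    (hgr : ∀ w, grad (∑ i, w i • B i) =ᵐ[volume.restrict Ω] S.gr w) {c c' : Euc n → Euc n}
    (hc : Measurable c) (hcβ : ∀ x, ‖c x‖ ≤ S.β) (hcc' : c' =ᵐ[volume.restrict Ω] c)
    (m w : ι → ℝ) :
    ∫ x in Ω, (S.d x * inner ℝ (grad (∑ i, m i • B i) x) (grad (∑ i, w i • B i) x)
      + fn (∑ i, m i • B i) x * inner ℝ (c' x) (grad (∑ i, w i • B i) x)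
      + S.κ * fn (∑ i, m i • B i) x * fn (∑ i, w i • B i) x)
        = ∑ i, m i * S.op (drift c) w i := by
  rw [(lipHam_drift hc hcβ).sum_op, hρ]
  refine integral_congr_ae ?_
  filter_upwards [hval m, hval w, hgr m, hgr w, hcc'] with x e1 e2 e3 e4 e5
  rw [e1, e2, e3, e4, e5, real_inner_comm, drift]
  ring

end Scheme

section Coefficients

variable {A : Type*}

/-- The coefficients are controlled only on `closure Ω`. Extending them by zero outside `Ω` makes
them bounded and measurable on the whole space without affecting integrals over `Ω`. -/
theorem hamiltonian_indicator (b : Euc n → A → Euc n) (f : Euc n → A → ℝ) {x : Euc n}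
    (hx : x ∈ Ω) : hamiltonian b f x = hamiltonian (fun x α => Ω.indicator (b · α) x)
      (fun x α => Ω.indicator (f · α) x) x := by
  funext p
  simp only [hamiltonian, indicator_of_mem hx]

theorem subdiff_indicator (b : Euc n → A → Euc n) (f : Euc n → A → ℝ) {x : Euc n}
    (hx : x ∈ Ω) : subdiff b f x = subdiff (fun x α => Ω.indicator (b · α) x)
      (fun x α => Ω.indicator (f · α) x) x := by
  funext p
  simp only [subdiff, hamiltonian_indicator b f hx]

theorem supNorm_nonneg (b : Euc n → A → Euc n) : 0 ≤ supNorm Ω b :=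
  Real.iSup_nonneg fun _ => norm_nonneg _

theorem measurable_indicator_of_continuousOn {F : Type*} [NormedAddCommGroup F]
    [MeasurableSpace F] [BorelSpace F] (hΩo : IsOpen Ω) {g : Euc n → F}
    (hg : ContinuousOn g Ω) : Measurable (Ω.indicator g) := by
  classical
  rw [← piecewise_eq_indicator]
  exact hg.measurable_piecewise continuousOn_const hΩo.measurableSet

/-- Compactness of `closure Ω ×ˢ univ` makes the suprema genuine, so that `supNorm` really bounds
the drift. -/
theorem controlData_indicator [MetricSpace A] [CompactSpace A] (hΩo : IsOpen Ω)
    (hΩb : Bornology.IsBounded Ω) {b : Euc n → A → Euc n} {f : Euc n → A → ℝ}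
    (hb : ContinuousOn (fun p : Euc n × A => b p.1 p.2) (closure Ω ×ˢ univ))
    (hf : ContinuousOn (fun p : Euc n × A => f p.1 p.2) (closure Ω ×ˢ univ)) :
    ControlData (fun x α => Ω.indicator (b · α) x) (fun x α => Ω.indicator (f · α) x)
      (supNorm Ω b) := by
  have hcomp : IsCompact (closure Ω ×ˢ (univ : Set A)) := hΩb.isCompact_closure.prod isCompact_univ
  obtain ⟨Cb, hCb⟩ := hcomp.exists_bound_of_continuousOn hb
  obtain ⟨Cf, hCf⟩ := hcomp.exists_bound_of_continuousOn hf
  have hx1 : ∀ {F : Type} [TopologicalSpace F] {g : Euc n → A → F},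
      ContinuousOn (fun p : Euc n × A => g p.1 p.2) (closure Ω ×ˢ univ) →
      ∀ α, ContinuousOn (g · α) Ω := fun hg α =>
    hg.comp (f := fun x => (x, α)) (by fun_prop) fun x hx => ⟨subset_closure hx, mem_univ _⟩
  have hx2 : ∀ {F : Type} [TopologicalSpace F] {g : Euc n → A → F},
      ContinuousOn (fun p : Euc n × A => g p.1 p.2) (closure Ω ×ˢ univ) →
      ∀ x ∈ Ω, Continuous (g x) := fun hg x hx =>
    hg.comp_continuous (f := fun α => (x, α)) (by fun_prop) fun α =>
      ⟨subset_closure hx, mem_univ _⟩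
  refine ⟨fun α => measurable_indicator_of_continuousOn hΩo (hx1 hb α),
    fun α => measurable_indicator_of_continuousOn hΩo (hx1 hf α), fun x => ?_, fun x => ?_,
    fun x α => ?_, max Cf 0, fun x α => ?_⟩
  · by_cases hx : x ∈ Ω
    · simpa only [indicator_of_mem hx] using hx2 hb x hx
    · simpa only [indicator_of_notMem hx] using continuous_const
  · by_cases hx : x ∈ Ω
    · simpa only [indicator_of_mem hx] using hx2 hf x hx
    · simpa only [indicator_of_notMem hx] using continuous_const
  · by_cases hx : x ∈ Ω
    · rw [indicator_of_mem hx]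
      refine le_ciSup (f := fun p : closure Ω × A => ‖b p.1 p.2‖) ⟨Cb, ?_⟩
        (⟨x, subset_closure hx⟩, α)
      rintro _ ⟨p, rfl⟩
      exact hCb (p.1, p.2) ⟨p.1.2, mem_univ _⟩
    · rw [indicator_of_notMem hx, norm_zero]
      exact supNorm_nonneg b
  · by_cases hx : x ∈ Ω
    · rw [indicator_of_mem hx]
      exact (hCf (x, α) ⟨subset_closure hx, mem_univ _⟩).trans (le_max_left _ _)
    · rw [indicator_of_notMem hx, abs_zero]
      exact le_max_right _ _

end Coefficients

theorem continuous_fn : Continuous (fn (Ω := Ω)) :=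
  (WithLp.prod_continuous_ofLp 2 _ _).fst.comp continuous_subtype_val

theorem sum_mul_apply {ι : Type*} [Fintype ι] (L : HMinus1 Ω) (B : ι → H01 Ω) (w : ι → ℝ) :
    ∑ i, w i * L (B i) = L (∑ i, w i • B i) := by
  rw [map_sum]
  exact Finset.sum_congr rfl fun i _ => by rw [map_smul, smul_eq_mul]

variable {A : Type*} [MetricSpace A] [CompactSpace A] [Nonempty A]

/-- The discrete problem in terms of coefficients with respect to the nodal basis. -/
theorem Mesh.isDiscreteSolution_iff {T : Mesh Ω} {S : Scheme n T.nodes} {B : T.nodes → H01 Ω}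
    {b : Euc n → A → Euc n} {f : Euc n → A → ℝ} {ν κ μ θ : ℝ} (hΩo : IsOpen Ω)
    (hΩb : Bornology.IsBounded Ω) (hΩ : interior (closure Ω) = Ω)
    (hB : ∀ p, fn (B p) =ᵐ[volume.restrict Ω] T.hat p)
    (hb : ContinuousOn (fun p : Euc n × A => b p.1 p.2) (closure Ω ×ˢ univ))
    (hf : ContinuousOn (fun p : Euc n × A => f p.1 p.2) (closure Ω ×ˢ univ))
    (hρ : S.ρ = volume.restrict Ω) (hξ : S.ξ = fun p : T.nodes => T.hat p)
    (hg : S.g = fun p : T.nodes => T.gradHat p)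
    (hd : S.d = fun x => ν + T.gamma ν κ μ θ (supNorm Ω b) x) (hκ : S.κ = κ)
    (hβ : S.β = supNorm Ω b) (F : L2 Ω → HMinus1 Ω) (G : HMinus1 Ω) (u m : T.nodes → ℝ) :
    T.IsDiscreteSolution b f ν κ μ θ F G (∑ p, u p • B p) (∑ p, m p • B p) ↔
      ∃ c : Euc n → Euc n, Measurable c ∧ (∀ x, ‖c x‖ ≤ S.β) ∧
        (∀ᵐ x ∂S.ρ, c x ∈ subdiff (fun x α => Ω.indicator (b · α) x)
          (fun x α => Ω.indicator (f · α) x) x (S.gr u x)) ∧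
        (S.op (hamiltonian (fun x α => Ω.indicator (b · α) x)
          (fun x α => Ω.indicator (f · α) x)) u = fun p => F (fn (∑ p, m p • B p)) (B p)) ∧
        ∀ w, ∑ p, m p * S.op (Scheme.drift c) w p = ∑ p, G (B p) * w p := by
  classical
  have hfin : IsFiniteMeasure (volume.restrict Ω) :=
    ⟨by rw [Measure.restrict_apply_univ]; exact hΩb.measure_lt_top⟩
  have hc := controlData_indicator hΩo hΩb hb hf
  have hval : ∀ w, fn (∑ p, w p • B p) =ᵐ[volume.restrict Ω] S.val w := fun w => by
    filter_upwards [fn_sum_basis hB w] with x hx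
    rw [hx, Scheme.val, hξ]
  have hgr : ∀ w, grad (∑ p, w p • B p) =ᵐ[volume.restrict Ω] S.gr w := fun w => by
    filter_upwards [grad_sum_basis hB hΩo hΩb hΩ w] with x hx
    rw [hx, Scheme.gr, hg]
    rfl
  have hhjb : (∀ ψ ∈ T.V, ∫ x in Ω, ((ν + T.gamma ν κ μ θ (supNorm Ω b) x)
      * inner ℝ (grad (∑ p, u p • B p) x) (grad ψ x)
        + hamiltonian b f x (grad (∑ p, u p • B p) x) * fn ψ x
        + κ * fn (∑ p, u p • B p) x * fn ψ x) = F (fn (∑ p, m p • B p)) ψ) ↔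
      S.op (hamiltonian (fun x α => Ω.indicator (b · α) x) (fun x α => Ω.indicator (f · α) x)) u
        = fun p => F (fn (∑ p, m p • B p)) (B p) := by
    have key := Scheme.integral_hjb (B := B) hΩo hρ hval hgr
      (ControlData.lipHam (S := S) (by rw [hβ]; exact hc))
      (fun x hx => hamiltonian_indicator b f hx) u
    rw [hd, hκ] at key
    refine ⟨fun h => ?_, fun h ψ hψ => ?_⟩
    · funext p
      have := (key (Pi.single p 1)).symm.trans (h _ (sum_basis_mem_V hB _))
      rw [← sum_mul_apply] at this
      simpa [Pi.single_apply] using this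
    · obtain ⟨w, rfl⟩ := exists_coeff hB hΩo hΩb hΩ hψ
      rw [← sum_mul_apply]
      refine (key w).trans ?_
      rw [h]
  have hkfp : ∀ c c' : Euc n → Euc n, Measurable c → (∀ x, ‖c x‖ ≤ S.β) →
      c' =ᵐ[volume.restrict Ω] c →
      ((∀ φ ∈ T.V, ∫ x in Ω, ((ν + T.gamma ν κ μ θ (supNorm Ω b) x)
        * inner ℝ (grad (∑ p, m p • B p) x) (grad φ x)
        + fn (∑ p, m p • B p) x * inner ℝ (c' x) (grad φ x)
        + κ * fn (∑ p, m p • B p) x * fn φ x) = G φ) ↔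
      ∀ w, ∑ p, m p * S.op (Scheme.drift c) w p = ∑ p, G (B p) * w p) := by
    intro c c' hcm hcβ hcc'
    have key := Scheme.integral_kfp (B := B) hρ hval hgr hcm hcβ hcc' m
    rw [hd, hκ] at key
    have hGw : ∀ w : T.nodes → ℝ, ∑ p, G (B p) * w p = G (∑ p, w p • B p) := fun w => by
      rw [← sum_mul_apply]
      exact Finset.sum_congr rfl fun p _ => mul_comm _ _
    refine ⟨fun h w => ?_, fun h φ hφ => ?_⟩
    · rw [← key w, hGw]
      exact h _ (sum_basis_mem_V hB w)
    · obtain ⟨w, rfl⟩ := exists_coeff hB hΩo hΩb hΩ hφ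
      rw [← hGw, ← h w]
      exact key w
  constructor
  · rintro ⟨-, -, c, hcs, hu, hm⟩
    have hcmeas : Measurable c := (Lp.stronglyMeasurable c).measurable
    have hset : MeasurableSet {x | ‖c x‖ ≤ S.β} := measurableSet_le hcmeas.norm measurable_const
    have hcs' : ∀ᵐ x ∂volume.restrict Ω, c x ∈ subdiff (fun x α => Ω.indicator (b · α) x)
        (fun x α => Ω.indicator (f · α) x) x (S.gr u x) := by
      filter_upwards [hcs, hgr u, ae_restrict_mem hΩo.measurableSet] with x h1 h2 h3
      rwa [← h2, ← subdiff_indicator b f h3]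
    -- Subgradients are bounded by the Lipschitz constant of the Hamiltonian, so cutting the
    -- representative at `S.β` changes it only on a null set.
    have hcc' : c =ᵐ[volume.restrict Ω] {x | ‖c x‖ ≤ S.β}.indicator c := by
      filter_upwards [hcs'] with x hx
      rw [indicator_of_mem]
      change ‖c x‖ ≤ S.β
      rw [hβ]
      exact hc.norm_le_of_mem_subdiff hx
    have hcβ : ∀ x, ‖{x | ‖c x‖ ≤ S.β}.indicator c x‖ ≤ S.β := fun x => by
      by_cases hx : x ∈ {x | ‖c x‖ ≤ S.β}
      · rw [indicator_of_mem hx]; exact hx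
      · rw [indicator_of_notMem hx, norm_zero]; exact S.β_nonneg
    refine ⟨{x | ‖c x‖ ≤ S.β}.indicator c, hcmeas.indicator hset, hcβ, ?_, hhjb.1 hu,
      (hkfp _ _ (hcmeas.indicator hset) hcβ hcc').1 hm⟩
    rw [hρ]
    filter_upwards [hcs', hcc'] with x h1 h2
    rwa [← h2]
  · rintro ⟨c, hcm, hcβ, hcs, hu, hm⟩
    have hmem : MemLp c ∞ (volume.restrict Ω) := BddMeas.memLp ⟨hcm, S.β, hcβ⟩ ∞
    refine ⟨sum_basis_mem_V hB u, sum_basis_mem_V hB m, hmem.toLp c, ?_, hhjb.2 hu,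
      (hkfp c _ hcm hcβ hmem.coeFn_toLp).2 hm⟩
    rw [hρ] at hcs
    change ∀ᵐ x ∂volume.restrict Ω, _
    filter_upwards [hcs, hgr u, hmem.coeFn_toLp, ae_restrict_mem hΩo.measurableSet]
      with x h1 h2 h3 h4
    rwa [h2, h3, subdiff_indicator b f h4]

end Discretisation

end MFG

end

/-! ### Existence and uniqueness -/

theorem mainTheorem5 {n : ℕ} (hn : 2 ≤ n)
    {Ω : Set (MFG.Euc n)} (hΩ_open : IsOpen Ω) (hΩ_conn : IsConnected Ω)
    (hΩ_bdd : Bornology.IsBounded Ω) (hΩ_lip : MFG.HasLipschitzBoundary Ω)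
    {A : Type*} [MetricSpace A] [CompactSpace A] [Nonempty A]
    (b : MFG.Euc n → A → MFG.Euc n) (f : MFG.Euc n → A → ℝ)
    (hb : UniformContinuousOn (fun p : MFG.Euc n × A => b p.1 p.2) (closure Ω ×ˢ Set.univ))
    (hf : UniformContinuousOn (fun p : MFG.Euc n × A => f p.1 p.2) (closure Ω ×ˢ Set.univ))
    (ν κ : ℝ) (hν : 0 < ν) (hκ : 0 ≤ κ)
    (F : MFG.L2 Ω → MFG.HMinus1 Ω) (c₁ c₂ : ℝ) (hc₁ : 0 ≤ c₁) (hc₂ : 0 ≤ c₂)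
    (hF_growth : ∀ z : MFG.L2 Ω, ‖F z‖ ≤ c₁ * (‖z‖ + 1))
    (hF_lip : ∀ z₁ z₂ : MFG.L2 Ω, ‖F z₁ - F z₂‖ ≤ c₂ * ‖z₁ - z₂‖)
    (G : MFG.HMinus1 Ω)
    (T : ℕ → MFG.Mesh Ω) (θ : ℝ) (hθ : θ ∈ Set.Ioo 0 (Real.pi / 2))
    (hT : ∀ k, (T k).StrictlyAcute θ)
    (μ : ℝ) (hμ : 1 < μ)
    (hF_mono : MFG.StrictlyMonotone F) (hG : MFG.NonnegDistribution G) :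
    ∀ k, ∃! p : MFG.H01 Ω × MFG.H01 Ω,
      (T k).IsDiscreteSolution b f ν κ μ θ F G p.1 p.2 := by
  open MFG in
  intro k
  have hΩ := interior_closure_eq hΩ_open hΩ_lip
  obtain ⟨B, hB⟩ := (T k).exists_basis hΩ_open hΩ_bdd hΩ
  obtain ⟨S, hρ, hξ, hg, hd, hSκ, hβ⟩ := (T k).exists_scheme (by omega) hΩ_open hΩ_bdd hΩ hν hκ hμ
    (supNorm_nonneg b) hθ (hT k)
  have hiff := Mesh.isDiscreteSolution_iff hΩ_open hΩ_bdd hΩ hB hb.continuousOn hf.continuousOn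
    hρ hξ hg hd hSκ hβ F G
  have hc := controlData_indicator hΩ_open hΩ_bdd hb.continuousOn hf.continuousOn
  rw [← hβ] at hc
  have hFc : Continuous F := (LipschitzWith.of_dist_le_mul (f := F) (K := c₂.toNNReal) fun z w => by
    rw [Real.coe_toNNReal _ hc₂, dist_eq_norm z w]
    exact (dist_eq_norm (F z) (F w)).trans_le (hF_lip z w)).continuous
  have hΦsum : ∀ m w : (T k).nodes → ℝ, ∑ p, (F (fn (∑ p, m p • B p)) (B p)
      - F (fn (∑ p, w p • B p)) (B p)) * (m p - w p)
      = (F (fn (∑ p, m p • B p)) - F (fn (∑ p, w p • B p)))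
        (∑ p, m p • B p - ∑ p, w p • B p) := by
    intro m w
    rw [← Finset.sum_sub_distrib, Finset.sum_congr rfl fun p _ => (sub_smul (m p) (w p) (B p)).symm,
      ← sum_mul_apply _ B fun p => m p - w p]
    exact Finset.sum_congr rfl fun p _ => mul_comm _ _
  -- Strict monotonicity descends to coefficients because the hat functions are linearly
  -- independent. It also yields plain monotonicity: a negative pairing would force equal arguments
  -- and hence a zero pairing.
  have hΦ : ∀ m w : (T k).nodes → ℝ, ∑ p, (F (fn (∑ p, m p • B p)) (B p)
      - F (fn (∑ p, w p • B p)) (B p)) * (m p - w p) ≤ 0 → m = w := by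
    intro m w hmw
    rw [hΦsum] at hmw
    exact Mesh.sum_basis_injective hB hΩ_open hΩ (hF_mono _ _ hmw)
  have hGB : ∀ p, 0 ≤ G (B p) := fun p => hG (B p) (by
    filter_upwards [hB p] with x hx
    rw [hx]
    exact (T k).hat_nonneg p x)
  obtain ⟨u, m, c, hsol⟩ := Scheme.exists_solution hc
    (Φ := fun m p => F (fn (∑ p, m p • B p)) (B p)) (G := fun p => G (B p))
    (fun p => (hFc.comp (continuous_fn.comp (by fun_prop))).clm_apply continuous_const)
    (fun m w => by
      by_contra hcon
      have := hΦ m w (not_le.1 hcon).le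
      simp [this] at hcon)
    hGB
  refine ⟨(∑ p, u p • B p, ∑ p, m p • B p), (hiff u m).2 ⟨c, hsol⟩, ?_⟩
  rintro ⟨U, M⟩ hUM
  obtain ⟨u', rfl⟩ := Mesh.exists_coeff hB hΩ_open hΩ_bdd hΩ hUM.1
  obtain ⟨m', rfl⟩ := Mesh.exists_coeff hB hΩ_open hΩ_bdd hΩ hUM.2.1
  obtain ⟨c', hc'm, hc'β, hc's, hu', hm'⟩ := (hiff u' m').1 hUM
  obtain ⟨hcm, hcβ, hcs, hu, hm⟩ := hsol
  obtain ⟨rfl, rfl⟩ := Scheme.eq_of_solutions hc.lipHam hGB hΦ hc'm hc'β hcm hcβ hc's hcs hu' hu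
    hm' hm
  rfl
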